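/- **Theorem 1.2.** Let $n\ge 1$ and let $J=\begin{pmatrix}0&-\mathbb 1\\ \mathbb 1&0\end{pmatrix}$. Let $\mathcal S$ be the universal cover of $Sp(2n,\mathbb R)$, regarded as the group (under pointwise multiplication) of continuous paths $X:[0,1]\to Sp(2n,\mathbb R)$ with $X(0)=\mathbb 1$, up to homotopy with fixed end points. Let $\mathcal C\subset\mathcal S$ be the set of elements that have a representative $X$ with $\dot X(t)X(t)^{-1}=JH(t)$ on $[0,1]$, where $H$ is a smooth path of symmetric matrices and each $H(t)$ is positive semidefinite. For $x\in\mathcal S$ take a representative $X$ with polar decomposition $X(t)=U(t)P(t)$, where $U(t)\in U(n)$ (embedded by $A+iB\mapsto\begin{pmatrix}A&-B\\B&A\end{pmatrix}$) and $P(t)$ is symmetric positive definite, choose $\alpha$ continuous with $e^{2\pi i\alpha(t)}=\det_{\mathbb C}U(t)$, and put $\mu(x)=\alpha(1)-\alpha(0)$. Then $\mu$ is well defined on $\mathcal S$ and is a quasimorphism: $|\mu(xy)-\mu(x)-\mu(y)|\le R$ for some $R$ and all $x,y\in\mathcal S$. The limit $\tilde\mu(x)=\lim_{k\to\infty}\mu(x^k)/k$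 exists for all $x\in\mathcal S$. Moreover $\mathcal C$ is a normal cone (it contains $1$ and is closed under products and under conjugation by elements of $\mathcal S$), and the relation $f\ge g:\Leftrightarrow fg^{-1}\in\mathcal C$ is a bi-invariant partial order on $\mathcal S$. Let $\mathcal S^+$ be the set of dominants, that is, of all $f\in\mathcal C\setminus\{1\}$ such that for every $g\in\mathcal S$ there is $k\in\mathbb N$ with $f^k\ge g$. For $f,g\in\mathcal S^+$ put $$\gamma(f,g)=\lim_{k\to\infty}\frac{\gamma_k(f,g)}{k},\qquad \gamma_k(f,g)=\inf\{p\in\mathbb Z\mid f^p\ge g^k\},$$ $$K(f,g)=\max\{\log\gamma(f,g),\log\gamma(g,f)\}.$$ Then $K$ is a pseudo-distance on $\mathcal S^+$; let $(Z,d)$ be the metric space that it induces on the quotient of $\mathcal S^+$ by the relation $K(f,g)=0$. Then $\tilde\mu(X)>0$ for every $X\in\mathcal S^+$, and the map $[X]\mapsto\log\tilde\mu(X)$ is a well-defined isometry from $(Z,d)$ onto $\mathbb R$ with its standard metric. -/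

import Mathlib

open Filter Topology Set
open scoped unitInterval ContDiff

noncomputable section

/-! ### Partially ordered groups -/

/-- A normal cone in a group. -/
structure IsNormalCone {D : Type*} [Group D] (C : Set D) : Prop where
  mul_mem : ∀ f g, f ∈ C → g ∈ C → f * g ∈ C
  conj_mem : ∀ f h, f ∈ C → h * f * h⁻¹ ∈ C
  one_mem : (1 : D) ∈ C

/-- The relation `f ≥ g` induced by a subset `C` of a group: `f * g⁻¹ ∈ C`. -/
def ConeGE {D : Type*} [Group D] (C : Set D) (f g : D) : Prop := f * g⁻¹ ∈ C

/-- `C` is a normal cone whose relation is antisymmetric, that is, `ConeGE C` is a bi-invariant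
partial order (reflexivity and transitivity are automatic for normal cones). -/
structure IsOrderCone {D : Type*} [Group D] (C : Set D) : Prop extends IsNormalCone C where
  antisymm : ∀ f g, ConeGE C f g → ConeGE C g f → f = g

/-- The set of dominants. -/
def dominants {D : Type*} [Group D] (C : Set D) : Set D :=
  {f | f ∈ C ∧ f ≠ 1 ∧ ∀ g : D, ∃ n : ℕ, ConeGE C (f ^ n) g}

/-- `γ_n(f, g) = inf {p ∈ ℤ | f ^ p ≥ g ^ n}`. -/
def growthInf {D : Type*} [Group D] (C : Set D) (f g : D) (n : ℕ) : ℤ :=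
  sInf {p : ℤ | ConeGE C (f ^ p) (g ^ n)}

/-- The relative growth `γ(f, g) = lim γ_n(f, g) / n`. -/
def relGrowth {D : Type*} [Group D] (C : Set D) (f g : D) : ℝ :=
  limUnder atTop (fun n : ℕ => (growthInf C f g n : ℝ) / n)

/-- The pseudo-distance `K(f, g) = max {log γ(f, g), log γ(g, f)}`. -/
def growthDist {D : Type*} [Group D] (C : Set D) (f g : D) : ℝ :=
  max (Real.log (relGrowth C f g)) (Real.log (relGrowth C g f))

section OrderCone

variable {D : Type*} [Group D] {C : Set D}

theorem ConeGE.trans (hC : IsNormalCone C) {f g h : D} (h1 : ConeGE C f g)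
    (h2 : ConeGE C g h) : ConeGE C f h := by
  have := hC.mul_mem _ _ h1 h2
  simpa [ConeGE, mul_assoc] using this

theorem ConeGE.mul (hC : IsNormalCone C) {f g d e : D} (h1 : ConeGE C f g)
    (h2 : ConeGE C d e) : ConeGE C (f * d) (g * e) := by
  have := hC.mul_mem _ _ h1 (hC.conj_mem _ g h2)
  simpa [ConeGE, mul_assoc] using this

theorem ConeGE.pow (hC : IsNormalCone C) {f g : D} (h : ConeGE C f g) (n : ℕ) :
    ConeGE C (f ^ n) (g ^ n) := by
  induction n with
  | zero => simpa [ConeGE] using hC.one_mem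
  | succ n ih => rw [pow_succ, pow_succ]; exact ih.mul hC h

theorem IsNormalCone.pow_mem (hC : IsNormalCone C) {f : D} (h : f ∈ C) (n : ℕ) : f ^ n ∈ C := by
  have h1 : ConeGE C f 1 := by simpa [ConeGE] using h
  simpa [ConeGE] using h1.pow hC n

theorem IsOrderCone.nonneg_of_zpow_mem (hC : IsOrderCone C) {f : D} (hf : f ∈ C) (hf1 : f ≠ 1)
    {p : ℤ} (hp : f ^ p ∈ C) : 0 ≤ p := by
  by_contra hneg
  obtain ⟨k, hk⟩ : ∃ k : ℕ, p = -((k : ℤ) + 1) := ⟨(-p - 1).toNat, by omega⟩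
  have h1 : f⁻¹ ∈ C := by
    have h2 := hC.mul_mem _ _ (hC.pow_mem hf k) hp
    have h3 : f ^ k * f ^ p = f⁻¹ := by
      rw [← zpow_natCast, ← zpow_add, hk, ← zpow_neg_one]
      congr 1; ring
    rwa [h3] at h2
  exact hf1 (hC.antisymm f 1 (by simpa [ConeGE] using hf) (by simpa [ConeGE] using h1))

variable {f g h : D}

theorem IsOrderCone.nonneg_of_ge (hC : IsOrderCone C) (hf : f ∈ dominants C)
    (hg : g ∈ dominants C) {p : ℤ} {n : ℕ} (hp : ConeGE C (f ^ p) (g ^ n)) : 0 ≤ p := by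
  refine hC.nonneg_of_zpow_mem hf.1 hf.2.1 (p := p) ?_
  have h1 := hC.mul_mem _ _ hp (hC.pow_mem hg.1 n)
  simpa using h1

theorem IsOrderCone.growthInf_mem (hC : IsOrderCone C) (hf : f ∈ dominants C)
    (hg : g ∈ dominants C) (n : ℕ) : ConeGE C (f ^ growthInf C f g n) (g ^ n) := by
  obtain ⟨p, hp⟩ := hf.2.2 (g ^ n)
  exact Int.csInf_mem (s := {p : ℤ | ConeGE C (f ^ p) (g ^ n)})
    ⟨(p : ℤ), by simpa using hp⟩ ⟨0, fun q hq => hC.nonneg_of_ge hf hg hq⟩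

theorem IsOrderCone.growthInf_le (hC : IsOrderCone C) (hf : f ∈ dominants C)
    (hg : g ∈ dominants C) {p : ℤ} {n : ℕ} (hp : ConeGE C (f ^ p) (g ^ n)) :
    growthInf C f g n ≤ p :=
  csInf_le ⟨0, fun _ hq => hC.nonneg_of_ge hf hg hq⟩ hp

theorem IsOrderCone.growthInf_nonneg (hC : IsOrderCone C) (hf : f ∈ dominants C)
    (hg : g ∈ dominants C) (n : ℕ) : 0 ≤ growthInf C f g n :=
  hC.nonneg_of_ge hf hg (hC.growthInf_mem hf hg n)

theorem IsOrderCone.growthInf_subadditive (hC : IsOrderCone C) (hf : f ∈ dominants C)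
    (hg : g ∈ dominants C) : Subadditive (fun n : ℕ => (growthInf C f g n : ℝ)) := by
  intro m n
  have : growthInf C f g (m + n) ≤ growthInf C f g m + growthInf C f g n := by
    refine hC.growthInf_le hf hg ?_
    rw [zpow_add, pow_add]
    exact (hC.growthInf_mem hf hg m).mul hC.toIsNormalCone (hC.growthInf_mem hf hg n)
  change (growthInf C f g (m + n) : ℝ) ≤ growthInf C f g m + growthInf C f g n
  exact_mod_cast this

theorem IsOrderCone.bddBelow_growthInf (hC : IsOrderCone C) (hf : f ∈ dominants C)
    (hg : g ∈ dominants C) : BddBelow (range fun n : ℕ => (growthInf C f g n : ℝ) / n) := by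
  refine ⟨0, ?_⟩
  rintro _ ⟨n, rfl⟩
  have : (0 : ℝ) ≤ growthInf C f g n := by exact_mod_cast hC.growthInf_nonneg hf hg n
  positivity

/-- The limit that defines the relative growth of two dominants exists. -/
theorem IsOrderCone.tendsto_relGrowth (hC : IsOrderCone C) (hf : f ∈ dominants C)
    (hg : g ∈ dominants C) :
    Tendsto (fun n : ℕ => (growthInf C f g n : ℝ) / n) atTop (𝓝 (relGrowth C f g)) :=
  tendsto_nhds_limUnder
    ⟨_, (hC.growthInf_subadditive hf hg).tendsto_lim (hC.bddBelow_growthInf hf hg)⟩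

theorem IsOrderCone.relGrowth_nonneg (hC : IsOrderCone C) (hf : f ∈ dominants C)
    (hg : g ∈ dominants C) : 0 ≤ relGrowth C f g := by
  refine ge_of_tendsto' (hC.tendsto_relGrowth hf hg) fun n => ?_
  have : (0 : ℝ) ≤ growthInf C f g n := by exact_mod_cast hC.growthInf_nonneg hf hg n
  positivity

theorem IsOrderCone.relGrowth_le (hC : IsOrderCone C) (hf : f ∈ dominants C)
    (hg : g ∈ dominants C) {p : ℤ} {n : ℕ} (hn : n ≠ 0) (hp : ConeGE C (f ^ p) (g ^ n)) :
    relGrowth C f g ≤ p / n := by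
  have hs := hC.growthInf_subadditive hf hg
  have hb := hC.bddBelow_growthInf hf hg
  rw [tendsto_nhds_unique (hC.tendsto_relGrowth hf hg) (hs.tendsto_lim hb)]
  refine (hs.lim_le_div hb hn).trans ?_
  have : (growthInf C f g n : ℝ) ≤ p := by exact_mod_cast hC.growthInf_le hf hg hp
  gcongr

theorem IsOrderCone.relGrowth_self (hC : IsOrderCone C) (hf : f ∈ dominants C) :
    relGrowth C f f = 1 := by
  refine tendsto_nhds_unique (hC.tendsto_relGrowth hf hf) ?_
  refine tendsto_const_nhds.congr' ?_
  filter_upwards [eventually_ne_atTop 0] with n hn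
  have h1 : growthInf C f f n = n := by
    apply le_antisymm
    · exact hC.growthInf_le hf hf (by simpa [ConeGE] using hC.one_mem)
    · have h2 := hC.growthInf_mem hf hf n
      rw [ConeGE, ← zpow_natCast, ← zpow_neg, ← zpow_add] at h2
      have := hC.nonneg_of_zpow_mem hf.1 hf.2.1 h2
      omega
  rw [h1]
  have : (n : ℝ) ≠ 0 := by exact_mod_cast hn
  simp [this]

theorem IsOrderCone.relGrowth_triangle (hC : IsOrderCone C) (hf : f ∈ dominants C)
    (hg : g ∈ dominants C) (hh : h ∈ dominants C) :
    relGrowth C f h ≤ relGrowth C f g * relGrowth C g h := by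
  refine ge_of_tendsto ((hC.tendsto_relGrowth hf hg).mul (hC.tendsto_relGrowth hg hh)) ?_
  filter_upwards [eventually_ne_atTop 0] with n hn
  obtain ⟨c, hc⟩ := Int.eq_ofNat_of_zero_le (hC.growthInf_nonneg hg hh n)
  have h1 := (hC.growthInf_mem hf hg n).pow hC.toIsNormalCone c
  have h2 := (hC.growthInf_mem hg hh n).pow hC.toIsNormalCone n
  rw [hc, zpow_natCast, ← pow_mul, ← pow_mul, mul_comm c n] at h2
  rw [← pow_mul, ← zpow_natCast, ← zpow_mul] at h1
  have h3 := hC.relGrowth_le hf hh (mul_ne_zero hn hn) (h1.trans hC.toIsNormalCone h2)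
  refine h3.trans (le_of_eq ?_)
  rw [hc]
  push_cast
  rw [div_mul_div_comm]

theorem IsOrderCone.relGrowth_pos (hC : IsOrderCone C) (hf : f ∈ dominants C)
    (hg : g ∈ dominants C) : 0 < relGrowth C f g := by
  have h1 := hC.relGrowth_triangle hf hg hf
  rw [hC.relGrowth_self hf] at h1
  rcases (hC.relGrowth_nonneg hf hg).eq_or_lt with h0 | h0
  · rw [← h0, zero_mul] at h1; linarith
  · exact h0

theorem IsOrderCone.log_relGrowth_triangle (hC : IsOrderCone C) (hf : f ∈ dominants C)
    (hg : g ∈ dominants C) (hh : h ∈ dominants C) :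
    Real.log (relGrowth C f h) ≤ Real.log (relGrowth C f g) + Real.log (relGrowth C g h) := by
  rw [← Real.log_mul (hC.relGrowth_pos hf hg).ne' (hC.relGrowth_pos hg hh).ne']
  exact Real.log_le_log (hC.relGrowth_pos hf hh) (hC.relGrowth_triangle hf hg hh)

end OrderCone

/-- The set of dominants of a bi-invariant partial order, to be equipped with the
pseudo-distance `K`. -/
structure DominantSpace {D : Type*} [Group D] {C : Set D} (_hC : IsOrderCone C) where
  /-- the underlying group element -/
  val : D
  mem : val ∈ dominants C

instance DominantSpace.instPseudoMetricSpace {D : Type*} [Group D] {C : Set D}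
    (hC : IsOrderCone C) : PseudoMetricSpace (DominantSpace hC) where
  dist f g := growthDist C f.val g.val
  dist_self f := by simp [growthDist, hC.relGrowth_self f.mem]
  dist_comm f g := max_comm _ _
  dist_triangle f g h := by
    refine max_le ?_ ?_
    · exact (hC.log_relGrowth_triangle f.mem g.mem h.mem).trans
        (add_le_add (le_max_left _ _) (le_max_left _ _))
    · rw [add_comm]
      exact (hC.log_relGrowth_triangle h.mem g.mem f.mem).trans
        (add_le_add (le_max_right _ _) (le_max_right _ _))

/-- The metric space `(Z, d)` of a bi-invariant partial order: the quotient of the set of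
dominants by the relation `K(f, g) = 0`, with the metric induced by `K`. -/
abbrev GrowthSpace {D : Type*} [Group D] {C : Set D} (hC : IsOrderCone C) : Type _ :=
  SeparationQuotient (DominantSpace hC)

/-- The point of `Z` represented by a dominant. -/
def GrowthSpace.mk {D : Type*} [Group D] {C : Set D} (hC : IsOrderCone C) (f : D)
    (hf : f ∈ dominants C) : GrowthSpace hC :=
  SeparationQuotient.mk (⟨f, hf⟩ : DominantSpace hC)

/-! ### Quasimorphisms -/

/-- A quasimorphism on a group. -/
def IsQuasimorphism {G : Type*} [Group G] (r : G → ℝ) : Prop :=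
  ∃ R : ℝ, ∀ f g : G, |r (f * g) - r f - r g| ≤ R

/-- The homogenization `lim r (x ^ k) / k` of a real function on a group. -/
def homogenization {G : Type*} [Group G] (r : G → ℝ) (x : G) : ℝ :=
  limUnder atTop (fun k : ℕ => r (x ^ k) / k)

/-! ### The universal cover of a topological group -/

/-- The group of continuous paths `[0, 1] → G` that start at the identity, with pointwise
multiplication. -/
def basedPaths (G : Type*) [TopologicalSpace G] [Group G] [IsTopologicalGroup G] :
    Subgroup C(I, G) where
  carrier := {γ | γ 0 = 1}
  mul_mem' := by
    intro a b ha hb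
    simp only [mem_ofPred_eq] at ha hb ⊢
    simp [ha, hb]
  one_mem' := rfl
  inv_mem' := by
    intro a ha
    simp only [mem_ofPred_eq] at ha ⊢
    simp [ha]

/-- Homotopy relative to the end points, as a congruence relation on `basedPaths G`. -/
def homotopyCon (G : Type*) [TopologicalSpace G] [Group G] [IsTopologicalGroup G] :
    Con (basedPaths G) where
  r γ δ := ContinuousMap.HomotopicRel γ.1 δ.1 {0, 1}
  iseqv := ⟨fun γ => ContinuousMap.HomotopicRel.refl γ.1, fun h => h.symm,
    fun h1 h2 => h1.trans h2⟩
  mul' := by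
    rintro a b c d ⟨F⟩ ⟨F'⟩
    exact ⟨{ toFun := fun p => F p * F' p
             continuous_toFun := F.continuous.mul F'.continuous
             map_zero_left := fun t => by simp
             map_one_left := fun t => by simp
             prop' := fun s t ht => by
              have h1 := F.eq_fst s ht
              have h2 := F'.eq_fst s ht
              simp only [ContinuousMap.coe_mk]
              rw [h1, h2]; rfl }⟩

/-- The universal cover of `G` with base point the identity: continuous paths starting at the
identity up to homotopy relative to the end points, with pointwise multiplication. -/
abbrev PathCover (G : Type*) [TopologicalSpace G] [Group G] [IsTopologicalGroup G] : Type _ :=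
  (homotopyCon G).Quotient

/-- The class of a path. -/
def PathCover.mk {G : Type*} [TopologicalSpace G] [Group G] [IsTopologicalGroup G]
    (γ : basedPaths G) : PathCover G :=
  (γ : (homotopyCon G).Quotient)

/-! ### The symplectic linear group -/

/-- The symplectic group `Sp(2n, ℝ)`. -/
abbrev SpGroup (n : ℕ) : Type := ↥(Matrix.symplecticGroup (Fin n) ℝ)

instance SpGroup.instIsTopologicalGroup (n : ℕ) : IsTopologicalGroup (SpGroup n) where
  continuous_inv := by
    refine Continuous.subtype_mk (f := fun A : SpGroup n =>
      -Matrix.J (Fin n) ℝ * (A.1).transpose * Matrix.J (Fin n) ℝ) ?_ _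
    fun_prop

/-- The universal cover of `Sp(2n, ℝ)`. -/
abbrev SpCover (n : ℕ) : Type := PathCover (SpGroup n)

/-- The matrix at time `t` of a path in `Sp(2n, ℝ)`; the time is clamped to `[0, 1]`. -/
def SpGroup.pathMatrix {n : ℕ} (γ : basedPaths (SpGroup n)) (t : ℝ) :
    Matrix (Fin n ⊕ Fin n) (Fin n ⊕ Fin n) ℝ :=
  (γ.1 (projIcc 0 1 zero_le_one t)).1

/-- The smooth path `H` of symmetric matrices (a time dependent quadratic Hamiltonian) generates
the path `X` in `Sp(2n, ℝ)`: one has `X' = J H X`, that is, `X' X⁻¹ = J H`, on `[0, 1]`, with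
`J = (0, -1; 1, 0)`. -/
structure Generates {n : ℕ} (H : ℝ → Matrix (Fin n ⊕ Fin n) (Fin n ⊕ Fin n) ℝ)
    (γ : basedPaths (SpGroup n)) : Prop where
  smooth : ∀ i j, ContDiffOn ℝ ∞ (fun t => H t i j) (Icc 0 1)
  symm : ∀ t ∈ Icc (0 : ℝ) 1, (H t).IsSymm
  deriv : ∀ t ∈ Icc (0 : ℝ) 1, ∀ i j,
    HasDerivWithinAt (fun s => SpGroup.pathMatrix γ s i j)
      ((Matrix.J (Fin n) ℝ * H t * SpGroup.pathMatrix γ t) i j) (Icc 0 1) t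

/-- The elements of the universal cover of `Sp(2n, ℝ)` that are generated by Hamiltonians which
are non-negative quadratic forms at each time. -/
def nonnegCone (n : ℕ) : Set (SpCover n) :=
  {x | ∃ γ : basedPaths (SpGroup n), PathCover.mk γ = x ∧
    ∃ H : ℝ → Matrix (Fin n ⊕ Fin n) (Fin n ⊕ Fin n) ℝ,
      Generates H γ ∧ ∀ t ∈ Icc (0 : ℝ) 1, (H t).PosSemidef}

/-! ### The Maslov quasimorphism -/

/-- The realization `A + iB ↦ (A, -B; B, A)` of complex matrices as real ones. -/
def realify {n : ℕ} (M : Matrix (Fin n) (Fin n) ℂ) : Matrix (Fin n ⊕ Fin n) (Fin n ⊕ Fin n) ℝ :=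
  Matrix.fromBlocks (M.map Complex.re) (-(M.map Complex.im)) (M.map Complex.im) (M.map Complex.re)

/-- `m` is a value `α(1) - α(0)`, where `X(t) = U(t) P(t)` is the polar decomposition of a path
`X` that represents `x` and `α` is continuous with `exp (2πi α(t)) = det U(t)`. -/
def IsMaslovValue {n : ℕ} (x : SpCover n) (m : ℝ) : Prop :=
  ∃ γ : basedPaths (SpGroup n), PathCover.mk γ = x ∧
    ∃ (U : I → Matrix (Fin n) (Fin n) ℂ) (P : I → Matrix (Fin n ⊕ Fin n) (Fin n ⊕ Fin n) ℝ)
      (α : C(I, ℝ)),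
      (∀ t, U t ∈ Matrix.unitaryGroup (Fin n) ℂ) ∧ (∀ t, (P t).PosDef) ∧
      (∀ t, (γ.1 t).1 = realify (U t) * P t) ∧
      (∀ t, Complex.exp (2 * Real.pi * Complex.I * (α t : ℂ)) = (U t).det) ∧
      m = α 1 - α 0

/-- The Maslov quasimorphism: the number `m` with `IsMaslovValue x m`. -/
def maslov {n : ℕ} (x : SpCover n) : ℝ := Classical.epsilon (IsMaslovValue x)

end

/-!
Write `c(X)` for the complex linear part of a real matrix `X` acting on `ℝ²ⁿ = ℂⁿ`, and
`psi X = det c(X)`. For a symplectic `X = U P` one has `c(X) = U c(P)` with `c(P)` positive definite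
(`posDef_complexPart`), so that `psi X` is a positive multiple of `det U`. Thus the Maslov number
is the variation of the argument of the continuous nonvanishing function `psi` along a path,
divided by `2π`; this explains why it is well defined (`existsUnique_isMaslovValue`). Everything
else compares this number with the cone, in three steps.

*Quasimorphism.* The antilinear part `X - c(X)` of a symplectic matrix is strictly smaller than
the linear one (`transpose_mul_complexPart_sub`). Hence the segment from `c(X) c(Y)` to `c(X Y)`
stays in the invertible matrices (`det_interpolate_ne_zero`), and its determinant is a polynomial
of degree at most `n` in the parameter, whose argument varies by at most `n / 2` turns
(`abs_maslov_mul_sub_le`).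

*The cone.* Along a path generated by `H` the logarithmic derivative of `psi` has the imaginary
part `tr (H X c(X)⁻¹) / 2`, and `c(X)ᵀ X = (Xᵀ X + 1) / 2` shows that this is non-negative for
`H ≥ 0`, and zero only for `H = 0` (`trace_inv_mul_complexPart`). So the elements of the cone have
non-negative Maslov number, and the cone defines a partial order (`isOrderCone_nonnegCone`).

*Domination.* Conversely, every element with Maslov number at least `2 n` lies in the cone
(`mem_nonnegCone_of_le_maslov`). By the normal form `exists_normalForm`, an element `x` is the
product of a power of a loop that rotates one coordinate, of a unitary one-parameter group with
angles in `[0, 2π]`, and of the class of a positive definite matrix; the power is at least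
`μ(x) - n`. The first two factors are in the cone when the power is non-negative, and `n` of the
rotations, which make up a full scalar rotation, absorb the positive definite factor: this factor
is a commutator with a quarter turn (`scalarRotation_mul_cayleyPath_mem`). For the normal form,
the class of the loop that closes up a path by its polar factors is locally constant in all
choices of these factors and of a diagonalization of the unitary one, which form a compact set
(`polarAngles`). Corrected by the power of the rotation loop it only depends on the time, so it is
constant on `[0, 1]` and hence trivial.

A cone that is squeezed in this way between two superlevel sets of a quasimorphism has the
relative growth `γ(f, g) = μ̃(g) / μ̃(f)` (`relGrowth_eq_div`), whence
`K(f, g) = |log μ̃(f) - log μ̃(g)|`. The scalar rotations realize all positive values of `μ̃`, so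
that `log μ̃` is onto.
-/

noncomputable section

/-! ### Realification and the complex linear part -/

section Realify

variable {n : ℕ}

open Matrix

/-- The complex linear part of a real matrix acting on `ℝ²ⁿ = ℂⁿ`, as a complex matrix. -/
def complexPart (X : Matrix (Fin n ⊕ Fin n) (Fin n ⊕ Fin n) ℝ) : Matrix (Fin n) (Fin n) ℂ :=
  Matrix.of fun i j => ⟨(X (.inl i) (.inl j) + X (.inr i) (.inr j)) / 2,
    (X (.inr i) (.inl j) - X (.inl i) (.inr j)) / 2⟩

theorem realify_one : realify (1 : Matrix (Fin n) (Fin n) ℂ) = 1 := by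
  ext (i | i) (j | j) <;> by_cases h : i = j <;> simp [realify, Matrix.one_apply, h]

theorem realify_mul (a b : Matrix (Fin n) (Fin n) ℂ) :
    realify (a * b) = realify a * realify b := by
  rw [realify, realify, realify, fromBlocks_multiply]
  congr 1 <;> ext i j <;>
    simp [Matrix.mul_apply, ← Finset.sum_add_distrib, ← Finset.sum_neg_distrib, sub_eq_add_neg,
      add_comm]

theorem realify_add (a b : Matrix (Fin n) (Fin n) ℂ) :
    realify (a + b) = realify a + realify b := by
  ext (i | i) (j | j) <;> simp [realify]; ring

theorem realify_conjTranspose (a : Matrix (Fin n) (Fin n) ℂ) :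
    realify aᴴ = (realify a)ᵀ := by
  ext (i | i) (j | j) <;> simp [realify]

theorem J_eq_realify : J (Fin n) ℝ = realify (Complex.I • (1 : Matrix (Fin n) (Fin n) ℂ)) := by
  ext (i | i) (j | j) <;> by_cases h : i = j <;> simp [realify, J, h]

theorem complexPart_realify (a : Matrix (Fin n) (Fin n) ℂ) : complexPart (realify a) = a := by
  ext i j
  apply Complex.ext <;> simp [complexPart, realify]

theorem realify_injective : Function.Injective (realify (n := n)) :=
  Function.LeftInverse.injective complexPart_realify

theorem complexPart_realify_mul (a : Matrix (Fin n) (Fin n) ℂ)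
    (X : Matrix (Fin n ⊕ Fin n) (Fin n ⊕ Fin n) ℝ) :
    complexPart (realify a * X) = a * complexPart X := by
  ext i j
  apply Complex.ext <;>
  · simp [complexPart, realify, Matrix.mul_apply, Fintype.sum_sum_type, Finset.sum_div,
      ← Finset.sum_add_distrib, ← Finset.sum_sub_distrib, ← Finset.sum_neg_distrib]
    refine Finset.sum_congr rfl fun k _ => ?_
    ring

theorem complexPart_mul_realify (a : Matrix (Fin n) (Fin n) ℂ)
    (X : Matrix (Fin n ⊕ Fin n) (Fin n ⊕ Fin n) ℝ) :
    complexPart (X * realify a) = complexPart X * a := by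
  ext i j
  apply Complex.ext <;>
  · simp [complexPart, realify, Matrix.mul_apply, Fintype.sum_sum_type, Finset.sum_div,
      ← Finset.sum_add_distrib, ← Finset.sum_sub_distrib, ← Finset.sum_neg_distrib]
    refine Finset.sum_congr rfl fun k _ => ?_
    ring

theorem complexPart_transpose (X : Matrix (Fin n ⊕ Fin n) (Fin n ⊕ Fin n) ℝ) :
    complexPart Xᵀ = (complexPart X)ᴴ := by
  ext i j
  apply Complex.ext <;> simp [complexPart]; ring

theorem trace_complexPart_re (X : Matrix (Fin n ⊕ Fin n) (Fin n ⊕ Fin n) ℝ) :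
    (complexPart X).trace.re = X.trace / 2 := by
  simp [complexPart, Matrix.trace, Fintype.sum_sum_type, ← Finset.sum_div, Finset.sum_add_distrib]

/-- The realification of the complex linear part averages `X` over conjugation by `J`. -/
theorem realify_complexPart (X : Matrix (Fin n ⊕ Fin n) (Fin n ⊕ Fin n) ℝ) :
    realify (complexPart X) = (1 / 2 : ℝ) • (X - J (Fin n) ℝ * X * J (Fin n) ℝ) := by
  obtain ⟨A, B, C, D, rfl⟩ : ∃ A B C D, X = fromBlocks A B C D :=
    ⟨_, _, _, _, (fromBlocks_toBlocks X).symm⟩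
  rw [J, fromBlocks_multiply, fromBlocks_multiply]
  ext (i | i) (j | j) <;> simp [realify, complexPart] <;> ring

theorem continuous_realify : Continuous (realify (n := n)) := by
  unfold realify
  fun_prop

theorem continuous_complexPart : Continuous (complexPart (n := n)) := by
  refine continuous_matrix fun i j => ?_
  simp only [complexPart, Matrix.of_apply]
  simp only [Complex.mk_eq_add_mul_I]
  fun_prop

theorem realify_mem_symplecticGroup {u : Matrix (Fin n) (Fin n) ℂ}
    (hu : u ∈ unitaryGroup (Fin n) ℂ) : realify u ∈ symplecticGroup (Fin n) ℝ := by
  rw [SymplecticGroup.mem_iff, J_eq_realify, ← realify_conjTranspose, ← realify_mul,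
    ← realify_mul]
  congr 1
  rw [mem_unitaryGroup_iff] at hu
  simpa [star_eq_conjTranspose] using hu

theorem realify_transpose_mul_self {u : Matrix (Fin n) (Fin n) ℂ}
    (hu : u ∈ unitaryGroup (Fin n) ℂ) : (realify u)ᵀ * realify u = 1 := by
  rw [← realify_conjTranspose, ← realify_mul, ← realify_one]
  congr 1
  rw [mem_unitaryGroup_iff'] at hu
  simpa [star_eq_conjTranspose] using hu

theorem realify_smul_one (r : ℝ) :
    realify ((r : ℂ) • (1 : Matrix (Fin n) (Fin n) ℂ)) = r • 1 := by
  ext (i | i) (j | j) <;> by_cases h : i = j <;> simp [realify, h]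

end Realify

/-! ### Polar decomposition of symplectic matrices -/

section LinearAlgebra

open Matrix
open scoped ComplexOrder

variable {n : ℕ}

section Sqrt

open scoped MatrixOrder

theorem posDef_exists_sqrt {m : Type*} [Fintype m] [DecidableEq m] {A : Matrix m m ℝ}
    (hA : A.PosDef) : ∃ P : Matrix m m ℝ, P.PosDef ∧ P * P = A := by
  have h0 : 0 ≤ A := nonneg_iff_posSemidef.2 hA.posSemidef
  have h1 : CFC.sqrt A * CFC.sqrt A = A := CFC.sqrt_mul_sqrt_self A h0
  have h2 : (CFC.sqrt A).PosSemidef := nonneg_iff_posSemidef.1 (CFC.sqrt_nonneg A)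
  refine ⟨CFC.sqrt A, h2.posDef_iff_isUnit.2 ?_, h1⟩
  have h3 := hA.isUnit
  rw [← h1] at h3
  exact isUnit_of_mul_isUnit_left h3

theorem posSemidef_eq_of_mul_self_eq {m : Type*} [Fintype m] [DecidableEq m] {A B : Matrix m m ℝ}
    (hA : A.PosSemidef) (hB : B.PosSemidef) (h : A * A = B * B) : A = B :=
  (CFC.mul_self_eq_mul_self_iff A B (nonneg_iff_posSemidef.2 hA) (nonneg_iff_posSemidef.2 hB)).1 h

end Sqrt

theorem SymplecticGroup.inv_mul {X : Matrix (Fin n ⊕ Fin n) (Fin n ⊕ Fin n) ℝ}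
    (hX : X ∈ symplecticGroup (Fin n) ℝ) : X⁻¹ * X = 1 :=
  Matrix.nonsing_inv_mul _ (SymplecticGroup.symplectic_det hX)

theorem SymplecticGroup.mul_inv {X : Matrix (Fin n ⊕ Fin n) (Fin n ⊕ Fin n) ℝ}
    (hX : X ∈ symplecticGroup (Fin n) ℝ) : X * X⁻¹ = 1 :=
  Matrix.mul_nonsing_inv _ (SymplecticGroup.symplectic_det hX)

/-- A positive definite square root of a symplectic matrix is symplectic. -/
theorem posDef_mem_symplecticGroup_of_mul_self {P : Matrix (Fin n ⊕ Fin n) (Fin n ⊕ Fin n) ℝ}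
    (hP : P.PosDef) (h : P * P ∈ symplecticGroup (Fin n) ℝ) : P ∈ symplecticGroup (Fin n) ℝ := by
  have hs : Pᵀ = P := by
    simpa [IsHermitian, conjTranspose_eq_transpose_of_trivial] using hP.isHermitian
  have hu : IsUnit P.det := (Matrix.isUnit_iff_isUnit_det P).1 hP.isUnit
  have hi : P * P⁻¹ = 1 := Matrix.mul_nonsing_inv _ hu
  set j := J (Fin n) ℝ
  have jj : j * j = -1 := J_squared _ _
  have h1 : P * P * j * (P * P) = j := by
    have := SymplecticGroup.mem_iff.1 h
    rwa [transpose_mul, hs] at this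
  -- `P` and `-J P⁻¹ J` are positive square roots of the same matrix
  have h2 : P = -(j * P⁻¹ * j) := by
    refine posSemidef_eq_of_mul_self_eq hP.posSemidef ?_ ?_
    · have := hP.inv.posSemidef.conjTranspose_mul_mul_same j
      rwa [conjTranspose_eq_transpose_of_trivial, J_transpose, Matrix.neg_mul, Matrix.neg_mul] at this
    · calc P * P = -(P * P * j * (P * P) * (P⁻¹ * P⁻¹) * j) := by
            rw [Matrix.mul_assoc (P * P * j), show P * P * (P⁻¹ * P⁻¹) = 1 by
              rw [Matrix.mul_assoc, ← Matrix.mul_assoc P P⁻¹, hi, Matrix.one_mul, hi],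
              Matrix.mul_one, Matrix.mul_assoc (P * P), jj]
            simp
        _ = -(j * (P⁻¹ * P⁻¹) * j) := by rw [h1]
        _ = _ := by
            rw [neg_mul_neg]
            simp only [Matrix.mul_assoc]
            rw [← Matrix.mul_assoc j j, jj]; simp
  rw [SymplecticGroup.mem_iff, hs]
  change P * j * P = j
  have h4 : j * P = P⁻¹ * j := by
    rw [h2, Matrix.mul_neg, ← Matrix.mul_assoc, ← Matrix.mul_assoc, jj, ← h2]; simp
  rw [Matrix.mul_assoc, h4, ← Matrix.mul_assoc, hi, Matrix.one_mul]

theorem realify_complexPart_of_commute {X : Matrix (Fin n ⊕ Fin n) (Fin n ⊕ Fin n) ℝ}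
    (h : J (Fin n) ℝ * X = X * J (Fin n) ℝ) : realify (complexPart X) = X := by
  rw [realify_complexPart, h, Matrix.mul_assoc, J_squared]
  ext i j
  simp
  ring

/-- The polar decomposition of a symplectic matrix. -/
theorem exists_polar {X : Matrix (Fin n ⊕ Fin n) (Fin n ⊕ Fin n) ℝ}
    (hX : X ∈ symplecticGroup (Fin n) ℝ) :
    ∃ (u : Matrix (Fin n) (Fin n) ℂ) (P : Matrix (Fin n ⊕ Fin n) (Fin n ⊕ Fin n) ℝ),
      u ∈ unitaryGroup (Fin n) ℂ ∧ P.PosDef ∧ X = realify u * P := by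
  have hXu : IsUnit X := (Matrix.isUnit_iff_isUnit_det X).2 (SymplecticGroup.symplectic_det hX)
  have hA : (Xᵀ * X).PosDef := by
    have := PosDef.conjTranspose_mul_self X (Matrix.mulVec_injective_of_isUnit hXu)
    rwa [conjTranspose_eq_transpose_of_trivial] at this
  obtain ⟨P, hP, hPP⟩ := posDef_exists_sqrt hA
  have hPs : P ∈ symplecticGroup (Fin n) ℝ := by
    refine posDef_mem_symplecticGroup_of_mul_self hP ?_
    rw [hPP]
    exact mul_mem (SymplecticGroup.transpose_mem hX) hX
  have hs : Pᵀ = P := by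
    simpa [IsHermitian, conjTranspose_eq_transpose_of_trivial] using hP.isHermitian
  have hi := SymplecticGroup.mul_inv hPs
  have hi' := SymplecticGroup.inv_mul hPs
  have hPi : P⁻¹ ∈ symplecticGroup (Fin n) ℝ := by
    have := (⟨P, hPs⟩ : symplecticGroup (Fin n) ℝ)⁻¹.2
    rwa [SymplecticGroup.coe_inv'] at this
  set W := X * P⁻¹ with hW
  have hWs : W ∈ symplecticGroup (Fin n) ℝ := mul_mem hX hPi
  have hWo : Wᵀ * W = 1 := by
    rw [hW, transpose_mul, transpose_nonsing_inv, hs, Matrix.mul_assoc, ← Matrix.mul_assoc Xᵀ,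
      ← hPP, ← Matrix.mul_assoc, ← Matrix.mul_assoc, hi', Matrix.one_mul, hi]
  have hJ : J (Fin n) ℝ * W = W * J (Fin n) ℝ := by
    have := SymplecticGroup.mem_iff.1 hWs
    calc J (Fin n) ℝ * W = W * J (Fin n) ℝ * Wᵀ * W := by rw [this]
      _ = _ := by rw [Matrix.mul_assoc, hWo, Matrix.mul_one]
  have hr := realify_complexPart_of_commute hJ
  refine ⟨complexPart W, P, ?_, hP, ?_⟩
  · rw [mem_unitaryGroup_iff', star_eq_conjTranspose]
    apply realify_injective
    rw [realify_mul, realify_conjTranspose, hr, hWo, realify_one]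
  · rw [hr, hW, Matrix.mul_assoc, hi', Matrix.mul_one]

/-- The polar decomposition is unique. -/
theorem polar_unique {u v : Matrix (Fin n) (Fin n) ℂ}
    {P Q : Matrix (Fin n ⊕ Fin n) (Fin n ⊕ Fin n) ℝ} (hu : u ∈ unitaryGroup (Fin n) ℂ)
    (hv : v ∈ unitaryGroup (Fin n) ℂ) (hP : P.PosDef) (hQ : Q.PosDef)
    (h : realify u * P = realify v * Q) : u = v ∧ P = Q := by
  have key : ∀ {w : Matrix (Fin n) (Fin n) ℂ} {R : Matrix (Fin n ⊕ Fin n) (Fin n ⊕ Fin n) ℝ},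
      w ∈ unitaryGroup (Fin n) ℂ → R.PosDef → (realify w * R)ᵀ * (realify w * R) = R * R := by
    intro w R hw hR
    have hs : Rᵀ = R := by
      simpa [IsHermitian, conjTranspose_eq_transpose_of_trivial] using hR.isHermitian
    rw [transpose_mul, hs, Matrix.mul_assoc, ← Matrix.mul_assoc _ (realify w),
      realify_transpose_mul_self hw, Matrix.one_mul]
  have h1 : P = Q := by
    refine posSemidef_eq_of_mul_self_eq hP.posSemidef hQ.posSemidef ?_
    rw [← key hu hP, ← key hv hQ, h]
  refine ⟨realify_injective ?_, h1⟩
  subst h1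
  exact hP.isUnit.mul_right_cancel h

theorem posDef_complexPart {P : Matrix (Fin n ⊕ Fin n) (Fin n ⊕ Fin n) ℝ} (hP : P.PosDef) :
    (complexPart P).PosDef := by
  have hs : Pᵀ = P := by
    simpa [IsHermitian, conjTranspose_eq_transpose_of_trivial] using hP.isHermitian
  have hh : (complexPart P).IsHermitian := by
    rw [IsHermitian, ← complexPart_transpose, hs]
  refine PosDef.of_dotProduct_mulVec_pos hh fun z hz => ?_
  rw [RCLike.pos_iff]
  refine ⟨?_, hh.im_star_dotProduct_mulVec_self z⟩
  set v : Fin n ⊕ Fin n → ℝ := Sum.elim (fun i => (z i).re) (fun i => (z i).im) with hv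
  set w : Fin n ⊕ Fin n → ℝ := Sum.elim (fun i => -(z i).im) (fun i => (z i).re) with hw
  have h1 : RCLike.re (star z ⬝ᵥ complexPart P *ᵥ z)
      = (star v ⬝ᵥ P *ᵥ v + star w ⬝ᵥ P *ᵥ w) / 2 := by
    simp only [dotProduct, mulVec, Fintype.sum_sum_type, hv, hw, Sum.elim_inl, Sum.elim_inr,
      complexPart, Pi.star_apply, star_trivial, Finset.mul_sum, ← Finset.sum_add_distrib,
      Finset.sum_div, Matrix.of_apply, map_sum]
    refine Finset.sum_congr rfl fun i _ => Finset.sum_congr rfl fun j _ => ?_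
    simp
    ring
  have h2 : ∃ i, z i ≠ 0 := by
    by_contra! h
    exact hz (funext h)
  have hvne : v ≠ 0 := by
    intro h
    obtain ⟨i, hi⟩ := h2
    apply hi
    apply Complex.ext
    · simpa [hv] using congrFun h (.inl i)
    · simpa [hv] using congrFun h (.inr i)
  rw [h1]
  have := hP.dotProduct_mulVec_pos hvne
  have := hP.posSemidef.dotProduct_mulVec_nonneg w
  linarith

/-- The determinant of the complex linear part of a real matrix. On the symplectic group its
argument is that of the determinant of the unitary factor of the polar decomposition. -/
def psi (X : Matrix (Fin n ⊕ Fin n) (Fin n ⊕ Fin n) ℝ) : ℂ := (complexPart X).det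

theorem continuous_psi : Continuous (psi (n := n)) := by
  unfold psi
  exact Continuous.matrix_det continuous_complexPart

theorem psi_one : psi (1 : Matrix (Fin n ⊕ Fin n) (Fin n ⊕ Fin n) ℝ) = 1 := by
  rw [psi, ← realify_one, complexPart_realify, det_one]

theorem norm_det_of_mem_unitaryGroup {u : Matrix (Fin n) (Fin n) ℂ}
    (hu : u ∈ unitaryGroup (Fin n) ℂ) : ‖u.det‖ = 1 := by
  have := Matrix.det_of_mem_unitary hu
  exact CStarRing.norm_of_mem_unitary this

/-- `psi` is a positive multiple of the determinant of the unitary polar factor, since the complex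
linear part of a positive definite matrix is positive definite. -/
theorem psi_realify_mul {u : Matrix (Fin n) (Fin n) ℂ}
    {P : Matrix (Fin n ⊕ Fin n) (Fin n ⊕ Fin n) ℝ} (hu : u ∈ unitaryGroup (Fin n) ℂ)
    (hP : P.PosDef) :
    psi (realify u * P) ≠ 0 ∧ psi (realify u * P) = ‖psi (realify u * P)‖ * u.det := by
  have h1 := (posDef_complexPart hP).det_pos
  have h2 : (complexPart P).det = ((complexPart P).det.re : ℂ) := by
    obtain ⟨_, h⟩ := RCLike.pos_iff.1 h1
    apply Complex.ext <;> simp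
    simpa using h
  have h3 : 0 < (complexPart P).det.re := (RCLike.pos_iff.1 h1).1
  have h4 := norm_det_of_mem_unitaryGroup hu
  rw [psi, complexPart_realify_mul, det_mul]
  refine ⟨mul_ne_zero ?_ h1.ne', ?_⟩
  · intro h; rw [h] at h4; simp at h4
  · rw [norm_mul, h4, one_mul, h2, Complex.norm_real, Real.norm_of_nonneg h3.le]
    ring

theorem psi_ne_zero {X : Matrix (Fin n ⊕ Fin n) (Fin n ⊕ Fin n) ℝ}
    (hX : X ∈ symplecticGroup (Fin n) ℝ) : psi X ≠ 0 := by
  obtain ⟨u, P, hu, hP, rfl⟩ := exists_polar hX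
  exact (psi_realify_mul hu hP).1

end LinearAlgebra

/-! ### Continuous arguments -/

section ArgLift

/-- `θ` is a continuous choice of `arg f / 2π`. -/
def IsArgLift {Y : Type*} [TopologicalSpace Y] (f : Y → ℂ) (θ : C(Y, ℝ)) : Prop :=
  ∀ y, f y = ‖f y‖ * Complex.exp (2 * Real.pi * Complex.I * (θ y : ℂ))

variable {Y : Type*} [TopologicalSpace Y]

theorem exists_isArgLift_of_simplyConnected [SimplyConnectedSpace Y] [LocallyPathConnectedSpace Y]
    {f : Y → ℂ} (hf : Continuous f) (h0 : ∀ y, f y ≠ 0) : ∃ θ : C(Y, ℝ), IsArgLift f θ := by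
  obtain ⟨y₀⟩ : Nonempty Y := inferInstance
  obtain ⟨F, ⟨-, hF⟩, -⟩ := Complex.isCoveringMap_exp.existsUnique_continuousMap_lifts
    (⟨fun y => (⟨f y, h0 y⟩ : {z : ℂ // z ≠ 0}), by fun_prop⟩ : C(Y, {z : ℂ // z ≠ 0}))
    (a₀ := y₀) (e₀ := Complex.log (f y₀)) (Subtype.ext (Complex.exp_log (h0 y₀)))
  refine ⟨⟨fun y => (F y).im / (2 * Real.pi), by fun_prop⟩, fun y => ?_⟩
  have h1 : Complex.exp (F y) = f y := congrArg Subtype.val (congrFun hF y)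
  have h2 : ‖f y‖ = Real.exp (F y).re := by rw [← h1, Complex.norm_exp]
  rw [h2, ← h1]
  push_cast
  rw [← Complex.exp_add]
  congr 1
  have : (Real.pi : ℂ) ≠ 0 := by exact_mod_cast Real.pi_ne_zero
  simp only [ContinuousMap.coe_mk]
  push_cast
  field_simp
  rw [mul_comm Complex.I]
  exact (Complex.re_add_im (F y)).symm

theorem exists_isArgLift {f : I → ℂ} (hf : Continuous f) (h0 : ∀ y, f y ≠ 0) :
    ∃ θ : C(I, ℝ), IsArgLift f θ := by
  obtain ⟨θ, hθ⟩ := exists_isArgLift_of_simplyConnected (Y := ℝ)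
    (f := fun t => f (projIcc 0 1 zero_le_one t)) (by fun_prop) fun _ => h0 _
  exact ⟨⟨fun t => θ t, by fun_prop⟩, fun t => by simpa using hθ t⟩

theorem exists_isArgLift_square {f : I × I → ℂ} (hf : Continuous f) (h0 : ∀ y, f y ≠ 0) :
    ∃ θ : C(I × I, ℝ), IsArgLift f θ := by
  obtain ⟨θ, hθ⟩ := exists_isArgLift_of_simplyConnected (Y := ℝ × ℝ)
    (f := fun t => f (projIcc 0 1 zero_le_one t.1, projIcc 0 1 zero_le_one t.2))
    (by fun_prop) fun _ => h0 _
  exact ⟨⟨fun t => θ (t.1, t.2), by fun_prop⟩, fun t => by simpa using hθ (t.1, t.2)⟩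

theorem IsArgLift.mul {f g : Y → ℂ} {θ η : C(Y, ℝ)} (hf : IsArgLift f θ) (hg : IsArgLift g η) :
    IsArgLift (fun y => f y * g y) (θ + η) := by
  intro y
  change f y * g y = ‖f y * g y‖ * _
  conv_lhs => rw [hf y, hg y]
  rw [norm_mul, ContinuousMap.add_apply]
  push_cast
  rw [mul_add, Complex.exp_add]
  ring

theorem exp_two_pi_eq_iff {a b : ℝ} : Complex.exp (2 * Real.pi * Complex.I * (a : ℂ))
    = Complex.exp (2 * Real.pi * Complex.I * (b : ℂ)) ↔ ∃ k : ℤ, a = b + k := by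
  rw [Complex.exp_eq_exp_iff_exists_int]
  refine exists_congr fun k => ?_
  have h : (2 * Real.pi * Complex.I : ℂ) ≠ 0 := by simp [Real.pi_ne_zero]
  rw [show (2 * Real.pi * Complex.I * (b : ℂ) + k * (2 * Real.pi * Complex.I) : ℂ)
    = 2 * Real.pi * Complex.I * (b + k) by ring, mul_right_inj' h]
  norm_cast

theorem isLocallyConstant_round {g : Y → ℝ} (hg : Continuous g) (h : ∀ y, ∃ k : ℤ, g y = k) :
    IsLocallyConstant fun y => round (g y) := by
  rw [IsLocallyConstant.iff_continuous]
  have h1 : ((↑) ∘ fun y => round (g y) : Y → ℝ) = g := by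
    ext y
    obtain ⟨k, hk⟩ := h y
    simp [hk]
  exact Int.isClosedEmbedding_coe_real.isEmbedding.continuous_iff.2 (by rw [h1]; exact hg)

/-- A continuous real function with integer values is constant. -/
theorem eq_of_forall_exists_int [PreconnectedSpace Y] {g : Y → ℝ} (hg : Continuous g)
    (h : ∀ y, ∃ k : ℤ, g y = k) (y z : Y) : g y = g z := by
  have h1 := (isLocallyConstant_round hg h).apply_eq_of_preconnectedSpace y z
  obtain ⟨k, hk⟩ := h y
  obtain ⟨l, hl⟩ := h z
  simp only [hk, hl, round_intCast] at h1
  rw [hk, hl, h1]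

theorem IsArgLift.exp_eq {f : Y → ℂ} {θ η : C(Y, ℝ)} (h0 : ∀ y, f y ≠ 0) (hθ : IsArgLift f θ)
    (hη : IsArgLift f η) (y : Y) : ∃ k : ℤ, θ y = η y + k := by
  rw [← exp_two_pi_eq_iff]
  have h : (‖f y‖ : ℂ) ≠ 0 := by simpa using h0 y
  exact mul_left_cancel₀ h ((hθ y).symm.trans (hη y))

theorem IsArgLift.sub_eq [PreconnectedSpace Y] {f : Y → ℂ} {θ η : C(Y, ℝ)} (h0 : ∀ y, f y ≠ 0)
    (hθ : IsArgLift f θ) (hη : IsArgLift f η) (y z : Y) : θ y - θ z = η y - η z := by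
  have := eq_of_forall_exists_int (g := fun y => θ y - η y) (by fun_prop) (fun y => by
    obtain ⟨k, hk⟩ := hθ.exp_eq h0 hη y
    exact ⟨k, by rw [hk]; ring⟩) y z
  linarith

/-- A continuous argument of a constant is constant. -/
theorem IsArgLift.eq_of_const [PreconnectedSpace Y] {f : Y → ℂ} {θ : C(Y, ℝ)} {c : ℂ} (hc : c ≠ 0)
    (hf : ∀ y, f y = c) (hθ : IsArgLift f θ) (y z : Y) : θ y = θ z := by
  have h1 : IsArgLift f (ContinuousMap.const Y (θ z)) := fun y => by
    have := hθ z
    rw [hf] at this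
    simpa [hf y] using this
  have := hθ.sub_eq (fun y => (hf y).trans_ne hc) h1 y z
  simpa [sub_eq_zero] using this

theorem IsArgLift.comp {Z : Type*} [TopologicalSpace Z] {f : Y → ℂ} {θ : C(Y, ℝ)}
    (hθ : IsArgLift f θ) (g : C(Z, Y)) : IsArgLift (f ∘ g) (θ.comp g) := fun z => hθ (g z)

end ArgLift

/-! ### The Maslov number -/

section Maslov

open Matrix
open scoped ComplexOrder

variable {n : ℕ}

theorem PathCover.mk_eq_mk {G : Type*} [TopologicalSpace G] [Group G] [IsTopologicalGroup G]
    {γ δ : basedPaths G} :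
    PathCover.mk γ = PathCover.mk δ ↔ ContinuousMap.HomotopicRel γ.1 δ.1 {0, 1} :=
  (homotopyCon G).eq

theorem PathCover.exists_mk {G : Type*} [TopologicalSpace G] [Group G] [IsTopologicalGroup G]
    (x : PathCover G) : ∃ γ, PathCover.mk γ = x := Quotient.exists_rep x

theorem continuous_psi_path (γ : basedPaths (SpGroup n)) : Continuous fun t => psi (γ.1 t).1 :=
  continuous_psi.comp (continuous_subtype_val.comp γ.1.continuous)

theorem psi_path_ne_zero (γ : basedPaths (SpGroup n)) (t : I) : psi (γ.1 t).1 ≠ 0 :=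
  psi_ne_zero (γ.1 t).2

/-- Along a path, the continuous arguments of `psi` are those of the determinant of the unitary
polar factor. -/
theorem isMaslovValue_of_isArgLift {γ : basedPaths (SpGroup n)} {θ : C(I, ℝ)}
    (h : IsArgLift (fun t => psi (γ.1 t).1) θ) :
    IsMaslovValue (PathCover.mk γ) (θ 1 - θ 0) := by
  choose U P hU hP hX using fun t => exists_polar (γ.1 t).2
  refine ⟨γ, rfl, U, P, θ, hU, hP, hX, fun t => ?_, rfl⟩
  have h1 := (psi_realify_mul (hU t) (hP t)).2
  have h2 := h t
  simp only [] at h2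
  rw [← hX t] at h1
  have h3 : (‖psi (γ.1 t).1‖ : ℂ) ≠ 0 := by simpa using psi_path_ne_zero γ t
  exact mul_left_cancel₀ h3 (h2.symm.trans h1)

theorem IsMaslovValue.exists_isArgLift {x : SpCover n} {m : ℝ} (h : IsMaslovValue x m) :
    ∃ (γ : basedPaths (SpGroup n)) (θ : C(I, ℝ)), PathCover.mk γ = x ∧
      IsArgLift (fun t => psi (γ.1 t).1) θ ∧ m = θ 1 - θ 0 := by
  obtain ⟨γ, hx, U, P, α, hU, hP, hX, hα, hm⟩ := h
  refine ⟨γ, α, hx, fun t => ?_, hm⟩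
  simp only []
  rw [hα, hX]
  exact (psi_realify_mul (hU t) (hP t)).2

/-- The total variation of the argument of `psi` is invariant under homotopies with fixed end
points. -/
theorem isArgLift_homotopic {γ δ : basedPaths (SpGroup n)}
    (h : ContinuousMap.HomotopicRel γ.1 δ.1 {0, 1}) {θ η : C(I, ℝ)}
    (hθ : IsArgLift (fun t => psi (γ.1 t).1) θ) (hη : IsArgLift (fun t => psi (δ.1 t).1) η) :
    θ 1 - θ 0 = η 1 - η 0 := by
  obtain ⟨F⟩ := h
  obtain ⟨Θ, hΘ⟩ := exists_isArgLift_square (f := fun p => psi (F p).1)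
    (continuous_psi.comp (continuous_subtype_val.comp F.continuous)) fun p => psi_ne_zero (F p).2
  -- the argument of `psi` does not change along the end points of the paths of the homotopy
  have hend : ∀ t : I, t ∈ ({0, 1} : Set I) → Θ (0, t) = Θ (1, t) := by
    intro t ht
    have h1 : IsArgLift _ (Θ.comp ⟨fun s => (s, t), by fun_prop⟩) := hΘ.comp _
    refine h1.eq_of_const (psi_path_ne_zero γ t) (fun s => ?_) 0 1
    exact congrArg (fun X : SpGroup n => psi X.1) (F.eq_fst s ht)
  have h0 : IsArgLift (fun t => psi (γ.1 t).1) (Θ.comp ⟨fun t => (0, t), by fun_prop⟩) := by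
    convert hΘ.comp ⟨fun t => ((0 : I), t), by fun_prop⟩ using 1
    ext t
    simp
  have h1 : IsArgLift (fun t => psi (δ.1 t).1) (Θ.comp ⟨fun t => (1, t), by fun_prop⟩) := by
    convert hΘ.comp ⟨fun t => ((1 : I), t), by fun_prop⟩ using 1
    ext t
    simp
  rw [hθ.sub_eq (psi_path_ne_zero γ) h0 1 0, hη.sub_eq (psi_path_ne_zero δ) h1 1 0]
  simp only [ContinuousMap.comp_apply, ContinuousMap.coe_mk]
  rw [hend 0 (by simp), hend 1 (by simp)]

theorem existsUnique_isMaslovValue (x : SpCover n) : ∃! m : ℝ, IsMaslovValue x m := by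
  obtain ⟨γ, rfl⟩ := PathCover.exists_mk x
  obtain ⟨θ, hθ⟩ := exists_isArgLift (continuous_psi_path γ) (psi_path_ne_zero γ)
  refine ⟨θ 1 - θ 0, isMaslovValue_of_isArgLift hθ, fun m hm => ?_⟩
  obtain ⟨δ, η, hδ, hη, rfl⟩ := hm.exists_isArgLift
  exact isArgLift_homotopic (PathCover.mk_eq_mk.1 hδ) hη hθ

theorem isMaslovValue_maslov (x : SpCover n) : IsMaslovValue x (maslov x) :=
  Classical.epsilon_spec (existsUnique_isMaslovValue x).exists

theorem IsMaslovValue.maslov_eq {x : SpCover n} {m : ℝ} (h : IsMaslovValue x m) : maslov x = m :=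
  (existsUnique_isMaslovValue x).unique (isMaslovValue_maslov x) h

theorem maslov_mk {γ : basedPaths (SpGroup n)} {θ : C(I, ℝ)}
    (h : IsArgLift (fun t => psi (γ.1 t).1) θ) : maslov (PathCover.mk γ) = θ 1 - θ 0 :=
  (isMaslovValue_of_isArgLift h).maslov_eq

end Maslov

/-! ### Variation of the argument of a polynomial -/

section ArgPolynomial

theorem isArgLift_arg {Y : Type*} [TopologicalSpace Y] {f : Y → ℂ} (hf : Continuous f)
    (h : ∀ y, f y ∈ Complex.slitPlane) :
    IsArgLift f ⟨fun y => (f y).arg / (2 * Real.pi),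
      (continuous_iff_continuousAt.2 fun y =>
        (Complex.continuousAt_arg (h y)).comp hf.continuousAt).div_const _⟩ := by
  intro y
  conv_lhs => rw [← Complex.norm_mul_exp_arg_mul_I (f y)]
  congr 2
  have : (Real.pi : ℂ) ≠ 0 := by exact_mod_cast Real.pi_ne_zero
  simp only [ContinuousMap.coe_mk]
  push_cast
  field_simp

theorem isArgLift_const {Y : Type*} [TopologicalSpace Y] (c : ℂ) :
    IsArgLift (fun _ : Y => c) (.const Y (c.arg / (2 * Real.pi))) := by
  intro y
  conv_lhs => rw [← Complex.norm_mul_exp_arg_mul_I c]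
  have : (Real.pi : ℂ) ≠ 0 := by exact_mod_cast Real.pi_ne_zero
  simp only [ContinuousMap.const_apply]
  push_cast
  field_simp

/-- If `r` is not in `[0, 1]`, the segment `1 - s / r`, `0 ≤ s ≤ 1`, does not meet the negative real
axis: `1 - s / r = -c` with `c ≥ 0` gives `r = s / (1 + c)`. -/
theorem one_sub_div_mem_slitPlane {r : ℂ} (hr : ∀ s : I, ((s : ℝ) : ℂ) ≠ r) (s : I) :
    1 - ((s : ℝ) : ℂ) / r ∈ Complex.slitPlane := by
  by_contra h
  rw [Complex.mem_slitPlane_iff, not_or, not_lt, not_not] at h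
  have hr0 : r ≠ 0 := fun h => hr 0 (by simp [h])
  set c : ℝ := -(1 - ((s : ℝ) : ℂ) / r).re with hc
  have hc0 : 0 ≤ c := by linarith [h.1]
  have h1 : 1 - ((s : ℝ) : ℂ) / r = -(c : ℂ) := by
    apply Complex.ext
    · simp [hc]
    · rw [h.2]; simp
  have h2 : ((s : ℝ) : ℂ) = (1 + c) * r := by
    field_simp at h1
    linear_combination -h1
  have h3 : (0 : ℝ) < 1 + c := by linarith
  have h4 : r = (((s : ℝ) / (1 + c) : ℝ) : ℂ) := by
    have : ((1 + c : ℝ) : ℂ) ≠ 0 := by exact_mod_cast h3.ne'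
    push_cast at this ⊢
    rw [h2]
    field_simp
  refine hr ⟨(s : ℝ) / (1 + c), ?_, ?_⟩ h4.symm
  · exact div_nonneg s.2.1 h3.le
  · rw [div_le_one h3]; linarith [s.2.2]

theorem exists_isArgLift_prod (R : Multiset ℂ) (hR : ∀ r ∈ R, ∀ s : I, ((s : ℝ) : ℂ) ≠ r) :
    ∃ θ : C(I, ℝ), IsArgLift (fun s : I => (R.map fun r => 1 - ((s : ℝ) : ℂ) / r).prod) θ ∧
      |θ 1 - θ 0| ≤ R.card / 2 := by
  induction R using Multiset.induction_on with
  | empty => exact ⟨.const I 0, fun s => by simp, by simp⟩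
  | cons r R ih =>
    obtain ⟨θ, hθ, hb⟩ := ih fun q hq => hR q (Multiset.mem_cons_of_mem hq)
    have h1 := isArgLift_arg (f := fun s : I => 1 - ((s : ℝ) : ℂ) / r) (by fun_prop)
      (one_sub_div_mem_slitPlane (hR r (Multiset.mem_cons_self r R)))
    refine ⟨_, by simpa using h1.mul hθ, ?_⟩
    have h2 := Complex.abs_arg_le_pi (1 - 1 / r)
    have hpi := Real.pi_pos
    have h3 : |(1 - 1 / r).arg / (2 * Real.pi)| ≤ 1 / 2 := by
      rw [abs_div, abs_of_pos (by positivity : (0 : ℝ) < 2 * Real.pi), div_le_div_iff₀ (by positivity)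
        (by norm_num)]
      linarith
    have h4 := abs_add_le ((1 - 1 / r).arg / (2 * Real.pi)) (θ 1 - θ 0)
    simp only [ContinuousMap.add_apply, ContinuousMap.coe_mk, Multiset.card_cons, Nat.cast_add,
      Nat.cast_one, Icc.coe_one, Icc.coe_zero, Complex.ofReal_one, Complex.ofReal_zero, zero_div,
      sub_zero, Complex.arg_one, zero_add]
    rw [add_sub_assoc]
    linarith

/-- The argument of a polynomial without zeros on `[0, 1]` varies by at most half a turn for each
of its roots. -/
theorem IsArgLift.abs_sub_le_of_polynomial {p : Polynomial ℂ}
    (hp : ∀ s : I, p.eval ((s : ℝ) : ℂ) ≠ 0) {θ : C(I, ℝ)}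
    (hθ : IsArgLift (fun s : I => p.eval ((s : ℝ) : ℂ)) θ) : |θ 1 - θ 0| ≤ p.natDegree / 2 := by
  have hR : ∀ r ∈ p.roots, ∀ s : I, ((s : ℝ) : ℂ) ≠ r := by
    rintro r hr s rfl
    exact hp s (Polynomial.isRoot_of_mem_roots hr)
  obtain ⟨η, hη, hb⟩ := exists_isArgLift_prod p.roots hR
  have h1 := (isArgLift_const (Y := I) (p.eval 0)).mul hη
  have hsp := IsAlgClosed.splits p
  have h2 : (fun s : I => p.eval 0 * (p.roots.map fun r => 1 - ((s : ℝ) : ℂ) / r).prod)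
      = fun s : I => p.eval ((s : ℝ) : ℂ) := by
    ext s
    rw [hsp.eval_eq_prod_roots, hsp.eval_eq_prod_roots, mul_assoc, ← Multiset.prod_map_mul]
    congr 2
    refine Multiset.map_congr rfl fun r hr => ?_
    have : r ≠ 0 := fun h => hR r hr 0 (by simp [h])
    field_simp
    ring
  rw [h2] at h1
  rw [hθ.sub_eq hp h1]
  rw [← hsp.natDegree_eq_card_roots] at hb
  simpa using hb

end ArgPolynomial

/-! ### The quasimorphism property -/

section Quasimorphism

open Matrix

variable {n : ℕ}

/-- This identity makes the argument of `psi` monotone along non-negative paths. -/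
theorem realify_complexPart_transpose_mul {X : Matrix (Fin n ⊕ Fin n) (Fin n ⊕ Fin n) ℝ}
    (hX : X ∈ symplecticGroup (Fin n) ℝ) :
    (realify (complexPart X))ᵀ * X = (1 / 2 : ℝ) • (Xᵀ * X + 1) := by
  have h := SymplecticGroup.mem_iff'.1 hX
  have h2 : J (Fin n) ℝ * Xᵀ * J (Fin n) ℝ * X = -1 := by
    rw [Matrix.mul_assoc, Matrix.mul_assoc, ← Matrix.mul_assoc Xᵀ, h, J_squared]
  rw [← realify_conjTranspose, ← complexPart_transpose, realify_complexPart, Matrix.smul_mul,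
    Matrix.sub_mul, h2, sub_neg_eq_add]

/-- The relation between the complex linear and antilinear parts of a symplectic matrix. -/
theorem transpose_mul_complexPart_sub {X : Matrix (Fin n ⊕ Fin n) (Fin n ⊕ Fin n) ℝ}
    (hX : X ∈ symplecticGroup (Fin n) ℝ) :
    (realify (complexPart X))ᵀ * realify (complexPart X)
      = (X - realify (complexPart X))ᵀ * (X - realify (complexPart X)) + 1 := by
  have h1 := realify_complexPart_transpose_mul hX
  have h2 := congrArg transpose h1
  rw [transpose_mul, transpose_transpose, transpose_smul, transpose_add, transpose_mul,
    transpose_transpose, transpose_one] at h2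
  rw [transpose_sub, Matrix.sub_mul, Matrix.mul_sub, Matrix.mul_sub, h1, h2]
  ext i j
  simp
  ring

/-- The complex linear part of a product: products of a complex linear and an antilinear part are
antilinear. -/
theorem realify_complexPart_mul (X Y : Matrix (Fin n ⊕ Fin n) (Fin n ⊕ Fin n) ℝ) :
    realify (complexPart (X * Y)) = realify (complexPart X) * realify (complexPart Y)
      + (X - realify (complexPart X)) * (Y - realify (complexPart Y)) := by
  have jj := J_squared (Fin n) ℝ
  have key : ∀ A B : Matrix (Fin n ⊕ Fin n) (Fin n ⊕ Fin n) ℝ,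
      A * J (Fin n) ℝ * (J (Fin n) ℝ * B) = -(A * B) := by
    intro A B
    rw [Matrix.mul_assoc, ← Matrix.mul_assoc (J _ _), jj]; simp
  have k2 : J (Fin n) ℝ * X * J (Fin n) ℝ * (J (Fin n) ℝ * Y * J (Fin n) ℝ)
      = -(J (Fin n) ℝ * (X * Y) * J (Fin n) ℝ) := by
    rw [← Matrix.mul_assoc, key]; simp [Matrix.mul_assoc]
  simp only [realify_complexPart, Matrix.smul_mul, Matrix.mul_smul, Matrix.sub_mul,
    Matrix.mul_sub, k2]
  ext i j
  simp
  ring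

theorem dotProduct_mulVec_transpose_mul {m : Type*} [Fintype m] (A : Matrix m m ℝ) (v : m → ℝ) :
    v ⬝ᵥ (Aᵀ * A) *ᵥ v = (A *ᵥ v) ⬝ᵥ (A *ᵥ v) := by
  rw [← mulVec_mulVec, dotProduct_mulVec, vecMul_transpose]

/-- The segment from the product of the complex linear parts to the complex linear part of the
product consists of invertible matrices. Realified, the interpolation is `C_X C_Y + s D_X D_Y` with
the complex antilinear parts `D`, and `C_Xᵀ`, `C_Y` strictly dominate `D_Xᵀ`, `D_Y` by
`transpose_mul_complexPart_sub`. -/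
theorem det_interpolate_ne_zero {X Y : Matrix (Fin n ⊕ Fin n) (Fin n ⊕ Fin n) ℝ}
    (hX : X ∈ symplecticGroup (Fin n) ℝ) (hY : Y ∈ symplecticGroup (Fin n) ℝ) {s : ℝ}
    (hs0 : 0 ≤ s) (hs1 : s ≤ 1) :
    ((s : ℂ) • (complexPart (X * Y) - complexPart X * complexPart Y)
      + complexPart X * complexPart Y).det ≠ 0 := by
  set M := (s : ℂ) • (complexPart (X * Y) - complexPart X * complexPart Y)
      + complexPart X * complexPart Y with hM
  set CX := realify (complexPart X) with hCX
  set CY := realify (complexPart Y) with hCY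
  set DX := X - CX with hDX
  set DY := Y - CY with hDY
  have hr : realify M = s • (DX * DY) + CX * CY := by
    have h1 : M = ((s : ℂ) • (1 : Matrix (Fin n) (Fin n) ℂ)) * complexPart (X * Y)
        + ((1 - s : ℝ) : ℂ) • (1 : Matrix (Fin n) (Fin n) ℂ) * (complexPart X * complexPart Y) := by
      rw [hM, Matrix.smul_mul, Matrix.smul_mul, Matrix.one_mul, Matrix.one_mul]
      push_cast
      module
    rw [h1, realify_add, realify_mul, realify_mul, realify_smul_one, realify_smul_one,
      realify_complexPart_mul, realify_mul, ← hCX, ← hCY, ← hDX, ← hDY, Matrix.smul_mul,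
      Matrix.smul_mul, Matrix.one_mul, Matrix.one_mul]
    module
  have hdet : (realify M).det ≠ 0 := by
    intro h0
    obtain ⟨v, hv, hv0⟩ := Matrix.exists_mulVec_eq_zero_iff.2 h0
    apply hv
    have hXu : IsUnit CXᵀ.det := by
      have h1 : IsUnit (complexPart X).det := isUnit_iff_ne_zero.2 (psi_ne_zero hX)
      have h2 : CX * realify (complexPart X)⁻¹ = 1 := by
        rw [hCX, ← realify_mul, Matrix.mul_nonsing_inv _ h1, realify_one]
      rw [det_transpose]
      exact (Matrix.isUnit_iff_isUnit_det _).1 (IsUnit.of_mul_eq_one _ h2)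
    have e1 := transpose_mul_complexPart_sub hY
    have e2 := transpose_mul_complexPart_sub (SymplecticGroup.transpose_mem hX)
    rw [complexPart_transpose, realify_conjTranspose, ← transpose_sub, transpose_transpose] at e2
    rw [← hCX, ← hDX] at e2
    rw [← hCY, ← hDY] at e1
    -- pair the kernel vector `v` with the `y` that has `C_Xᵀ y = C_Y v`
    set a := CY *ᵥ v with ha
    set b := DY *ᵥ v with hb
    set y := (CXᵀ)⁻¹ *ᵥ a with hy
    have hya : CXᵀ *ᵥ y = a := by
      rw [hy, mulVec_mulVec, Matrix.mul_nonsing_inv _ hXu, one_mulVec]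
    set d := DXᵀ *ᵥ y with hd
    have f1 : a ⬝ᵥ a = b ⬝ᵥ b + v ⬝ᵥ v := by
      have := congrArg (fun A => v ⬝ᵥ A *ᵥ v) e1
      simpa [dotProduct_mulVec_transpose_mul, add_mulVec, dotProduct_add] using this
    have f2 : a ⬝ᵥ a = d ⬝ᵥ d + y ⬝ᵥ y := by
      have h3 := dotProduct_mulVec_transpose_mul CXᵀ y
      have h4 := dotProduct_mulVec_transpose_mul DXᵀ y
      rw [transpose_transpose] at h3 h4
      rw [hya, e2, add_mulVec, dotProduct_add, one_mulVec] at h3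
      rw [← h3]
      simpa using h4
    have f3 : s * (d ⬝ᵥ b) + a ⬝ᵥ a = 0 := by
      have h5 : y ⬝ᵥ (realify M *ᵥ v) = 0 := by rw [hv0]; simp
      rw [hr, add_mulVec, smul_mulVec, ← mulVec_mulVec, ← mulVec_mulVec, dotProduct_add,
        dotProduct_smul, dotProduct_mulVec y DX, dotProduct_mulVec y CX, ← mulVec_transpose,
        ← mulVec_transpose, hya] at h5
      simpa using h5
    have g1 : 0 ≤ (d + b) ⬝ᵥ (d + b) := by simpa using dotProduct_star_self_nonneg (d + b)
    have g2 : 0 ≤ y ⬝ᵥ y := by simpa using dotProduct_star_self_nonneg y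
    have g3 : 0 ≤ d ⬝ᵥ d := by simpa using dotProduct_star_self_nonneg d
    have g4 : 0 ≤ b ⬝ᵥ b := by simpa using dotProduct_star_self_nonneg b
    have g5 : 0 ≤ v ⬝ᵥ v := by simpa using dotProduct_star_self_nonneg v
    rw [add_dotProduct, dotProduct_add, dotProduct_add, dotProduct_comm b d] at g1
    have g6 : v ⬝ᵥ v = 0 := by
      nlinarith [mul_nonneg hs0 g1, mul_nonneg (sub_nonneg.2 hs1) g3, mul_nonneg (sub_nonneg.2 hs1) g4]
    exact dotProduct_self_eq_zero.1 g6
  intro h0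
  have h1 : (realify M)⁻¹ * realify M = 1 :=
    Matrix.nonsing_inv_mul _ (isUnit_iff_ne_zero.2 hdet)
  have h2 := congrArg complexPart h1
  rw [complexPart_mul_realify, ← realify_one, complexPart_realify] at h2
  have h3 := congrArg det h2
  rw [det_mul, h0, mul_zero, det_one] at h3
  exact zero_ne_one h3

/-- The defect of the Maslov number is the variation of the argument along the end points of the
interpolation of `det_interpolate_ne_zero`, which is a polynomial of degree at most `n`. -/
theorem abs_maslov_mul_sub_le (x y : SpCover n) :
    |maslov (x * y) - maslov x - maslov y| ≤ n / 2 := by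
  obtain ⟨γ, rfl⟩ := PathCover.exists_mk x
  obtain ⟨δ, rfl⟩ := PathCover.exists_mk y
  obtain ⟨θ, hθ⟩ := exists_isArgLift (continuous_psi_path γ) (psi_path_ne_zero γ)
  obtain ⟨η, hη⟩ := exists_isArgLift (continuous_psi_path δ) (psi_path_ne_zero δ)
  set c : I → Matrix (Fin n) (Fin n) ℂ := fun t => complexPart (γ.1 t).1
  set d : I → Matrix (Fin n) (Fin n) ℂ := fun t => complexPart (δ.1 t).1
  set e : I → Matrix (Fin n) (Fin n) ℂ := fun t => complexPart ((γ.1 t).1 * (δ.1 t).1)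
  have hγ : Continuous fun t => (γ.1 t).1 := continuous_subtype_val.comp γ.1.continuous
  have hδ : Continuous fun t => (δ.1 t).1 := continuous_subtype_val.comp δ.1.continuous
  have hc : Continuous c := continuous_complexPart.comp hγ
  have hd : Continuous d := continuous_complexPart.comp hδ
  have he : Continuous e := continuous_complexPart.comp (hγ.matrix_mul hδ)
  obtain ⟨Θ, hΘ⟩ := exists_isArgLift_square
    (f := fun p => (((p.1 : ℝ) : ℂ) • (e p.2 - c p.2 * d p.2) + c p.2 * d p.2).det)
    (by fun_prop) fun p => det_interpolate_ne_zero (γ.1 p.2).2 (δ.1 p.2).2 p.1.2.1 p.1.2.2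
  have h0 : IsArgLift (fun t => psi (γ.1 t).1 * psi (δ.1 t).1)
      (Θ.comp ⟨fun t => (0, t), by fun_prop⟩) := by
    convert hΘ.comp ⟨fun t => ((0 : I), t), by fun_prop⟩ using 1
    ext t
    simp [psi, c, d]
  have h1 : IsArgLift (fun t => psi ((γ * δ).1 t).1) (Θ.comp ⟨fun t => (1, t), by fun_prop⟩) := by
    convert hΘ.comp ⟨fun t => ((1 : I), t), by fun_prop⟩ using 1
    ext t
    simp [psi, e]
  have h2 : IsArgLift (fun s : I => (1 : ℂ)) (Θ.comp ⟨fun s => (s, 0), by fun_prop⟩) := by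
    convert hΘ.comp ⟨fun s => (s, (0 : I)), by fun_prop⟩ using 1
    ext s
    have e1 : γ.1 0 = 1 := γ.2
    have e2 : δ.1 0 = 1 := δ.2
    have e3 : complexPart (1 : Matrix (Fin n ⊕ Fin n) (Fin n ⊕ Fin n) ℝ) = 1 := by
      rw [← realify_one, complexPart_realify]
    simp [c, d, e, e1, e2, e3]
  have h3 : IsArgLift _ (Θ.comp ⟨fun s => (s, 1), by fun_prop⟩) :=
    hΘ.comp ⟨fun s => (s, (1 : I)), by fun_prop⟩
  set p : Polynomial ℂ := det ((Polynomial.X : Polynomial ℂ) • (e 1 - c 1 * d 1).map Polynomial.C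
    + (c 1 * d 1).map Polynomial.C) with hp
  have h4 : ∀ z : ℂ, p.eval z = (z • (e 1 - c 1 * d 1) + c 1 * d 1).det := by
    intro z
    rw [hp, ← Polynomial.coe_evalRingHom, RingHom.map_det]
    congr 1
    ext i j
    simp [-Matrix.map_mul]
  have h5 : p.natDegree ≤ n :=
    (Polynomial.natDegree_det_X_add_C_le (e 1 - c 1 * d 1) (c 1 * d 1)).trans (by simp)
  have h6 : |Θ (1, 1) - Θ (0, 1)| ≤ p.natDegree / 2 := by
    refine IsArgLift.abs_sub_le_of_polynomial (p := p) (θ := Θ.comp ⟨fun s => (s, 1), by fun_prop⟩)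
      (fun s => ?_) ?_
    · rw [h4]
      exact det_interpolate_ne_zero (γ.1 1).2 (δ.1 1).2 s.2.1 s.2.2
    · simp only [h4]
      exact h3
  have h7 : Θ (0, 0) = Θ (1, 0) := h2.eq_of_const one_ne_zero (fun _ => rfl) 0 1
  have h8 := (hθ.mul hη).sub_eq
    (fun t => mul_ne_zero (psi_path_ne_zero γ t) (psi_path_ne_zero δ t)) h0 1 0
  have h9 : maslov (PathCover.mk γ * PathCover.mk δ) = Θ (1, 1) - Θ (1, 0) := maslov_mk h1
  rw [maslov_mk hθ, maslov_mk hη, h9]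
  simp only [ContinuousMap.add_apply, ContinuousMap.comp_apply, ContinuousMap.coe_mk] at h8
  have h10 : (p.natDegree : ℝ) ≤ n := by exact_mod_cast h5
  rw [show Θ (1, 1) - Θ (1, 0) - (θ 1 - θ 0) - (η 1 - η 0) = Θ (1, 1) - Θ (0, 1) by linarith]
  linarith

theorem isQuasimorphism_maslov : IsQuasimorphism (maslov : SpCover n → ℝ) :=
  ⟨n / 2, abs_maslov_mul_sub_le⟩

end Quasimorphism

/-! ### Derivatives of matrix functions -/

section MatrixCalculus

open Matrix

variable {𝕜 : Type*} [RCLike 𝕜]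

theorem hasDerivWithinAt_matrix_mul {l m p : Type*} [Fintype m] {A : ℝ → Matrix l m 𝕜}
    {B : ℝ → Matrix m p 𝕜} {A' : Matrix l m 𝕜} {B' : Matrix m p 𝕜} {S : Set ℝ} {t : ℝ}
    (hA : ∀ i j, HasDerivWithinAt (fun s => A s i j) (A' i j) S t)
    (hB : ∀ i j, HasDerivWithinAt (fun s => B s i j) (B' i j) S t) (i : l) (j : p) :
    HasDerivWithinAt (fun s => (A s * B s) i j) ((A' * B t + A t * B') i j) S t := by
  simp only [Matrix.mul_apply, Matrix.add_apply, ← Finset.sum_add_distrib]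
  exact HasDerivWithinAt.fun_sum fun k _ => (hA i k).mul (hB k j)

/-- Jacobi's formula. -/
theorem hasDerivWithinAt_det {m : Type*} [Fintype m] [DecidableEq m] {A : ℝ → Matrix m m 𝕜}
    {A' : Matrix m m 𝕜} {S : Set ℝ} {t : ℝ}
    (hA : ∀ i j, HasDerivWithinAt (fun s => A s i j) (A' i j) S t) :
    HasDerivWithinAt (fun s => (A s).det) (((A t).adjugate * A').trace) S t := by
  have h1 : ((A t).adjugate * A').trace
      = ∑ τ : Equiv.Perm m, ((Equiv.Perm.sign τ : ℤ) : 𝕜) *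
        ∑ i, (∏ j ∈ Finset.univ.erase i, A t (τ j) j) • A' (τ i) i := by
    have h2 : ((A t).adjugate * A').trace = ∑ i, ((A t).updateCol i fun k => A' k i).det := by
      simp only [← cramer_apply, cramer_eq_adjugate_mulVec]
      rfl
    rw [h2]
    simp only [det_apply', Finset.mul_sum]
    rw [Finset.sum_comm]
    refine Finset.sum_congr rfl fun τ _ => Finset.sum_congr rfl fun i _ => ?_
    congr 1
    rw [← Finset.prod_erase_mul _ _ (Finset.mem_univ i), updateCol_self, smul_eq_mul]
    congr 1
    refine Finset.prod_congr rfl fun j hj => ?_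
    rw [updateCol_ne (Finset.ne_of_mem_erase hj)]
  rw [h1]
  simp only [det_apply']
  exact HasDerivWithinAt.fun_sum fun τ _ =>
    (HasDerivWithinAt.fun_finsetProd fun i _ => hA (τ i) i).const_mul _

theorem hasDerivWithinAt_complexPart {n : ℕ}
    {A : ℝ → Matrix (Fin n ⊕ Fin n) (Fin n ⊕ Fin n) ℝ}
    {A' : Matrix (Fin n ⊕ Fin n) (Fin n ⊕ Fin n) ℝ} {S : Set ℝ} {t : ℝ}
    (hA : ∀ i j, HasDerivWithinAt (fun s => A s i j) (A' i j) S t) (i j : Fin n) :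
    HasDerivWithinAt (fun s => complexPart (A s) i j) (complexPart A' i j) S t := by
  simp only [complexPart, Matrix.of_apply, Complex.mk_eq_add_mul_I]
  exact (((hA _ _).add (hA _ _)).div_const 2).ofReal_comp.add
    ((((hA _ _).sub (hA _ _)).div_const 2).ofReal_comp.mul_const _)

/-- The argument of a solution of `f' = g f` is the integral of the imaginary part of `g`. -/
theorem isArgLift_of_hasDerivWithinAt {f g : ℝ → ℂ} (hg : Continuous g) (h0 : f 0 = 1)
    (hf : ∀ t ∈ Icc (0 : ℝ) 1, HasDerivWithinAt f (f t * g t) (Icc 0 1) t) :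
    IsArgLift (fun t : I => f t)
      ⟨fun t => (∫ s in (0 : ℝ)..t, (g s).im) / (2 * Real.pi),
        ((intervalIntegral.continuous_primitive (fun a b =>
          (Complex.continuous_im.comp hg).intervalIntegrable a b) 0).comp
            continuous_subtype_val).div_const _⟩ := by
  set G : ℝ → ℂ := fun t => ∫ s in (0 : ℝ)..t, g s with hG
  have hGd : ∀ t, HasDerivAt G (g t) t := fun t => hg.integral_hasStrictDerivAt 0 t |>.hasDerivAt
  have h1 : ∀ t ∈ Icc (0 : ℝ) 1,
      HasDerivWithinAt (fun s => f s * Complex.exp (-G s)) 0 (Icc 0 1) t := by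
    intro t ht
    have h2 := (hf t ht).mul ((hGd t).neg.cexp.hasDerivWithinAt (s := Icc 0 1))
    exact h2.congr_deriv (by ring)
  have h3 : ∀ t ∈ Icc (0 : ℝ) 1, f t = Complex.exp (G t) := by
    intro t ht
    have h4 := constant_of_derivWithin_zero (f := fun s => f s * Complex.exp (-G s)) (a := 0) (b := 1)
      (fun s hs => (h1 s hs).differentiableWithinAt) (fun s hs =>
        (h1 s (Ico_subset_Icc_self hs)).derivWithin
          (uniqueDiffOn_Icc zero_lt_one s (Ico_subset_Icc_self hs))) t ht
    have h5 : G 0 = 0 := by simp [hG]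
    simp only [h0, h5, neg_zero, Complex.exp_zero, mul_one] at h4
    rw [Complex.exp_neg, mul_inv_eq_one₀ (Complex.exp_ne_zero _)] at h4
    exact h4
  intro t
  simp only [ContinuousMap.coe_mk]
  have him : ∫ s in (0 : ℝ)..t, (g s).im = (G t).im := by
    have := Complex.imCLM.intervalIntegral_comp_comm (hg.intervalIntegrable (μ := MeasureTheory.volume) 0 t)
    simpa using this
  rw [him, h3 t t.2, Complex.norm_exp]
  push_cast
  rw [← Complex.exp_add]
  congr 1
  have : (Real.pi : ℂ) ≠ 0 := by exact_mod_cast Real.pi_ne_zero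
  field_simp
  rw [mul_comm Complex.I]
  exact (Complex.re_add_im _).symm

end MatrixCalculus

/-! ### The order cone of non-negative paths -/

section Cone

open Matrix

variable {n : ℕ}

theorem SpGroup.pathMatrix_coe (γ : basedPaths (SpGroup n)) (t : I) :
    SpGroup.pathMatrix γ t = (γ.1 t).1 := by simp [SpGroup.pathMatrix]

theorem SpGroup.pathMatrix_mem (γ : basedPaths (SpGroup n)) (t : ℝ) :
    SpGroup.pathMatrix γ t ∈ symplecticGroup (Fin n) ℝ := (γ.1 _).2

theorem SpGroup.continuous_pathMatrix (γ : basedPaths (SpGroup n)) :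
    Continuous (SpGroup.pathMatrix γ) :=
  continuous_subtype_val.comp (γ.1.continuous.comp continuous_projIcc)

/-- A path that is generated by a smooth Hamiltonian is smooth. -/
theorem Generates.contDiffOn {H : ℝ → Matrix (Fin n ⊕ Fin n) (Fin n ⊕ Fin n) ℝ}
    {γ : basedPaths (SpGroup n)} (h : Generates H γ) (i j : Fin n ⊕ Fin n) :
    ContDiffOn ℝ ∞ (fun t => SpGroup.pathMatrix γ t i j) (Icc 0 1) := by
  rw [contDiffOn_infty]
  intro k
  induction k generalizing i j with
  | zero =>
    exact contDiffOn_zero.2 ((SpGroup.continuous_pathMatrix γ).matrix_elem i j).continuousOn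
  | succ k ih =>
    push_cast
    rw [contDiffOn_succ_iff_derivWithin (uniqueDiffOn_Icc zero_lt_one)]
    refine ⟨fun t ht => (h.deriv t ht i j).differentiableWithinAt, by simp, ?_⟩
    refine ContDiffOn.congr (f := fun t => (J (Fin n) ℝ * H t * SpGroup.pathMatrix γ t) i j) ?_
      fun t ht => (h.deriv t ht i j).derivWithin (uniqueDiffOn_Icc zero_lt_one t ht)
    simp only [Matrix.mul_apply]
    refine ContDiffOn.sum fun a _ => ContDiffOn.mul (ContDiffOn.sum fun b _ => ?_) (ih a j)
    exact contDiffOn_const.mul ((h.smooth b a).of_le (mod_cast le_top))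

theorem contDiffOn_matrix_mul {l m p : Type*} [Fintype m] {A : ℝ → Matrix l m ℝ}
    {B : ℝ → Matrix m p ℝ} {S : Set ℝ} (hA : ∀ i j, ContDiffOn ℝ ∞ (fun t => A t i j) S)
    (hB : ∀ i j, ContDiffOn ℝ ∞ (fun t => B t i j) S) (i : l) (j : p) :
    ContDiffOn ℝ ∞ (fun t => (A t * B t) i j) S := by
  simp only [Matrix.mul_apply]
  exact ContDiffOn.sum fun k _ => (hA i k).mul (hB k j)

theorem PosSemidef.mul_mul_transpose {m : Type*} [Fintype m] {K : Matrix m m ℝ}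
    (hK : K.PosSemidef) (B : Matrix m m ℝ) : (B * K * Bᵀ).PosSemidef := by
  simpa [conjTranspose_eq_transpose_of_trivial] using hK.mul_mul_conjTranspose_same B

theorem transpose_J_mul_J (X : Matrix (Fin n ⊕ Fin n) (Fin n ⊕ Fin n) ℝ) :
    (J (Fin n) ℝ * X * J (Fin n) ℝ)ᵀ = J (Fin n) ℝ * Xᵀ * J (Fin n) ℝ := by
  simp [transpose_mul, J_transpose, Matrix.mul_assoc]

/-- Conjugation by a symplectic matrix carries the Hamiltonian vector field `J K` to that of the
transported quadratic form. -/
theorem J_mul_transport {X : Matrix (Fin n ⊕ Fin n) (Fin n ⊕ Fin n) ℝ}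
    (hX : X ∈ symplecticGroup (Fin n) ℝ) (K : Matrix (Fin n ⊕ Fin n) (Fin n ⊕ Fin n) ℝ) :
    J (Fin n) ℝ * (J (Fin n) ℝ * X * J (Fin n) ℝ * K * (J (Fin n) ℝ * X * J (Fin n) ℝ)ᵀ) * X
      = X * (J (Fin n) ℝ * K) := by
  have h := SymplecticGroup.mem_iff'.1 hX
  have jj := J_squared (Fin n) ℝ
  rw [transpose_J_mul_J]
  calc _ = J (Fin n) ℝ * J (Fin n) ℝ * (X * (J (Fin n) ℝ * K)) *
        (J (Fin n) ℝ * (Xᵀ * J (Fin n) ℝ * X)) := by simp only [Matrix.mul_assoc]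
    _ = _ := by rw [h, jj]; simp

theorem Generates.mul {H K : ℝ → Matrix (Fin n ⊕ Fin n) (Fin n ⊕ Fin n) ℝ}
    {γ δ : basedPaths (SpGroup n)} (hγ : Generates H γ) (hδ : Generates K δ) :
    Generates (fun t => H t + J (Fin n) ℝ * SpGroup.pathMatrix γ t * J (Fin n) ℝ * K t *
      (J (Fin n) ℝ * SpGroup.pathMatrix γ t * J (Fin n) ℝ)ᵀ) (γ * δ) where
  smooth i j := by
    have hB := contDiffOn_matrix_mul (contDiffOn_matrix_mul
      (A := fun _ : ℝ => J (Fin n) ℝ) (fun _ _ => contDiffOn_const) hγ.contDiffOn)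
      (B := fun _ : ℝ => J (Fin n) ℝ) (fun _ _ => contDiffOn_const)
    exact (hγ.smooth i j).add (contDiffOn_matrix_mul (contDiffOn_matrix_mul hB hδ.smooth)
      (fun i j => hB j i) i j)
  symm t ht := by
    have h1 := hγ.symm t ht
    have h2 := hδ.symm t ht
    simp only [IsSymm] at h1 h2
    simp [IsSymm, transpose_mul, h1, h2, Matrix.mul_assoc]
  deriv t ht i j := by
    have h1 := hasDerivWithinAt_matrix_mul (hγ.deriv t ht) (hδ.deriv t ht) i j
    refine h1.congr_deriv (congrFun (congrFun ?_ i) j)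
    symm
    change J (Fin n) ℝ * _ * (SpGroup.pathMatrix γ t * SpGroup.pathMatrix δ t) = _
    rw [Matrix.mul_add, Matrix.add_mul, ← Matrix.mul_assoc, ← Matrix.mul_assoc (_ * _),
      J_mul_transport (SpGroup.pathMatrix_mem γ t)]
    simp only [Matrix.mul_assoc]

/-- Conjugation of a path by a constant group element. -/
def conjPath {G : Type*} [TopologicalSpace G] [Group G] [IsTopologicalGroup G] (a : G)
    (γ : basedPaths G) : basedPaths G :=
  ⟨⟨fun t => a * γ.1 t * a⁻¹, by fun_prop⟩, by
    have : γ.1 0 = 1 := γ.2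
    change a * γ.1 0 * a⁻¹ = 1
    simp [this]⟩

/-- Conjugation in the universal cover only depends on the end point of the conjugating path. -/
theorem conj_mk {G : Type*} [TopologicalSpace G] [Group G] [IsTopologicalGroup G]
    (γ η : basedPaths G) : PathCover.mk η * PathCover.mk γ * (PathCover.mk η)⁻¹
      = PathCover.mk (conjPath (η.1 1) γ) := by
  have h0 : γ.1 0 = 1 := γ.2
  change PathCover.mk (η * γ * η⁻¹) = _
  rw [PathCover.mk_eq_mk]
  refine ⟨{ toFun := fun p => η.1 (max p.1 p.2) * γ.1 p.2 * (η.1 (max p.1 p.2))⁻¹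
            continuous_toFun := by fun_prop
            map_zero_left := fun t => ?_
            map_one_left := fun t => ?_
            prop' := ?_ }⟩
  · have : max (0 : I) t = t := max_eq_right t.2.1
    simp only [this]
    rfl
  · have : max (1 : I) t = 1 := max_eq_left t.2.2
    simp only [this]
    rfl
  · rintro s t (rfl | rfl)
    · simp [h0]
    · have : max s (1 : I) = 1 := max_eq_right s.2.2
      simp [this]

/-- The class of a loop is central. -/
theorem commute_mk_of_loop {G : Type*} [TopologicalSpace G] [Group G] [IsTopologicalGroup G]
    {γ : basedPaths G} (h1 : γ.1 1 = 1) (x : PathCover G) : Commute x (PathCover.mk γ) := by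
  obtain ⟨η, rfl⟩ := PathCover.exists_mk x
  have h0 : γ.1 0 = 1 := γ.2
  have he : η.1 0 = 1 := η.2
  have : PathCover.mk (η * γ * η⁻¹) = PathCover.mk γ := by
    rw [PathCover.mk_eq_mk]
    refine ContinuousMap.HomotopicRel.symm ⟨{
      toFun := fun p => η.1 (p.1 * p.2) * γ.1 p.2 * (η.1 (p.1 * p.2))⁻¹
      continuous_toFun := by fun_prop
      map_zero_left := fun t => by simp [he]
      map_one_left := fun t => by simp
      prop' := ?_ }⟩
    rintro s t (rfl | rfl)
    · simp [h0]
    · simp [h1]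
  have h2 : PathCover.mk η * PathCover.mk γ * (PathCover.mk η)⁻¹ = PathCover.mk γ := this
  exact mul_inv_eq_iff_eq_mul.1 h2

theorem Generates.conjPath {H : ℝ → Matrix (Fin n ⊕ Fin n) (Fin n ⊕ Fin n) ℝ}
    {γ : basedPaths (SpGroup n)} (hγ : Generates H γ) (a : SpGroup n) :
    Generates (fun t => J (Fin n) ℝ * a.1 * J (Fin n) ℝ * H t *
      (J (Fin n) ℝ * a.1 * J (Fin n) ℝ)ᵀ) (conjPath a γ) where
  smooth := contDiffOn_matrix_mul (contDiffOn_matrix_mul (A := fun _ : ℝ => _)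
    (fun _ _ => contDiffOn_const) hγ.smooth) (B := fun _ : ℝ => _) (fun _ _ => contDiffOn_const)
  symm t ht := by
    have h1 := hγ.symm t ht
    simp only [IsSymm] at h1
    simp [IsSymm, transpose_mul, h1, Matrix.mul_assoc]
  deriv t ht i j := by
    have h1 := hasDerivWithinAt_matrix_mul (hasDerivWithinAt_matrix_mul (A := fun _ => a.1)
      (A' := 0) (fun _ _ => hasDerivWithinAt_const _ _ _) (hγ.deriv t ht))
      (B := fun _ => a⁻¹.1) (B' := 0) (fun _ _ => hasDerivWithinAt_const _ _ _) i j
    refine h1.congr_deriv (congrFun (congrFun ?_ i) j)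
    symm
    change J (Fin n) ℝ * _ * (a.1 * SpGroup.pathMatrix γ t * a⁻¹.1) = _
    rw [← Matrix.mul_assoc, ← Matrix.mul_assoc, J_mul_transport a.2]
    simp only [Matrix.mul_assoc, Matrix.zero_mul, Matrix.mul_zero, zero_add, add_zero]

theorem isNormalCone_nonnegCone : IsNormalCone (nonnegCone n) where
  mul_mem := by
    rintro _ _ ⟨γ, rfl, H, hH, hH0⟩ ⟨δ, rfl, K, hK, hK0⟩
    exact ⟨γ * δ, rfl, _, hH.mul hK, fun t ht =>
      (hH0 t ht).add (PosSemidef.mul_mul_transpose (hK0 t ht) _)⟩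
  conj_mem := by
    rintro _ h ⟨γ, rfl, H, hH, hH0⟩
    obtain ⟨η, rfl⟩ := PathCover.exists_mk h
    exact ⟨_, (conj_mk γ η).symm, _, hH.conjPath _, fun t ht =>
      PosSemidef.mul_mul_transpose (hH0 t ht) _⟩
  one_mem := by
    refine ⟨1, rfl, fun _ => 0, ⟨fun _ _ => contDiffOn_const, fun t _ => by simp [IsSymm],
      fun t _ i j => ?_⟩, fun t _ => PosSemidef.zero⟩
    exact (hasDerivWithinAt_const t _ ((1 : Matrix (Fin n ⊕ Fin n) (Fin n ⊕ Fin n) ℝ) i j)).congr_deriv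
      (by simp)

/-- The logarithmic derivative of `psi` in the direction of a Hamiltonian vector field has
non-negative imaginary part, which only vanishes if the Hamiltonian does. -/
theorem trace_inv_mul_complexPart {X H : Matrix (Fin n ⊕ Fin n) (Fin n ⊕ Fin n) ℝ}
    (hX : X ∈ symplecticGroup (Fin n) ℝ) (hH : H.PosSemidef) :
    0 ≤ (((complexPart X)⁻¹ * complexPart (J (Fin n) ℝ * H * X)).trace).im ∧
      ((((complexPart X)⁻¹ * complexPart (J (Fin n) ℝ * H * X)).trace).im = 0 → H = 0) := by
  set c := complexPart X with hc
  have hcu : IsUnit c.det := isUnit_iff_ne_zero.2 (psi_ne_zero hX)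
  set F := realify c⁻¹ with hF
  have h1 : realify c * F = 1 := by
    rw [hF, ← realify_mul, Matrix.mul_nonsing_inv _ hcu, realify_one]
  have h3 : X * F = (1 / 2 : ℝ) • (Fᵀ * Xᵀ * X * F + Fᵀ * F) := by
    have h4 : Fᵀ * (realify c)ᵀ = 1 := by rw [← transpose_mul, h1, transpose_one]
    calc X * F = Fᵀ * ((realify c)ᵀ * X) * F := by rw [← Matrix.mul_assoc, h4, Matrix.one_mul]
      _ = _ := by
        rw [realify_complexPart_transpose_mul hX, Matrix.mul_smul, Matrix.smul_mul,
          Matrix.mul_add, Matrix.add_mul, Matrix.mul_one, ← Matrix.mul_assoc]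
  have h5 : ((c⁻¹ * complexPart (J (Fin n) ℝ * H * X)).trace).im
      = ((X * F * H * (X * F)ᵀ).trace + (F * H * Fᵀ).trace) / 4 := by
    have e1 : complexPart (J (Fin n) ℝ * H * X) = Complex.I • complexPart (H * X) := by
      rw [J_eq_realify, Matrix.mul_assoc, complexPart_realify_mul, Matrix.smul_mul, Matrix.one_mul]
    rw [e1, Matrix.mul_smul, trace_smul, smul_eq_mul, Complex.I_mul_im, trace_mul_comm,
      ← complexPart_mul_realify, trace_complexPart_re, Matrix.mul_assoc, h3, Matrix.mul_smul,
      trace_smul, Matrix.mul_add, trace_add, ← h3]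
    have e2 : (H * (Fᵀ * Xᵀ * X * F)).trace = (X * F * H * (X * F)ᵀ).trace := by
      rw [Matrix.mul_assoc (X * F), trace_mul_comm (X * F)]
      simp only [transpose_mul, Matrix.mul_assoc]
    have e3 : (H * (Fᵀ * F)).trace = (F * H * Fᵀ).trace := by
      rw [Matrix.mul_assoc F, trace_mul_comm F, Matrix.mul_assoc]
    rw [e2, e3, smul_eq_mul]
    ring
  have p1 := PosSemidef.mul_mul_transpose hH (X * F)
  have p2 := PosSemidef.mul_mul_transpose hH F
  rw [h5]
  refine ⟨by linarith [p1.trace_nonneg, p2.trace_nonneg], fun h => ?_⟩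
  have h6 : F * H * Fᵀ = 0 := p2.trace_eq_zero_iff.1 (by linarith [p1.trace_nonneg, p2.trace_nonneg])
  calc H = realify c * (F * H * Fᵀ) * (realify c)ᵀ := by
        rw [← Matrix.mul_assoc, ← Matrix.mul_assoc, h1, Matrix.one_mul, Matrix.mul_assoc,
          ← transpose_mul, h1, transpose_one, Matrix.mul_one]
    _ = 0 := by rw [h6]; simp

/-- Non-negative paths have non-negative Maslov number, with equality only for the constant
path. -/
theorem Generates.maslov_nonneg {H : ℝ → Matrix (Fin n ⊕ Fin n) (Fin n ⊕ Fin n) ℝ}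
    {γ : basedPaths (SpGroup n)} (h : Generates H γ) (hH : ∀ t ∈ Icc (0 : ℝ) 1, (H t).PosSemidef) :
    0 ≤ maslov (PathCover.mk γ) ∧
      (maslov (PathCover.mk γ) = 0 → ∀ t ∈ Icc (0 : ℝ) 1, H t = 0) := by
  set H' : ℝ → Matrix (Fin n ⊕ Fin n) (Fin n ⊕ Fin n) ℝ :=
    fun t => H (projIcc (0 : ℝ) 1 zero_le_one t) with hH'
  have hH'c : Continuous H' := by
    refine continuous_matrix fun i j => ?_
    exact (h.smooth i j).continuousOn.domRestrict.comp continuous_projIcc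
  set X := SpGroup.pathMatrix γ with hX
  have hXc : Continuous X := SpGroup.continuous_pathMatrix γ
  have hne : ∀ t, (complexPart (X t)).det ≠ 0 := fun t => psi_ne_zero (SpGroup.pathMatrix_mem γ t)
  set g : ℝ → ℂ := fun t =>
    ((complexPart (X t))⁻¹ * complexPart (J (Fin n) ℝ * H' t * X t)).trace with hg
  have hgc : Continuous g := by
    have h1 : Continuous fun t => complexPart (X t) := continuous_complexPart.comp hXc
    have h2 : Continuous fun t => (complexPart (X t))⁻¹ := by
      simp only [Matrix.inv_def, Ring.inverse_eq_inv']
      exact (Continuous.inv₀ h1.matrix_det hne).smul h1.matrix_adjugate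
    have h3 : Continuous fun t => complexPart (J (Fin n) ℝ * H' t * X t) :=
      continuous_complexPart.comp (by fun_prop)
    exact (h2.matrix_mul h3).matrix_trace
  have h0 : psi (X 0) = 1 := by
    have : X 0 = (γ.1 0).1 := SpGroup.pathMatrix_coe γ 0
    rw [this, show γ.1 0 = 1 from γ.2]
    exact psi_one
  have hd : ∀ t ∈ Icc (0 : ℝ) 1,
      HasDerivWithinAt (fun t => psi (X t)) (psi (X t) * g t) (Icc 0 1) t := by
    intro t ht
    have h1 := hasDerivWithinAt_det (hasDerivWithinAt_complexPart (h.deriv t ht))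
    refine h1.congr_deriv ?_
    have h2 : H' t = H t := by rw [hH']; simp only; rw [projIcc_of_mem zero_le_one ht]
    rw [hg]
    simp only [h2]
    rw [Matrix.inv_def, Matrix.smul_mul, trace_smul, Ring.inverse_eq_inv', smul_eq_mul, psi,
      mul_inv_cancel_left₀ (hne t)]
  have hl := isArgLift_of_hasDerivWithinAt hgc h0 hd
  have he : (fun t : I => psi (X t)) = fun t => psi (γ.1 t).1 := by
    ext t
    rw [hX, SpGroup.pathMatrix_coe]
  rw [he] at hl
  have hm := maslov_mk hl
  simp only [ContinuousMap.coe_mk, Icc.coe_one, Icc.coe_zero, intervalIntegral.integral_same,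
    zero_div, sub_zero] at hm
  have hnn : ∀ t, 0 ≤ (g t).im := fun t =>
    (trace_inv_mul_complexPart (SpGroup.pathMatrix_mem γ t) (hH _ (projIcc 0 1 zero_le_one t).2)).1
  have hpi := Real.pi_pos
  rw [hm]
  refine ⟨div_nonneg (intervalIntegral.integral_nonneg zero_le_one fun t _ => hnn t)
    (by positivity), fun h1 t ht => ?_⟩
  have h2 : (g t).im = 0 := by
    by_contra h3
    have h4 := intervalIntegral.integral_pos zero_lt_one
      (Complex.continuous_im.comp hgc).continuousOn (fun s _ => hnn s)
      ⟨t, ht, lt_of_le_of_ne (hnn t) (Ne.symm h3)⟩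
    have h5 : 0 < (∫ s in (0 : ℝ)..1, (g s).im) / (2 * Real.pi) := div_pos h4 (by positivity)
    exact h5.ne' h1
  have h3 := (trace_inv_mul_complexPart (SpGroup.pathMatrix_mem γ t)
    (hH _ (projIcc 0 1 zero_le_one t).2)).2 h2
  rwa [projIcc_of_mem zero_le_one ht] at h3

theorem maslov_nonneg_of_mem {x : SpCover n} (hx : x ∈ nonnegCone n) : 0 ≤ maslov x := by
  obtain ⟨γ, rfl, H, hH, h0⟩ := hx
  exact (hH.maslov_nonneg h0).1

theorem maslov_one : maslov (1 : SpCover n) = 0 := by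
  have h : IsArgLift (fun t => psi ((1 : basedPaths (SpGroup n)).1 t).1) (.const I 0) := by
    intro t
    change psi 1 = _
    simp [psi_one]
  have h1 := maslov_mk h
  rw [ContinuousMap.const_apply, ContinuousMap.const_apply, sub_self] at h1
  exact h1

theorem Generates.eq_one_of_zero {H : ℝ → Matrix (Fin n ⊕ Fin n) (Fin n ⊕ Fin n) ℝ}
    {γ : basedPaths (SpGroup n)} (h : Generates H γ) (hH : ∀ t ∈ Icc (0 : ℝ) 1, H t = 0) :
    γ = 1 := by
  apply Subtype.ext
  ext t i j
  have h1 : ∀ s ∈ Icc (0 : ℝ) 1,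
      HasDerivWithinAt (fun s => SpGroup.pathMatrix γ s i j) 0 (Icc 0 1) s := by
    intro s hs
    simpa [hH s hs] using h.deriv s hs i j
  have h4 := constant_of_derivWithin_zero (fun s hs => (h1 s hs).differentiableWithinAt)
    (fun s hs => (h1 s (Ico_subset_Icc_self hs)).derivWithin
      (uniqueDiffOn_Icc zero_lt_one s (Ico_subset_Icc_self hs))) t t.2
  have h5 := SpGroup.pathMatrix_coe γ 0
  rw [Icc.coe_zero, show γ.1 0 = 1 from γ.2] at h5
  rw [SpGroup.pathMatrix_coe, h5] at h4
  exact h4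

/-- The cone contains no nontrivial pair of mutually inverse elements: the product of two
non-negative paths that represent them has Maslov number `0`, hence vanishing Hamiltonian, and this
is a sum of two non-negative ones. -/
theorem eq_one_of_mem_of_inv_mem {x : SpCover n} (h1 : x ∈ nonnegCone n)
    (h2 : x⁻¹ ∈ nonnegCone n) : x = 1 := by
  obtain ⟨γ, rfl, H, hH, hH0⟩ := h1
  obtain ⟨δ, hδ, K, hK, hK0⟩ := h2
  have h3 : PathCover.mk (γ * δ) = 1 := by
    change PathCover.mk γ * PathCover.mk δ = 1
    rw [hδ, mul_inv_cancel]
  have h4 := ((hH.mul hK).maslov_nonneg fun t ht =>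
    (hH0 t ht).add (PosSemidef.mul_mul_transpose (hK0 t ht) _)).2 (by rw [h3, maslov_one])
  rw [hH.eq_one_of_zero fun t ht => ?_]
  · rfl
  have h5 := congrArg trace (h4 t ht)
  have h6 := PosSemidef.mul_mul_transpose (hK0 t ht)
    (J (Fin n) ℝ * SpGroup.pathMatrix γ t * J (Fin n) ℝ)
  rw [trace_add, trace_zero] at h5
  exact (hH0 t ht).trace_eq_zero_iff.1
    (by linarith [h6.trace_nonneg, (hH0 t ht).trace_nonneg])

theorem isOrderCone_nonnegCone : IsOrderCone (nonnegCone n) where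
  toIsNormalCone := isNormalCone_nonnegCone
  antisymm f g h1 h2 := by
    refine mul_inv_eq_one.1 (eq_one_of_mem_of_inv_mem h1 ?_)
    simpa [ConeGE] using h2

end Cone

/-! ### Diagonalization of unitary matrices -/

section UnitaryDiagonalization

open Matrix

variable {n : ℕ}

theorem exp_mul_I_injOn :
    InjOn (fun x : ℝ => Complex.exp (x * Complex.I)) (Ico 0 (2 * Real.pi)) := by
  intro x hx y hy h
  obtain ⟨k, hk⟩ := Complex.exp_eq_exp_iff_exists_int.1 h
  have h1 : x = y + k * (2 * Real.pi) := by
    have h2 : (x : ℂ) * Complex.I = ((y + k * (2 * Real.pi) : ℝ) : ℂ) * Complex.I := by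
      rw [hk]; push_cast; ring
    exact_mod_cast mul_right_cancel₀ Complex.I_ne_zero h2
  have hpi := Real.pi_pos
  have h3 : (k : ℝ) < 1 := by
    by_contra! h4
    nlinarith [hx.2, hy.1]
  have h4 : (-1 : ℝ) < k := by
    by_contra! h4
    nlinarith [hx.1, hy.2]
  have h5 : k = 0 := by
    have h6 : k < 1 := by exact_mod_cast h3
    have h7 : -1 < k := by exact_mod_cast h4
    omega
  simpa [h5] using h1

theorem exists_mem_Ico_exp_eq {z : ℂ} (hz : ‖z‖ = 1) :
    ∃ x ∈ Ico (0 : ℝ) (2 * Real.pi), Complex.exp (x * Complex.I) = z := by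
  obtain ⟨y, rfl⟩ := (Complex.norm_eq_one_iff z).1 hz
  refine ⟨toIcoMod Real.two_pi_pos 0 y, by simpa using toIcoMod_mem_Ico Real.two_pi_pos 0 y, ?_⟩
  rw [Complex.exp_eq_exp_iff_exists_int]
  refine ⟨-toIcoDiv Real.two_pi_pos 0 y, ?_⟩
  rw [toIcoMod, zsmul_eq_mul]
  push_cast
  ring

/-- The unitary diagonalization of a unitary matrix. A Cayley transform, centred at a point of the
unit circle outside of the spectrum, reduces it to that of a Hermitian matrix. -/
theorem exists_unitary_diagonalization {U : Matrix (Fin n) (Fin n) ℂ}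
    (hU : U ∈ unitaryGroup (Fin n) ℂ) :
    ∃ V ∈ unitaryGroup (Fin n) ℂ, ∃ θ : Fin n → ℝ, (∀ i, θ i ∈ Ico 0 (2 * Real.pi)) ∧
      U = V * diagonal (fun i => Complex.exp (θ i * Complex.I)) * Vᴴ := by
  have hU1 : Uᴴ * U = 1 := mem_unitaryGroup_iff'.1 hU
  obtain ⟨w, hw1, hw⟩ : ∃ w : ℂ, ‖w‖ = 1 ∧ (w • (1 : Matrix (Fin n) (Fin n) ℂ) - U).det ≠ 0 := by
    have h1 : ((fun x : ℝ => Complex.exp (x * Complex.I)) '' Ico 0 (2 * Real.pi)).Infinite :=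
      (Ico_infinite Real.two_pi_pos).image exp_mul_I_injOn
    obtain ⟨w, ⟨x, -, rfl⟩, hw⟩ := h1.exists_notMem_finset U.charpoly.roots.toFinset
    refine ⟨_, Complex.norm_exp_ofReal_mul_I x, fun h => hw ?_⟩
    rw [Multiset.mem_toFinset, Polynomial.mem_roots (charpoly_monic U).ne_zero, Polynomial.IsRoot,
      eval_charpoly, scalar_apply, ← h, smul_one_eq_diagonal]
  have hww : w * star w = 1 := by
    have := Complex.mul_conj w
    rw [Complex.normSq_eq_norm_sq, hw1] at this
    simpa using this
  set N := w • (1 : Matrix (Fin n) (Fin n) ℂ) - U with hN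
  set M := w • (1 : Matrix (Fin n) (Fin n) ℂ) + U with hM
  have hNu : IsUnit N.det := isUnit_iff_ne_zero.2 hw
  have hNi : N * N⁻¹ = 1 := Matrix.mul_nonsing_inv _ hNu
  have hNi' : N⁻¹ * N = 1 := Matrix.nonsing_inv_mul _ hNu
  have hNM : N * M = M * N := by
    rw [hN, hM]
    simp [Matrix.sub_mul, Matrix.mul_add, Matrix.add_mul, Matrix.mul_sub]
    module
  set h := Complex.I • (M * N⁻¹) with hh
  have hhN : h * N = Complex.I • M := by
    rw [hh, Matrix.smul_mul, Matrix.mul_assoc, hNi', Matrix.mul_one]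
  have hNH : Nᴴ = -(star w) • (Uᴴ * N) := by
    rw [hN, Matrix.mul_sub, hU1, conjTranspose_sub, conjTranspose_smul, conjTranspose_one,
      Matrix.mul_smul, Matrix.mul_one, smul_sub, smul_smul, neg_mul, mul_comm, hww]
    module
  have hMH : Mᴴ = (star w) • (Uᴴ * M) := by
    rw [hM, Matrix.mul_add, hU1, conjTranspose_add, conjTranspose_smul, conjTranspose_one,
      Matrix.mul_smul, Matrix.mul_one, smul_add, smul_smul, mul_comm, hww]
    module
  have hherm : h.IsHermitian := by
    have h1 : Nᴴ * hᴴ = Nᴴ * h := by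
      have e1 : Nᴴ * hᴴ = -(Complex.I • Mᴴ) := by
        rw [← conjTranspose_mul, hhN, conjTranspose_smul]
        simp
      have e2 : N * h = Complex.I • M := by
        rw [hh, Matrix.mul_smul, ← Matrix.mul_assoc, hNM, Matrix.mul_assoc, hNi, Matrix.mul_one]
      rw [e1, hNH, hMH, Matrix.smul_mul, Matrix.mul_assoc, e2, Matrix.mul_smul, smul_comm]
      module
    have h2 : IsUnit Nᴴ := by
      rw [Matrix.isUnit_iff_isUnit_det, det_conjTranspose]
      exact hNu.star
    exact h2.mul_left_cancel h1
  -- `(h + i) U = w (h - i)`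
  have hrel : (h + Complex.I • 1) * U = w • (h - Complex.I • 1) := by
    have h1 := hhN
    rw [hN, hM, Matrix.mul_sub, Matrix.mul_smul, Matrix.mul_one, smul_add, sub_eq_iff_eq_add] at h1
    rw [Matrix.add_mul, Matrix.smul_mul Complex.I 1 U, Matrix.one_mul, smul_sub, h1, smul_comm w]
    abel
  obtain ⟨V, lam, hV, hlam⟩ : ∃ (V : Matrix (Fin n) (Fin n) ℂ) (lam : Fin n → ℝ),
      V ∈ unitaryGroup (Fin n) ℂ ∧ h = V * diagonal (fun i => (lam i : ℂ)) * Vᴴ :=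
    ⟨hherm.eigenvectorUnitary, hherm.eigenvalues, hherm.eigenvectorUnitary.2, by
      conv_lhs => rw [hherm.spectral_theorem]
      rfl⟩
  have hV1 : Vᴴ * V = 1 := mem_unitaryGroup_iff'.1 hV
  have hV2 : V * Vᴴ = 1 := mem_unitaryGroup_iff.1 hV
  have hne : ∀ i, (lam i : ℂ) + Complex.I ≠ 0 := by
    intro i hi
    have := congrArg Complex.im hi
    simp at this
  set mu : Fin n → ℂ := fun i => w * (lam i - Complex.I) / (lam i + Complex.I) with hmu
  have hmu1 : ∀ i, ‖mu i‖ = 1 := by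
    intro i
    have h1 : ‖(lam i : ℂ) - Complex.I‖ = ‖(lam i : ℂ) + Complex.I‖ := by
      rw [← Complex.norm_conj]; simp
    rw [hmu]
    simp only [norm_div, norm_mul, hw1, h1, one_mul]
    exact div_self (norm_ne_zero_iff.2 (hne i))
  choose θ hθ hθe using fun i => exists_mem_Ico_exp_eq (hmu1 i)
  refine ⟨V, hV, θ, hθ, ?_⟩
  simp only [hθe]
  have d1 : ∀ c : ℂ, h + c • 1 = V * diagonal (fun i => (lam i : ℂ) + c) * Vᴴ := by
    intro c
    have : diagonal (fun i => (lam i : ℂ) + c) = diagonal (fun i => (lam i : ℂ)) + c • 1 := by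
      rw [smul_one_eq_diagonal, diagonal_add]
    rw [this, Matrix.mul_add, Matrix.add_mul, ← hlam, Matrix.mul_smul, Matrix.mul_one,
      Matrix.smul_mul, hV2]
  have d2 : w • (h - Complex.I • 1)
      = V * (diagonal (fun i => (lam i : ℂ) + Complex.I) * diagonal mu) * Vᴴ := by
    rw [sub_eq_add_neg, ← neg_smul, d1, diagonal_mul_diagonal]
    have : (fun i => ((lam i : ℂ) + Complex.I) * mu i) = w • fun i => (lam i : ℂ) + -Complex.I := by
      ext i
      rw [hmu]
      have := hne i
      simp only [Pi.smul_apply, smul_eq_mul]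
      field_simp
      ring
    rw [this, diagonal_smul, Matrix.mul_smul, Matrix.smul_mul]
  have hreg : IsUnit (h + Complex.I • (1 : Matrix (Fin n) (Fin n) ℂ)) := by
    rw [d1]
    have u1 : IsUnit V := IsUnit.of_mul_eq_one _ hV2
    have u2 : IsUnit Vᴴ := IsUnit.of_mul_eq_one _ hV1
    refine (u1.mul ?_).mul u2
    rw [Matrix.isUnit_iff_isUnit_det, det_diagonal, isUnit_iff_ne_zero, Finset.prod_ne_zero_iff]
    exact fun i _ => hne i
  apply hreg.mul_left_cancel
  rw [hrel, d2, d1]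
  simp only [Matrix.mul_assoc]
  rw [← Matrix.mul_assoc Vᴴ V, hV1, Matrix.one_mul]

/-- The functional calculus of a unitary matrix does not depend on the diagonalization. -/
theorem diagonalization_unique {V W : Matrix (Fin n) (Fin n) ℂ} {θ η : Fin n → ℝ}
    (hV : V ∈ unitaryGroup (Fin n) ℂ) (hW : W ∈ unitaryGroup (Fin n) ℂ)
    (hθ : ∀ i, θ i ∈ Ico 0 (2 * Real.pi)) (hη : ∀ i, η i ∈ Ico 0 (2 * Real.pi))
    (h : V * diagonal (fun i => Complex.exp (θ i * Complex.I)) * Vᴴ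
      = W * diagonal (fun i => Complex.exp (η i * Complex.I)) * Wᴴ) (f : ℝ → ℂ) :
    V * diagonal (fun i => f (θ i)) * Vᴴ = W * diagonal (fun i => f (η i)) * Wᴴ := by
  have hV1 : Vᴴ * V = 1 := mem_unitaryGroup_iff'.1 hV
  have hV2 : V * Vᴴ = 1 := mem_unitaryGroup_iff.1 hV
  have hW1 : Wᴴ * W = 1 := mem_unitaryGroup_iff'.1 hW
  have hW2 : W * Wᴴ = 1 := mem_unitaryGroup_iff.1 hW
  have h1 : (Wᴴ * V) * diagonal (fun i => Complex.exp (θ i * Complex.I))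
      = diagonal (fun i => Complex.exp (η i * Complex.I)) * (Wᴴ * V) := by
    calc _ = Wᴴ * (V * diagonal (fun i => Complex.exp (θ i * Complex.I)) * Vᴴ) * V := by
          simp only [Matrix.mul_assoc]; rw [hV1, Matrix.mul_one]
      _ = _ := by
          rw [h]; simp only [Matrix.mul_assoc]; rw [← Matrix.mul_assoc Wᴴ W, hW1, Matrix.one_mul]
  have h2 : (Wᴴ * V) * diagonal (fun i => f (θ i)) = diagonal (fun i => f (η i)) * (Wᴴ * V) := by
    ext a b
    have h3 := congrFun (congrFun h1 a) b
    rw [mul_diagonal, diagonal_mul] at h3 ⊢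
    by_cases h4 : (Wᴴ * V) a b = 0
    · simp [h4]
    · rw [mul_comm] at h3
      rw [exp_mul_I_injOn (hθ b) (hη a) (mul_right_cancel₀ h4 h3), mul_comm]
  calc _ = W * (Wᴴ * V * diagonal (fun i => f (θ i))) * Vᴴ := by
        simp only [Matrix.mul_assoc]; rw [← Matrix.mul_assoc W Wᴴ, hW2, Matrix.one_mul]
    _ = _ := by rw [h2]; simp only [Matrix.mul_assoc]; rw [hV2, Matrix.mul_one]

theorem isCompact_unitaryGroup :
    IsCompact (unitaryGroup (Fin n) ℂ : Set (Matrix (Fin n) (Fin n) ℂ)) := by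
  have h1 : IsCompact (Set.univ.pi fun _ => Set.univ.pi fun _ => Metric.closedBall (0 : ℂ) 1 :
      Set (Fin n → Fin n → ℂ)) :=
    isCompact_univ_pi fun _ => isCompact_univ_pi fun _ => isCompact_closedBall 0 1
  refine IsCompact.of_isClosed_subset h1 ?_ fun U hU i _ j _ => ?_
  · have h2 : (unitaryGroup (Fin n) ℂ : Set (Matrix (Fin n) (Fin n) ℂ)) = {U | U * star U = 1} := by
      ext U; exact mem_unitaryGroup_iff
    rw [h2]
    exact isClosed_eq (by fun_prop) continuous_const
  · simpa using entry_norm_bound_of_unitary hU i j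

end UnitaryDiagonalization

/-! ### Unitary one-parameter groups and rotation loops -/

section UnitaryPaths

open Matrix

variable {n : ℕ}

/-- The one-parameter group `t ↦ V diag(exp(i t θ)) Vᴴ`. -/
def unitaryFlow (V : Matrix (Fin n) (Fin n) ℂ) (θ : Fin n → ℝ) (t : ℝ) :
    Matrix (Fin n) (Fin n) ℂ :=
  V * diagonal (fun i => Complex.exp ((t * θ i : ℝ) * Complex.I)) * Vᴴ

theorem unitaryFlow_add {V : Matrix (Fin n) (Fin n) ℂ} (hV : V ∈ unitaryGroup (Fin n) ℂ)
    (θ η : Fin n → ℝ) (t : ℝ) :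
    unitaryFlow V (θ + η) t = unitaryFlow V θ t * unitaryFlow V η t := by
  have hV1 : Vᴴ * V = 1 := mem_unitaryGroup_iff'.1 hV
  have h1 : (fun i => Complex.exp ((t * (θ + η) i : ℝ) * Complex.I))
      = fun i => Complex.exp ((t * θ i : ℝ) * Complex.I) * Complex.exp ((t * η i : ℝ) * Complex.I) := by
    ext i
    rw [← Complex.exp_add]
    congr 1
    simp only [Pi.add_apply]
    push_cast
    ring
  rw [unitaryFlow, h1, ← diagonal_mul_diagonal, unitaryFlow, unitaryFlow]
  simp only [Matrix.mul_assoc]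
  rw [← Matrix.mul_assoc Vᴴ V, hV1, Matrix.one_mul]

theorem unitaryFlow_zero_right {V : Matrix (Fin n) (Fin n) ℂ} (hV : V ∈ unitaryGroup (Fin n) ℂ)
    (θ : Fin n → ℝ) : unitaryFlow V θ 0 = 1 := by
  have hV1 : V * Vᴴ = 1 := mem_unitaryGroup_iff.1 hV
  simp [unitaryFlow, hV1]

theorem unitaryFlow_zero {V : Matrix (Fin n) (Fin n) ℂ} (hV : V ∈ unitaryGroup (Fin n) ℂ)
    (t : ℝ) : unitaryFlow V 0 t = 1 := by
  have hV1 : V * Vᴴ = 1 := mem_unitaryGroup_iff.1 hV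
  simp [unitaryFlow, hV1]

theorem unitaryFlow_mem {V : Matrix (Fin n) (Fin n) ℂ} (hV : V ∈ unitaryGroup (Fin n) ℂ)
    (θ : Fin n → ℝ) (t : ℝ) : unitaryFlow V θ t ∈ unitaryGroup (Fin n) ℂ := by
  refine mul_mem (mul_mem hV ?_) (Unitary.star_mem hV)
  rw [mem_unitaryGroup_iff, star_eq_conjTranspose, diagonal_conjTranspose, diagonal_mul_diagonal,
    ← diagonal_one]
  congr 1
  ext i
  rw [Pi.star_apply, Complex.star_def, Complex.mul_conj, Complex.normSq_eq_norm_sq,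
    Complex.norm_exp_ofReal_mul_I]
  simp

theorem det_unitaryFlow {V : Matrix (Fin n) (Fin n) ℂ} (hV : V ∈ unitaryGroup (Fin n) ℂ)
    (θ : Fin n → ℝ) (t : ℝ) :
    (unitaryFlow V θ t).det = Complex.exp ((t * ∑ i, θ i : ℝ) * Complex.I) := by
  have hV1 : Vᴴ * V = 1 := mem_unitaryGroup_iff'.1 hV
  rw [unitaryFlow, det_mul, mul_comm, ← det_mul, ← Matrix.mul_assoc, hV1,
    Matrix.one_mul, det_diagonal, ← Complex.exp_sum]
  congr 1
  push_cast
  rw [Finset.mul_sum, Finset.sum_mul]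

theorem continuous_unitaryFlow {Y : Type*} [TopologicalSpace Y] {V : Y → Matrix (Fin n) (Fin n) ℂ}
    {θ : Y → Fin n → ℝ} {t : Y → ℝ} (hV : Continuous V) (hθ : Continuous θ) (ht : Continuous t) :
    Continuous fun y => unitaryFlow (V y) (θ y) (t y) := by
  unfold unitaryFlow
  fun_prop

/-- The path `t ↦ V diag(exp(i t θ)) Vᴴ` in the symplectic group. -/
def unitaryPath (V : unitaryGroup (Fin n) ℂ) (θ : Fin n → ℝ) : basedPaths (SpGroup n) :=
  ⟨⟨fun t => ⟨realify (unitaryFlow V.1 θ t),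
      realify_mem_symplecticGroup (unitaryFlow_mem V.2 θ t)⟩, Continuous.subtype_mk
        (continuous_realify.comp
          (continuous_unitaryFlow continuous_const continuous_const continuous_subtype_val)) _⟩,
    Subtype.ext (by
      change realify (unitaryFlow V.1 θ ((0 : I) : ℝ)) = 1
      rw [Icc.coe_zero, unitaryFlow_zero_right V.2, realify_one])⟩

theorem unitaryPath_add (V : unitaryGroup (Fin n) ℂ) (θ η : Fin n → ℝ) :
    unitaryPath V (θ + η) = unitaryPath V θ * unitaryPath V η := by
  apply Subtype.ext
  ext t : 1
  apply Subtype.ext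
  change realify (unitaryFlow V.1 (θ + η) t)
    = realify (unitaryFlow V.1 θ t) * realify (unitaryFlow V.1 η t)
  rw [unitaryFlow_add V.2, realify_mul]

theorem unitaryPath_zero (V : unitaryGroup (Fin n) ℂ) : unitaryPath V 0 = 1 := by
  apply Subtype.ext
  ext t : 1
  apply Subtype.ext
  change realify (unitaryFlow V.1 0 t) = 1
  rw [unitaryFlow_zero V.2, realify_one]

theorem hasDerivAt_unitaryFlow {V : Matrix (Fin n) (Fin n) ℂ} (hV : V ∈ unitaryGroup (Fin n) ℂ)
    (θ : Fin n → ℝ) (t : ℝ) (i j : Fin n) :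
    HasDerivAt (fun s => unitaryFlow V θ s i j)
      ((Complex.I • (V * diagonal (fun i => (θ i : ℂ)) * Vᴴ) * unitaryFlow V θ t) i j) t := by
  have hV1 : Vᴴ * V = 1 := mem_unitaryGroup_iff'.1 hV
  have h1 : Complex.I • (V * diagonal (fun i => (θ i : ℂ)) * Vᴴ) * unitaryFlow V θ t
      = V * diagonal (fun i => Complex.exp ((t * θ i : ℝ) * Complex.I) * (θ i * Complex.I)) * Vᴴ := by
    have h2 : (fun i => Complex.exp ((t * θ i : ℝ) * Complex.I) * (θ i * Complex.I))
        = Complex.I • fun i => (θ i : ℂ) * Complex.exp ((t * θ i : ℝ) * Complex.I) := by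
      ext i
      simp only [Pi.smul_apply, smul_eq_mul]
      ring
    rw [h2, diagonal_smul, ← diagonal_mul_diagonal, unitaryFlow, Matrix.smul_mul, Matrix.mul_smul,
      Matrix.smul_mul]
    simp only [Matrix.mul_assoc]
    rw [← Matrix.mul_assoc Vᴴ V, hV1, Matrix.one_mul]
  rw [h1]
  simp only [unitaryFlow, Matrix.mul_apply (M := V * _), mul_diagonal]
  refine HasDerivAt.fun_sum fun k _ => ?_
  have h3 : HasDerivAt (fun s : ℝ => ((s * θ k : ℝ) : ℂ) * Complex.I) (θ k * Complex.I) t := by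
    have := (((hasDerivAt_id t).mul_const (θ k)).ofReal_comp).mul_const Complex.I
    simpa using this
  exact (h3.cexp.const_mul _).mul_const _

theorem hasDerivAt_realify {A : ℝ → Matrix (Fin n) (Fin n) ℂ} {A' : Matrix (Fin n) (Fin n) ℂ}
    {t : ℝ} (hA : ∀ i j, HasDerivAt (fun s => A s i j) (A' i j) t) (i j : Fin n ⊕ Fin n) :
    HasDerivAt (fun s => realify (A s) i j) (realify A' i j) t := by
  have hre : ∀ i j, HasDerivAt (fun s => (A s i j).re) (A' i j).re t := fun i j =>
    Complex.reCLM.hasFDerivAt.comp_hasDerivAt t (hA i j)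
  have him : ∀ i j, HasDerivAt (fun s => (A s i j).im) (A' i j).im t := fun i j =>
    Complex.imCLM.hasFDerivAt.comp_hasDerivAt t (hA i j)
  rcases i with i | i <;> rcases j with j | j
  · exact hre i j
  · exact (him i j).neg
  · exact him i j
  · exact hre i j

theorem generates_unitaryPath (V : unitaryGroup (Fin n) ℂ) (θ : Fin n → ℝ) :
    Generates (fun _ => realify (V.1 * diagonal (fun i => (θ i : ℂ)) * V.1ᴴ)) (unitaryPath V θ) where
  smooth _ _ := contDiffOn_const
  symm t _ := by
    rw [IsSymm, ← realify_conjTranspose]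
    congr 1
    simp only [conjTranspose_mul, conjTranspose_conjTranspose, diagonal_conjTranspose,
      Matrix.mul_assoc]
    congr 3
    ext i
    simp
  deriv t ht i j := by
    have h1 := (hasDerivAt_realify (hasDerivAt_unitaryFlow V.2 θ t) i j).hasDerivWithinAt (s := Icc 0 1)
    have h2 : ∀ s ∈ Icc (0 : ℝ) 1,
        SpGroup.pathMatrix (unitaryPath V θ) s = realify (unitaryFlow V.1 θ s) :=
      fun s hs => SpGroup.pathMatrix_coe (unitaryPath V θ) ⟨s, hs⟩
    have h3 : HasDerivWithinAt (fun s => SpGroup.pathMatrix (unitaryPath V θ) s i j) _ (Icc 0 1) t :=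
      h1.congr (fun s hs => by rw [h2 s hs]) (by rw [h2 t ht])
    rw [h2 t ht, J_eq_realify, ← realify_mul, ← realify_mul, Matrix.smul_mul Complex.I 1,
      Matrix.one_mul]
    exact h3

theorem mk_unitaryPath_mem_nonnegCone (V : unitaryGroup (Fin n) ℂ) {θ : Fin n → ℝ}
    (hθ : ∀ i, 0 ≤ θ i) : PathCover.mk (unitaryPath V θ) ∈ nonnegCone n := by
  refine ⟨_, rfl, _, generates_unitaryPath V θ, fun t _ => ?_⟩
  rw [realify_mul, realify_mul, realify_conjTranspose]
  refine PosSemidef.mul_mul_transpose ?_ _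
  have h1 : realify (diagonal fun i => (θ i : ℂ)) = diagonal (Sum.elim θ θ) := by
    ext (i | i) (j | j) <;> by_cases h : i = j <;> simp [realify, h]
  rw [h1]
  refine PosSemidef.diagonal ?_
  rintro (i | i) <;> simpa using hθ i

theorem unitaryPath_eq_conjPath (V : unitaryGroup (Fin n) ℂ) (θ : Fin n → ℝ) :
    unitaryPath V θ = conjPath ⟨realify V.1, realify_mem_symplecticGroup V.2⟩ (unitaryPath 1 θ) := by
  apply Subtype.ext
  ext t : 1
  change (unitaryPath V θ).1 t = _ * (unitaryPath 1 θ).1 t * _⁻¹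
  rw [eq_mul_inv_iff_mul_eq]
  apply Subtype.ext
  change realify (unitaryFlow V.1 θ t) * realify V.1 = realify V.1 * realify (unitaryFlow 1 θ t)
  have hV1 : V.1ᴴ * V.1 = 1 := mem_unitaryGroup_iff'.1 V.2
  rw [← realify_mul, ← realify_mul]
  congr 1
  rw [unitaryFlow, unitaryFlow, Matrix.mul_assoc, hV1, conjTranspose_one]
  simp

/-- Loops are not changed, up to homotopy, by conjugation with a unitary matrix. -/
theorem mk_conjPath_unitary (V : unitaryGroup (Fin n) ℂ) {γ : basedPaths (SpGroup n)}
    (hγ : γ.1 1 = 1) :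
    PathCover.mk (conjPath ⟨realify V.1, realify_mem_symplecticGroup V.2⟩ γ) = PathCover.mk γ := by
  obtain ⟨W, hW, θ, -, hVW⟩ := exists_unitary_diagonalization V.2
  have h1 : (unitaryPath ⟨W, hW⟩ θ).1 1 = ⟨realify V.1, realify_mem_symplecticGroup V.2⟩ := by
    apply Subtype.ext
    change realify (unitaryFlow W θ ((1 : I) : ℝ)) = realify V.1
    rw [hVW, unitaryFlow]
    simp
  rw [← h1, ← conj_mk]
  exact mul_inv_eq_iff_eq_mul.2 (commute_mk_of_loop hγ _)

theorem unitaryPath_one_of_int (V : unitaryGroup (Fin n) ℂ) {θ : Fin n → ℝ}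
    (hθ : ∀ i, ∃ k : ℤ, θ i = k * (2 * Real.pi)) : (unitaryPath V θ).1 1 = 1 := by
  apply Subtype.ext
  change realify (unitaryFlow V.1 θ ((1 : I) : ℝ)) = 1
  have h1 : (fun i => Complex.exp (((1 : ℝ) * θ i : ℝ) * Complex.I)) = fun _ => 1 := by
    ext i
    obtain ⟨k, hk⟩ := hθ i
    rw [Complex.exp_eq_one_iff]
    exact ⟨k, by rw [hk]; push_cast; ring⟩
  have hV1 : V.1 * V.1ᴴ = 1 := mem_unitaryGroup_iff.1 V.2
  rw [unitaryFlow, Icc.coe_one, h1, diagonal_one, Matrix.mul_one, hV1, realify_one]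

/-- The permutation matrix of `e`. -/
def permUnitary (e : Equiv.Perm (Fin n)) : unitaryGroup (Fin n) ℂ :=
  ⟨(1 : Matrix (Fin n) (Fin n) ℂ).submatrix e id, by
    rw [mem_unitaryGroup_iff, star_eq_conjTranspose, conjTranspose_submatrix, conjTranspose_one,
      ← submatrix_mul _ _ _ id _ Function.bijective_id, Matrix.one_mul, submatrix_one_equiv]⟩

theorem unitaryPath_permUnitary (e : Equiv.Perm (Fin n)) (θ : Fin n → ℝ) :
    unitaryPath (permUnitary e) θ = unitaryPath 1 (θ ∘ e) := by
  apply Subtype.ext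
  ext t : 1
  apply Subtype.ext
  change realify (unitaryFlow _ θ t) = realify (unitaryFlow _ (θ ∘ e) t)
  congr 1
  change ((1 : Matrix (Fin n) (Fin n) ℂ).submatrix e id) * _ * ((1 : Matrix _ _ ℂ).submatrix e id)ᴴ
    = 1 * _ * 1ᴴ
  rw [conjTranspose_submatrix, conjTranspose_one, Matrix.one_mul, Matrix.mul_one]
  ext i j
  rcases eq_or_ne i j with rfl | h <;> simp [Matrix.mul_apply, diagonal_apply, Matrix.one_apply, *]

/-- The class of the loop that rotates one complex coordinate once. -/
def rotationLoop (i : Fin n) : SpCover n :=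
  PathCover.mk (unitaryPath 1 (Pi.single i (2 * Real.pi)))

theorem exists_int_single (i j : Fin n) :
    ∃ k : ℤ, (Pi.single i (2 * Real.pi) : Fin n → ℝ) j = k * (2 * Real.pi) := by
  by_cases h : j = i
  · subst h; exact ⟨1, by simp⟩
  · exact ⟨0, by simp [h]⟩

theorem mk_unitaryPath_single (V : unitaryGroup (Fin n) ℂ) (i j : Fin n) :
    PathCover.mk (unitaryPath V (Pi.single j (2 * Real.pi))) = rotationLoop i := by
  rw [unitaryPath_eq_conjPath, mk_conjPath_unitary V (unitaryPath_one_of_int 1 (exists_int_single j))]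
  have h1 : (Pi.single i (2 * Real.pi) : Fin n → ℝ) = Pi.single j (2 * Real.pi) ∘ Equiv.swap i j := by
    ext k
    by_cases hk : k = i
    · subst hk; simp
    · have : Equiv.swap i j k ≠ j := by
        intro h
        apply hk
        have := congrArg (Equiv.swap i j) h
        simpa using this
      simp [hk, this]
  rw [rotationLoop, h1, ← unitaryPath_permUnitary, unitaryPath_eq_conjPath (permUnitary _),
    mk_conjPath_unitary _ (unitaryPath_one_of_int 1 (exists_int_single j))]

theorem mk_unitaryPath_add (V : unitaryGroup (Fin n) ℂ) (θ η : Fin n → ℝ) :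
    PathCover.mk (unitaryPath V (θ + η))
      = PathCover.mk (unitaryPath V θ) * PathCover.mk (unitaryPath V η) := by
  rw [unitaryPath_add]; rfl

theorem mk_unitaryPath_sum_single (V : unitaryGroup (Fin n) ℂ) (i : Fin n) (s : Finset (Fin n)) :
    PathCover.mk (unitaryPath V (∑ j ∈ s, Pi.single j (2 * Real.pi)))
      = rotationLoop i ^ s.card := by
  induction s using Finset.induction_on with
  | empty => rw [Finset.sum_empty, unitaryPath_zero]; rfl
  | insert a s ha ih =>
    rw [Finset.sum_insert ha, mk_unitaryPath_add, ih, mk_unitaryPath_single V i,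
      Finset.card_insert_of_notMem ha, pow_succ']

theorem commute_rotationLoop (i : Fin n) (x : SpCover n) : Commute x (rotationLoop i) :=
  commute_mk_of_loop (unitaryPath_one_of_int 1 (exists_int_single i)) x

theorem rotationLoop_mem (i : Fin n) : rotationLoop i ∈ nonnegCone n := by
  refine mk_unitaryPath_mem_nonnegCone 1 fun j => ?_
  have hpi := Real.pi_pos
  by_cases h : j = i
  · subst h; simp [hpi.le]
  · simp [h]

/-- An angle `2π` can be replaced by the angle `0` at the cost of a full rotation. -/
theorem mk_unitaryPath_reduce (V : unitaryGroup (Fin n) ℂ) (i : Fin n) {θ : Fin n → ℝ}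
    (hθ : ∀ j, θ j ∈ Icc 0 (2 * Real.pi)) :
    ∃ (η : Fin n → ℝ) (k : ℕ), (∀ j, η j ∈ Ico 0 (2 * Real.pi)) ∧
      (∑ j, θ j = ∑ j, η j + k * (2 * Real.pi)) ∧
      unitaryFlow V.1 θ 1 = unitaryFlow V.1 η 1 ∧
      PathCover.mk (unitaryPath V θ) = rotationLoop i ^ k * PathCover.mk (unitaryPath V η) := by
  have hpi := Real.pi_pos
  set s : Finset (Fin n) := Finset.univ.filter fun j => θ j = 2 * Real.pi with hs
  set η : Fin n → ℝ := fun j => if θ j = 2 * Real.pi then 0 else θ j with hη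
  have h1 : θ = (∑ j ∈ s, Pi.single j (2 * Real.pi)) + η := by
    ext j
    rw [Pi.add_apply, Finset.sum_apply, Finset.sum_pi_single]
    by_cases h : θ j = 2 * Real.pi <;> simp [hs, hη, h]
  refine ⟨η, s.card, fun j => ?_, ?_, ?_, ?_⟩
  · by_cases h : θ j = 2 * Real.pi
    · simp [hη, h, hpi]
    · simp only [hη, h, if_false]
      exact ⟨(hθ j).1, lt_of_le_of_ne (hθ j).2 h⟩
  · conv_lhs => rw [h1]
    simp only [Pi.add_apply, Finset.sum_add_distrib, Finset.sum_apply, Finset.sum_pi_single]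
    simp [← nsmul_eq_mul, add_comm]
  · have h2 := unitaryPath_one_of_int V (θ := ∑ j ∈ s, Pi.single j (2 * Real.pi)) fun j => by
      rw [Finset.sum_apply, Finset.sum_pi_single]
      by_cases h : j ∈ s
      · exact ⟨1, by simp [h]⟩
      · exact ⟨0, by simp [h]⟩
    have h3 : realify (unitaryFlow V.1 (∑ j ∈ s, Pi.single j (2 * Real.pi)) ((1 : I) : ℝ)) = 1 :=
      congrArg Subtype.val h2
    rw [← realify_one, Icc.coe_one] at h3
    conv_lhs => rw [h1]
    rw [unitaryFlow_add V.2, realify_injective h3, Matrix.one_mul]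
  · conv_lhs => rw [h1]
    rw [mk_unitaryPath_add, mk_unitaryPath_sum_single V i]

/-- The class of `t ↦ V diag(exp(i t θ)) Vᴴ`, corrected by full rotations, only depends on the
end point and on the total angle. -/
theorem rotationLoop_zpow_mul_mk_unitaryPath {V W : unitaryGroup (Fin n) ℂ} (i : Fin n)
    {θ η : Fin n → ℝ} (hθ : ∀ j, θ j ∈ Icc 0 (2 * Real.pi)) (hη : ∀ j, η j ∈ Icc 0 (2 * Real.pi))
    (h : unitaryFlow V.1 θ 1 = unitaryFlow W.1 η 1) {k l : ℤ}
    (hkl : k * (2 * Real.pi) + ∑ j, θ j = l * (2 * Real.pi) + ∑ j, η j) :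
    rotationLoop i ^ k * PathCover.mk (unitaryPath V θ)
      = rotationLoop i ^ l * PathCover.mk (unitaryPath W η) := by
  obtain ⟨θ', a, hθ', hsθ, hfθ, hmθ⟩ := mk_unitaryPath_reduce V i hθ
  obtain ⟨η', b, hη', hsη, hfη, hmη⟩ := mk_unitaryPath_reduce W i hη
  rw [hfθ, hfη] at h
  have hu := diagonalization_unique V.2 W.2 hθ' hη' (by simpa [unitaryFlow] using h)
  have hp : unitaryPath V θ' = unitaryPath W η' := by
    apply Subtype.ext
    ext t : 1
    apply Subtype.ext
    change realify (unitaryFlow _ _ t) = realify (unitaryFlow _ _ t)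
    congr 1
    exact hu fun x => Complex.exp ((t * x : ℝ) * Complex.I)
  have ht : ∑ j, θ' j = ∑ j, η' j := by
    have h1 := congrArg trace (hu fun x => (x : ℂ))
    rw [trace_mul_comm, ← Matrix.mul_assoc, show V.1ᴴ * V.1 = 1 from mem_unitaryGroup_iff'.1 V.2,
      trace_mul_comm (W.1 * _), ← Matrix.mul_assoc,
      show W.1ᴴ * W.1 = 1 from mem_unitaryGroup_iff'.1 W.2, Matrix.one_mul, Matrix.one_mul,
      trace_diagonal, trace_diagonal] at h1
    exact_mod_cast h1
  have hpi := Real.pi_pos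
  have hk : k + a = l + b := by
    rw [hsθ, hsη, ht] at hkl
    have h2 : ((k + a : ℤ) : ℝ) * (2 * Real.pi) = ((l + b : ℤ) : ℝ) * (2 * Real.pi) := by
      push_cast; linarith
    exact_mod_cast mul_right_cancel₀ (by positivity) h2
  rw [hmθ, hmη, ← mul_assoc, ← mul_assoc, ← zpow_natCast, ← zpow_natCast, ← _root_.zpow_add,
    ← _root_.zpow_add, hk, hp]

end UnitaryPaths

/-! ### Contraction by the Cayley transform -/

section Cayley

open Matrix

variable {n : ℕ}

/-- The contraction of a matrix `M` to `1` along the ray through its Cayley transform: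
`t (M - 1) (M + 1)⁻¹` is the Cayley transform of `cayley M t`. -/
def cayley (M : Matrix (Fin n ⊕ Fin n) (Fin n ⊕ Fin n) ℝ) (t : ℝ) :
    Matrix (Fin n ⊕ Fin n) (Fin n ⊕ Fin n) ℝ :=
  ((1 + t) • M + (1 - t) • 1) * ((1 - t) • M + (1 + t) • 1)⁻¹

/-- The matrices `M` for which `cayley M` is defined on `[0, 1]`, that is, those without eigenvalues
in `(-∞, -1]`. -/
def CayleyAdmissible (M : Matrix (Fin n ⊕ Fin n) (Fin n ⊕ Fin n) ℝ) : Prop :=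
  ∀ t : I, ((1 - (t : ℝ)) • M + (1 + (t : ℝ)) • 1).det ≠ 0

theorem PosSemidef.cayleyAdmissible {M : Matrix (Fin n ⊕ Fin n) (Fin n ⊕ Fin n) ℝ}
    (hM : M.PosSemidef) : CayleyAdmissible M := fun t =>
  (PosDef.posSemidef_add (hM.smul (sub_nonneg.2 t.2.2))
    (PosDef.one.smul (by linarith [t.2.1] : (0 : ℝ) < 1 + t))).det_pos.ne'

theorem cayley_zero {M : Matrix (Fin n ⊕ Fin n) (Fin n ⊕ Fin n) ℝ} (hM : CayleyAdmissible M) :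
    cayley M 0 = 1 := by
  have h := hM 0
  simp only [cayley, Icc.coe_zero, add_zero, sub_zero] at h ⊢
  exact Matrix.mul_nonsing_inv _ (isUnit_iff_ne_zero.2 h)

theorem cayley_one_right (M : Matrix (Fin n ⊕ Fin n) (Fin n ⊕ Fin n) ℝ) : cayley M 1 = M := by
  have h1 : ((1 + 1 : ℝ) • (1 : Matrix (Fin n ⊕ Fin n) (Fin n ⊕ Fin n) ℝ))⁻¹
      = (1 / 2 : ℝ) • 1 := by
    refine Matrix.inv_eq_right_inv ?_
    rw [Matrix.smul_mul, Matrix.one_mul, smul_smul]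
    norm_num
  simp only [cayley, sub_self, zero_smul, add_zero, zero_add]
  rw [h1, Matrix.mul_smul, Matrix.mul_one, smul_smul]
  norm_num

theorem cayley_one_left {t : ℝ} : cayley (1 : Matrix (Fin n ⊕ Fin n) (Fin n ⊕ Fin n) ℝ) t = 1 := by
  have h1 : (1 + t) • (1 : Matrix (Fin n ⊕ Fin n) (Fin n ⊕ Fin n) ℝ) + (1 - t) • 1
      = (2 : ℝ) • 1 := by module
  have h2 : (1 - t) • (1 : Matrix (Fin n ⊕ Fin n) (Fin n ⊕ Fin n) ℝ) + (1 + t) • 1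
      = (2 : ℝ) • 1 := by module
  rw [cayley, h1, h2]
  refine Matrix.mul_nonsing_inv _ ?_
  rw [smul_one_eq_diagonal, det_diagonal, isUnit_iff_ne_zero, Finset.prod_ne_zero_iff]
  norm_num

/-- The numerator and the denominator of `cayley M t` commute. -/
theorem cayley_commute (M : Matrix (Fin n ⊕ Fin n) (Fin n ⊕ Fin n) ℝ) (a b : ℝ) :
    (a • M + b • 1) * (b • M + a • 1) = (b • M + a • 1) * (a • M + b • 1) := by
  simp only [Matrix.add_mul, Matrix.mul_add, Matrix.smul_mul, Matrix.mul_smul, Matrix.one_mul,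
    Matrix.mul_one]
  module

theorem cayley_eq_inv_mul {M : Matrix (Fin n ⊕ Fin n) (Fin n ⊕ Fin n) ℝ} (hM : CayleyAdmissible M)
    (t : I) : cayley M t
      = ((1 - (t : ℝ)) • M + (1 + (t : ℝ)) • 1)⁻¹ * ((1 + (t : ℝ)) • M + (1 - (t : ℝ)) • 1) := by
  set D := (1 - (t : ℝ)) • M + (1 + (t : ℝ)) • (1 : Matrix (Fin n ⊕ Fin n) (Fin n ⊕ Fin n) ℝ) with hD
  have hu : IsUnit D.det := isUnit_iff_ne_zero.2 (hM t)
  have h1 : D * D⁻¹ = 1 := Matrix.mul_nonsing_inv _ hu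
  have h2 : D⁻¹ * D = 1 := Matrix.nonsing_inv_mul _ hu
  have h3 := cayley_commute M (1 + t) (1 - t)
  rw [← hD] at h3
  rw [cayley, ← hD]
  calc _ = D⁻¹ * (D * ((1 + (t : ℝ)) • M + (1 - (t : ℝ)) • 1)) * D⁻¹ := by
        rw [← Matrix.mul_assoc, h2, Matrix.one_mul]
    _ = _ := by rw [← h3, Matrix.mul_assoc, Matrix.mul_assoc, h1, Matrix.mul_one]

theorem cayley_mem {M : Matrix (Fin n ⊕ Fin n) (Fin n ⊕ Fin n) ℝ}
    (hMs : M ∈ symplecticGroup (Fin n) ℝ) (hM : CayleyAdmissible M) (t : I) :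
    cayley M t ∈ symplecticGroup (Fin n) ℝ := by
  have hu : IsUnit ((1 - (t : ℝ)) • M + (1 + (t : ℝ)) • 1).det := isUnit_iff_ne_zero.2 (hM t)
  have h4 := SymplecticGroup.mem_iff.1 hMs
  rw [SymplecticGroup.mem_iff, cayley_eq_inv_mul hM]
  set D := (1 - (t : ℝ)) • M + (1 + (t : ℝ)) • (1 : Matrix (Fin n ⊕ Fin n) (Fin n ⊕ Fin n) ℝ) with hD
  set N := (1 + (t : ℝ)) • M + (1 - (t : ℝ)) • (1 : Matrix (Fin n ⊕ Fin n) (Fin n ⊕ Fin n) ℝ) with hN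
  have h2 : D⁻¹ * D = 1 := Matrix.nonsing_inv_mul _ hu
  have h5 : N * J (Fin n) ℝ * Nᵀ = D * J (Fin n) ℝ * Dᵀ := by
    rw [hN, hD]
    simp only [transpose_add, transpose_smul, transpose_one, Matrix.add_mul, Matrix.mul_add,
      Matrix.smul_mul, Matrix.mul_smul, Matrix.one_mul, Matrix.mul_one, h4]
    module
  have h6 : Dᵀ * (D⁻¹)ᵀ = 1 := by rw [← transpose_mul, h2, transpose_one]
  calc D⁻¹ * N * J (Fin n) ℝ * (D⁻¹ * N)ᵀ = D⁻¹ * (N * J (Fin n) ℝ * Nᵀ) * (D⁻¹)ᵀ := by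
        rw [transpose_mul]; simp only [Matrix.mul_assoc]
    _ = D⁻¹ * D * J (Fin n) ℝ * (Dᵀ * (D⁻¹)ᵀ) := by rw [h5]; simp only [Matrix.mul_assoc]
    _ = _ := by rw [h2, h6, Matrix.one_mul, Matrix.mul_one]

theorem continuous_cayley {Y : Type*} [TopologicalSpace Y]
    {M : Y → Matrix (Fin n ⊕ Fin n) (Fin n ⊕ Fin n) ℝ} {t : Y → I} (hM : Continuous M)
    (ht : Continuous t) (h : ∀ y, CayleyAdmissible (M y)) :
    Continuous fun y => cayley (M y) (t y) := by
  simp only [cayley, Matrix.inv_def, Ring.inverse_eq_inv']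
  have h1 : Continuous fun y => (1 - (t y : ℝ)) • M y + (1 + (t y : ℝ)) • 1 := by fun_prop
  have h2 : Continuous fun y => (1 + (t y : ℝ)) • M y + (1 - (t y : ℝ)) • 1 := by fun_prop
  exact h2.matrix_mul ((Continuous.inv₀ h1.matrix_det fun y => h y (t y)).smul h1.matrix_adjugate)

/-- The path `t ↦ cayley P t` from `1` to `P`. -/
def cayleyPath (P : SpGroup n) (hP : CayleyAdmissible P.1) : basedPaths (SpGroup n) :=
  ⟨⟨fun t => ⟨cayley P.1 t, cayley_mem P.2 hP t⟩,
    (continuous_cayley continuous_const continuous_id fun _ => hP).subtype_mk _⟩,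
    Subtype.ext (by
      change cayley P.1 ((0 : I) : ℝ) = 1
      rw [Icc.coe_zero, cayley_zero hP])⟩

theorem cayleyPath_apply_one (P : SpGroup n) (hP : CayleyAdmissible P.1) :
    (cayleyPath P hP).1 1 = P :=
  Subtype.ext (cayley_one_right P.1)

/-- A path of matrices that can be contracted by the Cayley transform is determined, up to
homotopy, by its end point. -/
theorem mk_eq_mk_cayleyPath (γ : basedPaths (SpGroup n)) (h : ∀ t, CayleyAdmissible (γ.1 t).1) :
    PathCover.mk γ = PathCover.mk (cayleyPath (γ.1 1) (h 1)) := by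
  rw [← mul_inv_eq_one]
  change PathCover.mk (γ * (cayleyPath (γ.1 1) (h 1))⁻¹) = PathCover.mk 1
  rw [PathCover.mk_eq_mk]
  have h0 : γ.1 0 = 1 := γ.2
  have hc : Continuous fun p : I × I => cayley (γ.1 p.2).1 p.1 :=
    continuous_cayley (by fun_prop) continuous_fst fun p => h p.2
  let A : C(I × I, SpGroup n) :=
    ⟨fun p => ⟨cayley (γ.1 p.2).1 p.1, cayley_mem (γ.1 p.2).2 (h p.2) p.1⟩, hc.subtype_mk _⟩
  have hA0 : ∀ t, A (0, t) = 1 := fun t => Subtype.ext (cayley_zero (h t))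
  have hA1 : ∀ t, A (1, t) = γ.1 t := fun t => Subtype.ext (cayley_one_right _)
  have hA2 : ∀ s, A (s, 0) = 1 := fun s => Subtype.ext (by
    change cayley (γ.1 0).1 s = 1
    rw [h0]
    exact cayley_one_left)
  -- contract `γ` and correct the end points by the contraction of the last of them
  refine ContinuousMap.HomotopicRel.symm ⟨{
    toFun := fun p => A (p.1, p.2) * (A (p.1 * p.2, 1))⁻¹
    continuous_toFun := by fun_prop
    map_zero_left := fun t => by
      simp only [zero_mul, hA0, inv_one, mul_one]
      rfl
    map_one_left := fun t => by
      simp only [one_mul, hA1]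
      rfl
    prop' := ?_ }⟩
  rintro s t (rfl | rfl)
  · simp [hA0, hA2]
  · simp

theorem mk_eq_one_of_loop (γ : basedPaths (SpGroup n)) (h : ∀ t, CayleyAdmissible (γ.1 t).1)
    (h1 : γ.1 1 = 1) : PathCover.mk γ = 1 := by
  rw [mk_eq_mk_cayleyPath γ h]
  change _ = PathCover.mk 1
  congr 1
  apply Subtype.ext
  ext t : 1
  apply Subtype.ext
  change cayley (γ.1 1).1 t = 1
  rw [h1]
  exact cayley_one_left

/-- The class of a loop in a continuous family of loops is locally constant. -/
theorem isLocallyConstant_mk_loop {T : Type*} [TopologicalSpace T]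
    (Z : T → basedPaths (SpGroup n)) (hZ : Continuous fun p : T × I => (Z p.1).1 p.2)
    (h1 : ∀ x, (Z x).1 1 = 1) : IsLocallyConstant fun x => PathCover.mk (Z x) := by
  rw [IsLocallyConstant.iff_eventually_eq]
  intro x
  have hc : Continuous fun p : T × (I × I) =>
      ((1 - (p.2.1 : ℝ)) • ((Z p.1).1 p.2.2 * ((Z x).1 p.2.2)⁻¹ : SpGroup n).1
        + (1 + (p.2.1 : ℝ)) • (1 : Matrix (Fin n ⊕ Fin n) (Fin n ⊕ Fin n) ℝ)).det := by
    have e1 : Continuous fun p : T × (I × I) => (Z p.1).1 p.2.2 :=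
      hZ.comp (continuous_fst.prodMk (continuous_snd.comp continuous_snd))
    have e2 : Continuous fun p : T × (I × I) => ((Z x).1 p.2.2)⁻¹ := by fun_prop
    have e3 := continuous_subtype_val.comp (e1.mul e2)
    have e4 : Continuous fun p : T × (I × I) => (p.2.1 : ℝ) := by fun_prop
    exact Continuous.matrix_det (((continuous_const.sub e4).smul e3).add
      ((continuous_const.add e4).smul continuous_const))
  have h2 : ∀ᶠ y in 𝓝 x, ∀ q ∈ (univ : Set (I × I)),
      ((1 - (q.1 : ℝ)) • ((Z y).1 q.2 * ((Z x).1 q.2)⁻¹ : SpGroup n).1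
        + (1 + (q.1 : ℝ)) • (1 : Matrix (Fin n ⊕ Fin n) (Fin n ⊕ Fin n) ℝ)).det ≠ 0 := by
    refine isCompact_univ.eventually_forall_of_forall_eventually
      (P := fun y (q : I × I) => ((1 - (q.1 : ℝ)) • ((Z y).1 q.2 * ((Z x).1 q.2)⁻¹ : SpGroup n).1
        + (1 + (q.1 : ℝ)) • (1 : Matrix (Fin n ⊕ Fin n) (Fin n ⊕ Fin n) ℝ)).det ≠ 0)
      fun q _ => hc.continuousAt.eventually_ne ?_
    rw [mul_inv_cancel]
    exact PosSemidef.cayleyAdmissible PosSemidef.one q.1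
  filter_upwards [h2] with y hy
  rw [← mul_inv_eq_one]
  refine mk_eq_one_of_loop (Z y * (Z x)⁻¹) (fun t s => hy (s, t) trivial) ?_
  change (Z y).1 1 * ((Z x).1 1)⁻¹ = 1
  rw [h1, h1, inv_one, mul_one]

end Cayley

/-! ### A normal form in the universal cover -/

section NormalForm

open Matrix

variable {n : ℕ}

theorem isClosed_posSemidef {m : Type*} [Fintype m] :
    IsClosed {M : Matrix m m ℝ | M.PosSemidef} := by
  have h : {M : Matrix m m ℝ | M.PosSemidef}
      = {M | Mᴴ = M} ∩ ⋂ x : m → ℝ, {M | 0 ≤ star x ⬝ᵥ M *ᵥ x} := by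
    ext M
    simp only [mem_ofPred_eq, posSemidef_iff_dotProduct_mulVec, mem_inter_iff, mem_iInter]
    rfl
  rw [h]
  refine IsClosed.inter (isClosed_eq (by fun_prop) continuous_id) (isClosed_iInter fun x => ?_)
  exact isClosed_le continuous_const (by fun_prop)

/-- A path slowed down so that it stops at time `s`. -/
def restrictPath {G : Type*} [TopologicalSpace G] [Group G] [IsTopologicalGroup G]
    (γ : basedPaths G) (s : I) : basedPaths G :=
  ⟨⟨fun t => γ.1 (s * t), by fun_prop⟩, by
    have : γ.1 0 = 1 := γ.2
    change γ.1 (s * 0) = 1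
    rw [mul_zero, this]⟩

/-- The triples `(s, V, θ)` for which `V diag(exp(iθ)) Vᴴ` is the unitary factor of the polar
decomposition of `γ s`. The angles vary in the closed interval `[0, 2π]`, which makes the set
compact. -/
def polarAngles (γ : basedPaths (SpGroup n)) : Set (I × Matrix (Fin n) (Fin n) ℂ × (Fin n → ℝ)) :=
  {p | (p.2.1 ∈ unitaryGroup (Fin n) ℂ ∧ ∀ j, p.2.2 j ∈ Icc 0 (2 * Real.pi)) ∧
    ((realify (unitaryFlow p.2.1 p.2.2 1))ᵀ * (γ.1 p.1).1).PosSemidef}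

theorem isCompact_polarAngles (γ : basedPaths (SpGroup n)) : IsCompact (polarAngles γ) := by
  have h1 : IsCompact ((univ : Set I) ×ˢ ((unitaryGroup (Fin n) ℂ : Set (Matrix (Fin n) (Fin n) ℂ)) ×ˢ
      (univ.pi fun _ : Fin n => Icc 0 (2 * Real.pi)))) :=
    isCompact_univ.prod (isCompact_unitaryGroup.prod (isCompact_univ_pi fun _ => isCompact_Icc))
  have h2 : IsClosed {p : I × Matrix (Fin n) (Fin n) ℂ × (Fin n → ℝ) |
      ((realify (unitaryFlow p.2.1 p.2.2 1))ᵀ * (γ.1 p.1).1).PosSemidef} := by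
    refine isClosed_posSemidef.preimage ?_
    have e1 : Continuous fun p : I × Matrix (Fin n) (Fin n) ℂ × (Fin n → ℝ) =>
        realify (unitaryFlow p.2.1 p.2.2 1) :=
      continuous_realify.comp (continuous_unitaryFlow (by fun_prop) (by fun_prop) continuous_const)
    have e2 : Continuous fun p : I × Matrix (Fin n) (Fin n) ℂ × (Fin n → ℝ) => (γ.1 p.1).1 :=
      continuous_subtype_val.comp (γ.1.continuous.comp continuous_fst)
    exact e1.matrix_transpose.matrix_mul e2
  convert h1.inter_right h2 using 1
  ext p
  simp only [polarAngles, mem_prod, mem_inter_iff, mem_univ_pi, mem_univ, true_and,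
    SetLike.mem_coe, mem_ofPred_eq]

namespace polarAngles

variable {γ : basedPaths (SpGroup n)}

/-- The unitary matrix of eigenvectors. -/
def eigenbasis (x : polarAngles γ) : unitaryGroup (Fin n) ℂ := ⟨x.1.2.1, x.2.1.1⟩

/-- The positive factor of the polar decomposition. -/
def posPart (x : polarAngles γ) : SpGroup n :=
  ⟨(realify (unitaryFlow x.1.2.1 x.1.2.2 1))ᵀ * (γ.1 x.1.1).1,
    mul_mem (SymplecticGroup.transpose_mem (realify_mem_symplecticGroup
      (unitaryFlow_mem x.2.1.1 _ _))) (γ.1 x.1.1).2⟩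

theorem realify_mul_posPart (x : polarAngles γ) :
    realify (unitaryFlow x.1.2.1 x.1.2.2 1) * (posPart x).1 = (γ.1 x.1.1).1 := by
  have h1 := mul_eq_one_comm.1 (realify_transpose_mul_self (unitaryFlow_mem x.2.1.1 x.1.2.2 1))
  change _ * (_ * _) = _
  rw [← Matrix.mul_assoc, h1, Matrix.one_mul]

theorem posDef_posPart (x : polarAngles γ) : (posPart x).1.PosDef := by
  refine (PosSemidef.posDef_iff_isUnit (x := (posPart x).1) x.2.2).2 ?_
  exact (Matrix.isUnit_iff_isUnit_det _).2 (SymplecticGroup.symplectic_det (posPart x).2)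

theorem cayleyAdmissible_posPart (x : polarAngles γ) : CayleyAdmissible (posPart x).1 :=
  PosSemidef.cayleyAdmissible (posDef_posPart x).posSemidef

/-- The loop that compares the path `γ` up to time `s` with the path `V diag(exp(itθ)) Vᴴ`,
corrected by the positive factor. -/
def loop (x : polarAngles γ) : basedPaths (SpGroup n) :=
  (restrictPath γ x.1.1)⁻¹ * (unitaryPath (eigenbasis x) x.1.2.2 *
    cayleyPath (posPart x) (cayleyAdmissible_posPart x))

theorem unitaryPath_mul_posPart (x : polarAngles γ) :
    (unitaryPath (eigenbasis x) x.1.2.2).1 1 * posPart x = γ.1 x.1.1 := by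
  apply Subtype.ext
  change realify (unitaryFlow x.1.2.1 x.1.2.2 ((1 : I) : ℝ)) * (posPart x).1 = (γ.1 x.1.1).1
  rw [Icc.coe_one, realify_mul_posPart]

theorem loop_apply_one (x : polarAngles γ) : (loop x).1 1 = 1 := by
  change (γ.1 (x.1.1 * 1))⁻¹ * ((unitaryPath (eigenbasis x) x.1.2.2).1 1 *
    (cayleyPath (posPart x) (cayleyAdmissible_posPart x)).1 1) = 1
  rw [cayleyPath_apply_one, unitaryPath_mul_posPart, mul_one, inv_mul_cancel]

theorem continuous_loop : Continuous fun p : polarAngles γ × I => (loop p.1).1 p.2 := by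
  have e0 : Continuous fun p : polarAngles γ × I => (p.1.1 : I × Matrix (Fin n) (Fin n) ℂ × (Fin n → ℝ)) :=
    continuous_subtype_val.comp continuous_fst
  have e1 : Continuous fun p : polarAngles γ × I => (γ.1 (p.1.1.1 * p.2))⁻¹ :=
    (γ.1.continuous.comp ((continuous_fst.comp e0).mul continuous_snd)).inv
  have e2 : Continuous fun p : polarAngles γ × I =>
      (unitaryPath (eigenbasis p.1) p.1.1.2.2).1 p.2 :=
    Continuous.subtype_mk (continuous_realify.comp (continuous_unitaryFlow
      (continuous_fst.comp (continuous_snd.comp e0)) (continuous_snd.comp (continuous_snd.comp e0))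
      (continuous_subtype_val.comp continuous_snd))) _
  have e3 : Continuous fun p : polarAngles γ × I => (posPart p.1).1 := by
    have f1 : Continuous fun p : polarAngles γ × I => realify (unitaryFlow p.1.1.2.1 p.1.1.2.2 1) :=
      continuous_realify.comp (continuous_unitaryFlow (continuous_fst.comp (continuous_snd.comp e0))
        (continuous_snd.comp (continuous_snd.comp e0)) continuous_const)
    exact f1.matrix_transpose.matrix_mul
      (continuous_subtype_val.comp (γ.1.continuous.comp (continuous_fst.comp e0)))
  have e4 : Continuous fun p : polarAngles γ × I =>
      (cayleyPath (posPart p.1) (cayleyAdmissible_posPart p.1)).1 p.2 :=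
    Continuous.subtype_mk (continuous_cayley e3 continuous_snd fun p =>
      cayleyAdmissible_posPart p.1) _
  exact e1.mul (e2.mul e4)

theorem exists_fst_eq (s : I) : ∃ x : polarAngles γ, x.1.1 = s := by
  obtain ⟨u, P, hu, hP, hX⟩ := exists_polar (γ.1 s).2
  obtain ⟨V, hV, θ, hθ, huV⟩ := exists_unitary_diagonalization hu
  have h1 : unitaryFlow V θ 1 = u := by rw [huV, unitaryFlow]; simp
  refine ⟨⟨(s, V, θ), ⟨hV, fun j => Ico_subset_Icc_self (hθ j)⟩, ?_⟩, rfl⟩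
  change ((realify (unitaryFlow V θ 1))ᵀ * (γ.1 s).1).PosSemidef
  rw [h1, hX, ← Matrix.mul_assoc, realify_transpose_mul_self hu, Matrix.one_mul]
  exact hP.posSemidef

theorem unique {x y : polarAngles γ} (h : x.1.1 = y.1.1) :
    unitaryFlow x.1.2.1 x.1.2.2 1 = unitaryFlow y.1.2.1 y.1.2.2 1 ∧ posPart x = posPart y := by
  have h1 := polar_unique (unitaryFlow_mem x.2.1.1 x.1.2.2 1) (unitaryFlow_mem y.2.1.1 y.1.2.2 1)
    (posDef_posPart x) (posDef_posPart y) (by rw [realify_mul_posPart, realify_mul_posPart, h])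
  exact ⟨h1.1, Subtype.ext h1.2⟩

/-- The total angle of the unitary factor agrees with the continuous argument of `psi` modulo full
turns. -/
theorem exists_int {δ : C(I, ℝ)} (hδ : IsArgLift (fun t => psi (γ.1 t).1) δ) (x : polarAngles γ) :
    ∃ k : ℤ, δ x.1.1 - δ 0 - (∑ j, x.1.2.2 j) / (2 * Real.pi) = k := by
  have key : ∀ (s : I) (V : Matrix (Fin n) (Fin n) ℂ) (θ : Fin n → ℝ)
      (P : Matrix (Fin n ⊕ Fin n) (Fin n ⊕ Fin n) ℝ), V ∈ unitaryGroup (Fin n) ℂ → P.PosDef →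
      realify (unitaryFlow V θ 1) * P = (γ.1 s).1 →
      ∃ k : ℤ, δ s = (∑ j, θ j) / (2 * Real.pi) + k := by
    intro s V θ P hV hP hX
    have h1 := (psi_realify_mul (unitaryFlow_mem hV θ 1) hP).2
    rw [hX, det_unitaryFlow hV] at h1
    have h2 := hδ s
    simp only [] at h2
    have h3 : (‖psi (γ.1 s).1‖ : ℂ) ≠ 0 := by simpa using psi_path_ne_zero γ s
    have h4 := mul_left_cancel₀ h3 (h2.symm.trans h1)
    rw [← exp_two_pi_eq_iff, h4]
    congr 1
    have : (Real.pi : ℂ) ≠ 0 := by exact_mod_cast Real.pi_ne_zero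
    push_cast
    field_simp
  obtain ⟨k, hk⟩ := key _ _ _ _ x.2.1.1 (posDef_posPart x) (realify_mul_posPart x)
  obtain ⟨l, hl⟩ := key 0 1 0 1 (one_mem _) PosDef.one (by
    rw [unitaryFlow_zero (one_mem _), realify_one, Matrix.mul_one, show γ.1 0 = 1 from γ.2]
    rfl)
  refine ⟨k - l, ?_⟩
  rw [hk, hl]
  push_cast
  simp
  ring

end polarAngles

open polarAngles in
/-- The normal form of the elements of the universal cover: a power of the rotation loop, times a
one-parameter group of unitary matrices with angles in `[0, 2π]`, times a positive definite
element. The power is read off from the Maslov number. This rests on the fact that the corrected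
class of `loop x`, which is locally constant on the compact set `polarAngles γ`, only depends on
the time. -/
theorem exists_normalForm (i : Fin n) (x : SpCover n) :
    ∃ (k : ℤ) (V : unitaryGroup (Fin n) ℂ) (θ : Fin n → ℝ) (P : SpGroup n) (hP : P.1.PosDef),
      (∀ j, θ j ∈ Icc 0 (2 * Real.pi)) ∧
      maslov x = k + (∑ j, θ j) / (2 * Real.pi) ∧
      x = rotationLoop i ^ k * (PathCover.mk (unitaryPath V θ) *
        PathCover.mk (cayleyPath P (PosSemidef.cayleyAdmissible hP.posSemidef))) := by
  obtain ⟨γ, rfl⟩ := PathCover.exists_mk x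
  obtain ⟨δ, hδ⟩ := exists_isArgLift (continuous_psi_path γ) (psi_path_ne_zero γ)
  have hpi := Real.pi_pos
  set deg : polarAngles γ → ℤ := fun y =>
    round (δ y.1.1 - δ 0 - (∑ j, y.1.2.2 j) / (2 * Real.pi)) with hdeg
  have hdeg' : ∀ y, (deg y : ℝ) = δ y.1.1 - δ 0 - (∑ j, y.1.2.2 j) / (2 * Real.pi) := by
    intro y
    obtain ⟨k, hk⟩ := exists_int hδ y
    rw [hdeg]
    simp [hk]
  have hdegc : IsLocallyConstant deg := isLocallyConstant_round (by fun_prop) (exists_int hδ)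
  set Φ : polarAngles γ → SpCover n := fun y => rotationLoop i ^ deg y * PathCover.mk (loop y)
  have hΦc : IsLocallyConstant Φ :=
    (hdegc.comp fun k => rotationLoop i ^ k).mul (isLocallyConstant_mk_loop loop continuous_loop
      loop_apply_one)
  have hΦe : ∀ y, Φ y = (PathCover.mk (restrictPath γ y.1.1))⁻¹ *
      (rotationLoop i ^ deg y * PathCover.mk (unitaryPath (eigenbasis y) y.1.2.2) *
        PathCover.mk (cayleyPath (posPart y) (cayleyAdmissible_posPart y))) := by
    intro y
    have hc := ((commute_rotationLoop i (PathCover.mk (restrictPath γ y.1.1))⁻¹).zpow_right (deg y)).eq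
    change rotationLoop i ^ deg y * ((PathCover.mk (restrictPath γ y.1.1))⁻¹ *
      (PathCover.mk (unitaryPath (eigenbasis y) y.1.2.2) *
        PathCover.mk (cayleyPath (posPart y) (cayleyAdmissible_posPart y)))) = _
    rw [← mul_assoc, ← hc]
    simp only [mul_assoc]
  have hΦu : ∀ y z : polarAngles γ, y.1.1 = z.1.1 → Φ y = Φ z := by
    intro y z h
    obtain ⟨h1, h2⟩ := unique h
    have h3 := rotationLoop_zpow_mul_mk_unitaryPath (V := eigenbasis y) (W := eigenbasis z) i
      y.2.1.2 z.2.1.2 h1 (k := deg y) (l := deg z) (by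
        rw [hdeg', hdeg', h]
        field_simp
        ring)
    have h4 : cayleyPath (posPart y) (cayleyAdmissible_posPart y)
        = cayleyPath (posPart z) (cayleyAdmissible_posPart z) := by
      congr 1
    rw [hΦe, hΦe, h3, h, h4]
  choose sec hsec using fun s : I => exists_fst_eq (γ := γ) s
  have hfac : Φ = (fun s => Φ (sec s)) ∘ fun y : polarAngles γ => y.1.1 := by
    ext y
    exact hΦu _ _ (hsec _).symm
  have hcomp : CompactSpace (polarAngles γ) :=
    isCompact_iff_compactSpace.1 (isCompact_polarAngles γ)
  have hfst : Continuous fun y : polarAngles γ => y.1.1 :=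
    continuous_fst.comp continuous_subtype_val
  have hq : IsQuotientMap fun y : polarAngles γ => y.1.1 :=
    hfst.isClosedMap.isQuotientMap hfst fun s => ⟨sec s, hsec s⟩
  have hloc : IsLocallyConstant fun s => Φ (sec s) := by
    intro A
    rw [← hq.isOpen_preimage, ← preimage_comp, ← hfac]
    exact hΦc A
  have h0 : Φ (sec 0) = 1 := by
    have hγ0 : γ.1 0 = 1 := γ.2
    have hmem : ((0 : I), (1 : Matrix (Fin n) (Fin n) ℂ), (0 : Fin n → ℝ)) ∈ polarAngles γ := by
      refine ⟨⟨one_mem _, fun j => ⟨le_rfl, by positivity⟩⟩, ?_⟩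
      rw [unitaryFlow_zero (one_mem _), realify_one, hγ0, transpose_one, Matrix.one_mul]
      exact PosSemidef.one
    set y : polarAngles γ := ⟨_, hmem⟩ with hy
    have hd : deg y = 0 := by
      have := hdeg' y
      simp only [hy, sub_self, Pi.zero_apply, Finset.sum_const_zero, zero_div] at this
      exact_mod_cast this
    have hl : loop y = 1 := by
      apply Subtype.ext
      ext t : 1
      change (γ.1 (0 * t))⁻¹ * ((unitaryPath (eigenbasis y) 0).1 t *
        (cayleyPath (posPart y) (cayleyAdmissible_posPart y)).1 t) = 1
      rw [zero_mul, hγ0, unitaryPath_zero]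
      have hp : (posPart y).1 = 1 := by
        change (realify (unitaryFlow 1 0 1))ᵀ * (γ.1 0).1 = 1
        rw [unitaryFlow_zero (one_mem _), realify_one, hγ0, transpose_one, Matrix.one_mul]
        rfl
      have hq : (cayleyPath (posPart y) (cayleyAdmissible_posPart y)).1 t = 1 := by
        apply Subtype.ext
        change cayley (posPart y).1 t = 1
        rw [hp]
        exact cayley_one_left
      rw [hq, inv_one, one_mul, mul_one]
      rfl
    rw [hΦu (sec 0) y (hsec 0)]
    change rotationLoop i ^ deg y * PathCover.mk (loop y) = 1
    rw [hd, hl, zpow_zero, one_mul]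
    rfl
  have h1 : Φ (sec 1) = 1 := (hloc.apply_eq_of_preconnectedSpace 1 0).trans h0
  refine ⟨deg (sec 1), eigenbasis (sec 1), (sec 1).1.2.2, posPart (sec 1), posDef_posPart (sec 1),
    (sec 1).2.1.2, ?_, ?_⟩
  · rw [maslov_mk hδ, hdeg', hsec 1]
    ring
  · rw [hΦe, inv_mul_eq_one, hsec 1, mul_assoc] at h1
    rw [← h1]
    congr 1
    apply Subtype.ext
    ext t : 1
    change γ.1 t = γ.1 (1 * t)
    rw [one_mul]

end NormalForm

/-! ### Homogenization of quasimorphisms -/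

section Homogenization

variable {G : Type*} [Group G] {r : G → ℝ} {R : ℝ}

/-- Fekete's lemma gives the limit that defines the homogenization of a quasimorphism. -/
theorem tendsto_homogenization (hR : ∀ f g, |r (f * g) - r f - r g| ≤ R) (x : G) :
    Tendsto (fun k : ℕ => r (x ^ k) / k) atTop (𝓝 (homogenization r x)) := by
  refine tendsto_nhds_limUnder ?_
  -- adding the defect makes the sequence subadditive
  have hs : Subadditive fun k : ℕ => r (x ^ k) + R := by
    intro m k
    have := (abs_le.1 (hR (x ^ m) (x ^ k))).2
    simp only [pow_add]
    linarith
  have hlow : ∀ k : ℕ, k * (r x - R) ≤ r (x ^ k) + R := by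
    intro k
    induction k with
    | zero =>
      have := (abs_le.1 (hR 1 1)).2
      rw [mul_one] at this
      simp
      linarith
    | succ k ih =>
      have := (abs_le.1 (hR (x ^ k) x)).1
      rw [pow_succ]
      push_cast
      linarith
  have hb : BddBelow (range fun k : ℕ => (r (x ^ k) + R) / k) := by
    refine ⟨min 0 (r x - R), ?_⟩
    rintro _ ⟨k, rfl⟩
    rcases Nat.eq_zero_or_pos k with rfl | hk
    · simp
    · refine (min_le_right _ _).trans ?_
      rw [le_div_iff₀ (by exact_mod_cast hk), mul_comm]
      exact hlow k
  have h1 := (hs.tendsto_lim hb).sub (tendsto_const_div_atTop_nhds_zero_nat R)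
  rw [sub_zero] at h1
  refine ⟨hs.lim, h1.congr fun k => ?_⟩
  ring

theorem homogenization_pow (hR : ∀ f g, |r (f * g) - r f - r g| ≤ R) (x : G) (m : ℕ) :
    homogenization r (x ^ m) = m * homogenization r x := by
  rcases Nat.eq_zero_or_pos m with rfl | hm
  · refine tendsto_nhds_unique (tendsto_homogenization hR _) ?_
    simpa using tendsto_const_div_atTop_nhds_zero_nat (r 1)
  · refine tendsto_nhds_unique (tendsto_homogenization hR _) ?_
    have h1 := ((tendsto_homogenization hR x).comp (tendsto_id.const_mul_atTop' hm)).const_mul (m : ℝ)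
    refine h1.congr fun k => ?_
    have : (m : ℝ) ≠ 0 := by exact_mod_cast hm.ne'
    simp only [Function.comp_apply, id_eq]
    rw [pow_mul]
    push_cast
    rw [← mul_div_assoc, mul_div_mul_left _ _ this]

/-- A quasimorphism is at bounded distance from its homogenization. -/
theorem abs_homogenization_sub_le (hR : ∀ f g, |r (f * g) - r f - r g| ≤ R) (h1 : r 1 = 0) (x : G) :
    |r x - homogenization r x| ≤ R := by
  have hk : ∀ k : ℕ, |r (x ^ k) - k * r x| ≤ k * R := by
    intro k
    induction k with
    | zero => simp [h1]
    | succ k ih =>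
      have h2 := abs_add_le (r (x ^ k * x) - r (x ^ k) - r x) (r (x ^ k) - k * r x)
      have h3 := hR (x ^ k) x
      rw [pow_succ]
      push_cast
      rw [show r (x ^ k * x) - (k + 1) * r x
        = r (x ^ k * x) - r (x ^ k) - r x + (r (x ^ k) - k * r x) by ring]
      linarith
  refine le_of_tendsto ((tendsto_const_nhds (x := r x)).sub (tendsto_homogenization hR x)).abs ?_
  filter_upwards [eventually_gt_atTop 0] with k hk0
  have h2 : (0 : ℝ) < k := by exact_mod_cast hk0
  rw [abs_sub_comm, show r (x ^ k) / k - r x = (r (x ^ k) - k * r x) / k by field_simp, abs_div,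
    abs_of_pos h2, div_le_iff₀ h2, mul_comm R]
  exact hk k

end Homogenization

/-! ### Relative growth and quasimorphisms -/

section Growth

variable {G : Type*} [Group G] {C : Set G} {r : G → ℝ} {R A : ℝ}

/-- If the cone is squeezed between two superlevel sets of a quasimorphism, the relative growth of
two dominants is the quotient of the values of the homogenization. -/
theorem relGrowth_eq_div (hC : IsOrderCone C) (hR : ∀ f g, |r (f * g) - r f - r g| ≤ R)
    (h1 : r 1 = 0) (hpos : ∀ x ∈ C, 0 ≤ r x) (hbig : ∀ x, A ≤ r x → x ∈ C) {f g : G}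
    (hf : f ∈ dominants C) (hg : g ∈ dominants C) (hf0 : 0 < homogenization r f) :
    relGrowth C f g = homogenization r g / homogenization r f := by
  have hfp : ∀ (x : G) (p : ℕ), |r (x ^ p) - p * homogenization r x| ≤ R := fun x p => by
    rw [← homogenization_pow hR]
    exact abs_homogenization_sub_le hR h1 _
  have hlim := hC.tendsto_relGrowth hf hg
  apply le_antisymm
  · set B := 3 * R + A with hB
    have h2 : ∀ k : ℕ, 0 < k → relGrowth C f g
        ≤ homogenization r g / homogenization r f
          + (|B| / homogenization r f + 1) / k := by
      intro k hk
      have hk' : (0 : ℝ) < k := by exact_mod_cast hk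
      set p := ⌈(k * homogenization r g + |B|) / homogenization r f⌉₊ with hp
      have hp1 : k * homogenization r g + |B| ≤ p * homogenization r f := by
        rw [← div_le_iff₀ hf0]; exact Nat.le_ceil _
      have hg0 : 0 ≤ homogenization r g := ge_of_tendsto' (tendsto_homogenization hR g) fun k =>
        div_nonneg (hpos _ (hC.pow_mem hg.1 k)) (Nat.cast_nonneg k)
      have hp2 : (p : ℝ) < (k * homogenization r g + |B|) / homogenization r f + 1 :=
        Nat.ceil_lt_add_one (by positivity)
      have hmem : ConeGE C (f ^ (p : ℤ)) (g ^ k) := by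
        refine hbig _ ?_
        have e1 := (abs_le.1 (hR (f ^ p * (g ^ k)⁻¹) (g ^ k))).2
        rw [inv_mul_cancel_right] at e1
        have e2 := (abs_le.1 (hfp f p)).1
        have e3 := (abs_le.1 (hfp g k)).2
        rw [zpow_natCast]
        linarith [le_abs_self B]
      refine (hC.relGrowth_le hf hg hk.ne' hmem).trans ?_
      rw [Int.cast_natCast, div_le_iff₀ hk']
      refine hp2.le.trans (le_of_eq ?_)
      field_simp
      ring
    have h3 := (tendsto_const_nhds (x := homogenization r g / homogenization r f)).add
      (tendsto_const_div_atTop_nhds_zero_nat (|B| / homogenization r f + 1))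
    rw [add_zero] at h3
    exact ge_of_tendsto h3 ((eventually_gt_atTop 0).mono h2)
  · rw [div_le_iff₀ hf0]
    have h2 : ∀ k : ℕ, 0 < k → homogenization r g
        ≤ (growthInf C f g k : ℝ) / k * homogenization r f + 3 * R / k := by
      intro k hk
      have hk' : (0 : ℝ) < k := by exact_mod_cast hk
      have hm := hC.growthInf_mem hf hg k
      obtain ⟨p, hp⟩ := Int.eq_ofNat_of_zero_le (hC.growthInf_nonneg hf hg k)
      rw [hp] at hm ⊢
      have e0 := hpos _ hm
      rw [zpow_natCast] at e0
      have e1 := (abs_le.1 (hR (f ^ p * (g ^ k)⁻¹) (g ^ k))).1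
      rw [inv_mul_cancel_right] at e1
      have e2 := (abs_le.1 (hfp f p)).2
      have e3 := (abs_le.1 (hfp g k)).1
      rw [Int.cast_natCast, div_mul_eq_mul_div, ← add_div, le_div_iff₀ hk']
      linarith
    have h3 := (hlim.mul_const (homogenization r f)).add
      (tendsto_const_div_atTop_nhds_zero_nat (3 * R))
    rw [add_zero] at h3
    exact ge_of_tendsto h3 ((eventually_gt_atTop 0).mono h2)

/-- A dominant has positive homogenization if the quasimorphism is unbounded above. -/
theorem homogenization_pos (hR : ∀ f g, |r (f * g) - r f - r g| ≤ R)
    (h1 : r 1 = 0) (hpos : ∀ x ∈ C, 0 ≤ r x) (hunb : ∀ B : ℝ, ∃ x, B < r x) {f : G}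
    (hf : f ∈ dominants C) : 0 < homogenization r f := by
  obtain ⟨g, hg⟩ := hunb (2 * R)
  obtain ⟨p, hp⟩ := hf.2.2 g
  have e1 := (abs_le.1 (hR (f ^ p * g⁻¹) g)).1
  rw [inv_mul_cancel_right] at e1
  have e2 := (abs_le.1 (abs_homogenization_sub_le hR h1 (f ^ p))).2
  rw [homogenization_pow hR] at e2
  have e3 := hpos _ hp
  have e4 : 0 < p * homogenization r f := by linarith
  exact pos_of_mul_pos_right e4 (Nat.cast_nonneg p)

theorem growthDist_eq (hC : IsOrderCone C) (hR : ∀ f g, |r (f * g) - r f - r g| ≤ R)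
    (h1 : r 1 = 0) (hpos : ∀ x ∈ C, 0 ≤ r x) (hbig : ∀ x, A ≤ r x → x ∈ C) {f g : G}
    (hf : f ∈ dominants C) (hg : g ∈ dominants C) (hf0 : 0 < homogenization r f)
    (hg0 : 0 < homogenization r g) :
    growthDist C f g = |Real.log (homogenization r f) - Real.log (homogenization r g)| := by
  rw [growthDist, relGrowth_eq_div hC hR h1 hpos hbig hf hg hf0,
    relGrowth_eq_div hC hR h1 hpos hbig hg hf hg0, Real.log_div hg0.ne' hf0.ne',
    Real.log_div hf0.ne' hg0.ne', abs_eq_max_neg, neg_sub, max_comm]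

end Growth

/-! ### Domination by the Maslov number and the isometry -/

section Domination

open Matrix

variable {n : ℕ}

/-- The class of a scalar rotation by the angle `a`. -/
def scalarRotation (n : ℕ) (a : ℝ) : SpCover n := PathCover.mk (unitaryPath 1 fun _ => a)

theorem scalarRotation_add (a b : ℝ) :
    scalarRotation n (a + b) = scalarRotation n a * scalarRotation n b :=
  mk_unitaryPath_add 1 (fun _ => a) (fun _ => b)

theorem scalarRotation_zero : scalarRotation n 0 = 1 := by
  change PathCover.mk (unitaryPath 1 0) = 1
  rw [unitaryPath_zero]
  rfl

theorem scalarRotation_pow (a : ℝ) (k : ℕ) : scalarRotation n a ^ k = scalarRotation n (k * a) := by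
  induction k with
  | zero => simp [scalarRotation_zero]
  | succ k ih => rw [pow_succ, ih, ← scalarRotation_add]; congr 1; push_cast; ring

theorem scalarRotation_mem {a : ℝ} (ha : 0 ≤ a) : scalarRotation n a ∈ nonnegCone n :=
  mk_unitaryPath_mem_nonnegCone 1 fun _ => ha

theorem scalarRotation_two_pi (i : Fin n) :
    scalarRotation n (2 * Real.pi) = rotationLoop i ^ n := by
  have h := mk_unitaryPath_sum_single 1 i Finset.univ
  rw [Finset.card_univ, Fintype.card_fin] at h
  rw [← h, scalarRotation]
  congr 2
  ext j
  rw [Finset.sum_apply, Finset.sum_pi_single]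
  simp

theorem maslov_scalarRotation (a : ℝ) : maslov (scalarRotation n a) = n * a / (2 * Real.pi) := by
  have h : IsArgLift (fun t => psi ((unitaryPath (1 : unitaryGroup (Fin n) ℂ) fun _ => a).1 t).1)
      ⟨fun t => (t : ℝ) * (n * a / (2 * Real.pi)), by fun_prop⟩ := by
    intro t
    have h1 : psi ((unitaryPath (1 : unitaryGroup (Fin n) ℂ) fun _ => a).1 t).1
        = (unitaryFlow (1 : Matrix (Fin n) (Fin n) ℂ) (fun _ => a) t).det := by
      change psi (realify _) = _
      rw [psi, complexPart_realify]
      rfl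
    simp only [h1]
    rw [norm_det_of_mem_unitaryGroup (unitaryFlow_mem (one_mem _) _ _),
      det_unitaryFlow (one_mem _), Complex.ofReal_one, one_mul]
    congr 1
    have : (Real.pi : ℂ) ≠ 0 := by exact_mod_cast Real.pi_ne_zero
    simp only [Finset.sum_const, Finset.card_univ, Fintype.card_fin, nsmul_eq_mul,
      ContinuousMap.coe_mk]
    push_cast
    field_simp
  rw [scalarRotation, maslov_mk h]
  simp

theorem cayley_transpose {M : Matrix (Fin n ⊕ Fin n) (Fin n ⊕ Fin n) ℝ} (hs : Mᵀ = M)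
    (hM : CayleyAdmissible M) (t : I) : (cayley M t)ᵀ = cayley M t := by
  conv_rhs => rw [cayley_eq_inv_mul hM]
  rw [cayley, transpose_mul, transpose_nonsing_inv]
  simp [hs]

/-- A full rotation absorbs every positive definite element. With `P = Q²` and `r` the rotation by
a quarter turn one has `r q r⁻¹ = q⁻¹` for the class `q` of the path to `Q`, so that the class of
the path to `P` is the commutator `r q⁻¹ r⁻¹ q`. -/
theorem scalarRotation_mul_cayleyPath_mem {P : SpGroup n} (hP : P.1.PosDef) :
    scalarRotation n (2 * Real.pi) *
      PathCover.mk (cayleyPath P (PosSemidef.cayleyAdmissible hP.posSemidef)) ∈ nonnegCone n := by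
  obtain ⟨Q, hQ, hQP⟩ := posDef_exists_sqrt hP
  have hQs : Q ∈ symplecticGroup (Fin n) ℝ :=
    posDef_mem_symplecticGroup_of_mul_self hQ (by rw [hQP]; exact P.2)
  have hQt : Qᵀ = Q := by
    simpa [IsHermitian, conjTranspose_eq_transpose_of_trivial] using hQ.isHermitian
  have hQa : CayleyAdmissible Q := PosSemidef.cayleyAdmissible hQ.posSemidef
  set c : basedPaths (SpGroup n) := cayleyPath ⟨Q, hQs⟩ hQa with hc
  set q : SpCover n := PathCover.mk c with hq
  have hct : ∀ t, ((c.1 t).1)ᵀ = (c.1 t).1 := fun t => cayley_transpose hQt hQa t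
  have hp : PathCover.mk (cayleyPath P (PosSemidef.cayleyAdmissible hP.posSemidef)) = q * q := by
    have h1 := mk_eq_mk_cayleyPath (c * c) fun t => by
      refine PosSemidef.cayleyAdmissible ?_
      change ((c.1 t).1 * (c.1 t).1).PosSemidef
      have := posSemidef_self_mul_conjTranspose (c.1 t).1
      rwa [conjTranspose_eq_transpose_of_trivial, hct] at this
    have h2 : (c * c).1 1 = P := by
      apply Subtype.ext
      change (c.1 1).1 * (c.1 1).1 = P.1
      rw [hc, cayleyPath_apply_one]
      exact hQP
    change _ = PathCover.mk (c * c)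
    rw [h1]
    congr 2
    exact h2.symm
  set e : SpCover n := scalarRotation n (Real.pi / 2) with he
  have hconj : e * q * e⁻¹ = q⁻¹ := by
    rw [he, scalarRotation, hq, conj_mk]
    change _ = PathCover.mk c⁻¹
    congr 1
    apply Subtype.ext
    ext t : 1
    change _ * c.1 t * _⁻¹ = (c.1 t)⁻¹
    rw [mul_inv_eq_iff_eq_mul, eq_inv_mul_iff_mul_eq, ← mul_assoc]
    apply Subtype.ext
    have hJ : (((unitaryPath (1 : unitaryGroup (Fin n) ℂ) fun _ => Real.pi / 2).1 1 : SpGroup n).1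
        : Matrix (Fin n ⊕ Fin n) (Fin n ⊕ Fin n) ℝ) = J (Fin n) ℝ := by
      change realify (unitaryFlow 1 (fun _ => Real.pi / 2) ((1 : I) : ℝ)) = _
      rw [J_eq_realify, unitaryFlow, smul_one_eq_diagonal]
      congr 1
      simp [Complex.exp_pi_div_two_mul_I]
    have h1 := SymplecticGroup.mem_iff.1 (c.1 t).2
    rw [hct] at h1
    change (c.1 t).1 * ((unitaryPath (1 : unitaryGroup (Fin n) ℂ) fun _ => Real.pi / 2).1 1).1 *
      (c.1 t).1 = ((unitaryPath (1 : unitaryGroup (Fin n) ℂ) fun _ => Real.pi / 2).1 1).1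
    rw [hJ, h1]
  have hz : scalarRotation n (2 * Real.pi) = e * scalarRotation n (3 * Real.pi / 2) := by
    rw [he, ← scalarRotation_add]; congr 1; ring
  have hcomm : ∀ x : SpCover n, Commute x (scalarRotation n (2 * Real.pi)) := fun x =>
    commute_mk_of_loop (unitaryPath_one_of_int 1 fun _ => ⟨1, by simp⟩) x
  have hq2 : q = e * q⁻¹ * e⁻¹ := by
    rw [← _root_.inv_inj]
    simp only [_root_.mul_inv_rev, inv_inv]
    rw [← mul_assoc]
    exact hconj.symm
  have hpi := Real.pi_pos
  have key : scalarRotation n (2 * Real.pi) * (q * q)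
      = e * (q⁻¹ * scalarRotation n (3 * Real.pi / 2) * q⁻¹⁻¹) := by
    calc scalarRotation n (2 * Real.pi) * (q * q)
        = scalarRotation n (2 * Real.pi) * (e * q⁻¹ * e⁻¹ * q) := by rw [← hq2]
      _ = e * q⁻¹ * e⁻¹ * scalarRotation n (2 * Real.pi) * q := by
          rw [← mul_assoc, (hcomm _).eq]
      _ = _ := by rw [hz]; group
  rw [hp, key]
  exact isNormalCone_nonnegCone.mul_mem _ _ (scalarRotation_mem (by positivity))
    (isNormalCone_nonnegCone.conj_mem _ _ (scalarRotation_mem (by positivity)))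

/-- Elements with large Maslov number are generated by non-negative Hamiltonians. -/
theorem mem_nonnegCone_of_le_maslov (hn : 1 ≤ n) {x : SpCover n} (hx : 2 * (n : ℝ) ≤ maslov x) :
    x ∈ nonnegCone n := by
  set i : Fin n := ⟨0, hn⟩
  obtain ⟨k, V, θ, P, hP, hθ, hm, rfl⟩ := exists_normalForm i x
  have hpi := Real.pi_pos
  have h1 : (∑ j, θ j) / (2 * Real.pi) ≤ n := by
    rw [div_le_iff₀ (by positivity)]
    have := Finset.sum_le_card_nsmul Finset.univ θ (2 * Real.pi) fun j _ => (hθ j).2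
    simpa using this
  have h2 : (n : ℤ) ≤ k := by
    have : (n : ℝ) ≤ k := by rw [hm] at hx; linarith
    exact_mod_cast this
  obtain ⟨m, rfl⟩ := Int.exists_add_of_le h2
  set p := PathCover.mk (cayleyPath P (PosSemidef.cayleyAdmissible hP.posSemidef)) with hp
  have h3 : rotationLoop i ^ ((n : ℤ) + m) * (PathCover.mk (unitaryPath V θ) * p)
      = rotationLoop i ^ m * PathCover.mk (unitaryPath V θ) *
        (scalarRotation n (2 * Real.pi) * p) := by
    have hc := ((commute_rotationLoop i (PathCover.mk (unitaryPath V θ))).pow_right n).eq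
    rw [scalarRotation_two_pi i, add_comm, _root_.zpow_add, zpow_natCast, zpow_natCast, mul_assoc,
      mul_assoc, ← mul_assoc _ _ p, ← hc]
    simp only [mul_assoc]
  rw [h3]
  exact isNormalCone_nonnegCone.mul_mem _ _ (isNormalCone_nonnegCone.mul_mem _ _
    (isNormalCone_nonnegCone.pow_mem (rotationLoop_mem i) m)
    (mk_unitaryPath_mem_nonnegCone V fun j => (hθ j).1)) (scalarRotation_mul_cayleyPath_mem hP)

theorem maslov_scalarRotation_turns (hn : 1 ≤ n) (c : ℝ) :
    maslov (scalarRotation n (2 * Real.pi * c / n)) = c := by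
  have hpi := Real.pi_pos
  have : (n : ℝ) ≠ 0 := by positivity
  rw [maslov_scalarRotation]
  field_simp

theorem homogenization_scalarRotation_turns (hn : 1 ≤ n) (c : ℝ) :
    homogenization maslov (scalarRotation n (2 * Real.pi * c / n)) = c := by
  refine tendsto_nhds_unique (tendsto_homogenization abs_maslov_mul_sub_le _) ?_
  refine tendsto_const_nhds.congr' ?_
  filter_upwards [eventually_ne_atTop 0] with k hk
  have : (k : ℝ) ≠ 0 := by exact_mod_cast hk
  rw [scalarRotation_pow, show (k : ℝ) * (2 * Real.pi * c / n) = 2 * Real.pi * (k * c) / n by ring,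
    maslov_scalarRotation_turns hn]
  field_simp

theorem scalarRotation_mem_dominants (hn : 1 ≤ n) {c : ℝ} (hc : 0 < c) :
    scalarRotation n (2 * Real.pi * c / n) ∈ dominants (nonnegCone n) := by
  have hpi := Real.pi_pos
  refine ⟨scalarRotation_mem (by positivity), fun h => ?_, fun g => ?_⟩
  · have := maslov_scalarRotation_turns hn c
    rw [h, maslov_one] at this
    exact hc.ne this
  · obtain ⟨k, hk⟩ := exists_nat_ge ((2 * n + n / 2 - maslov g⁻¹) / c)
    refine ⟨k, mem_nonnegCone_of_le_maslov hn ?_⟩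
    rw [div_le_iff₀ hc] at hk
    have h1 := (abs_le.1 (abs_maslov_mul_sub_le (scalarRotation n (2 * Real.pi * c / n) ^ k) g⁻¹)).1
    rw [scalarRotation_pow, show (k : ℝ) * (2 * Real.pi * c / n) = 2 * Real.pi * (k * c) / n by ring,
      maslov_scalarRotation_turns hn] at h1
    rw [scalarRotation_pow, show (k : ℝ) * (2 * Real.pi * c / n) = 2 * Real.pi * (k * c) / n by ring]
    linarith

theorem homogenization_maslov_pos (hn : 1 ≤ n) {X : SpCover n} (hX : X ∈ dominants (nonnegCone n)) :
    0 < homogenization maslov X :=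
  homogenization_pos abs_maslov_mul_sub_le maslov_one (fun _ => maslov_nonneg_of_mem)
    (fun B => ⟨scalarRotation n (2 * Real.pi * (B + 1) / n), by
      rw [maslov_scalarRotation_turns hn]; linarith⟩) hX

/-- The isometry `[X] ↦ log μ̃(X)`. -/
def logMaslov (hn : 1 ≤ n) : GrowthSpace (isOrderCone_nonnegCone (n := n)) ≃ᵢ ℝ := by
  have hiso : Isometry fun f : DominantSpace (isOrderCone_nonnegCone (n := n)) =>
      Real.log (homogenization maslov f.val) := by
    refine Isometry.of_dist_eq fun f g => ?_
    rw [Real.dist_eq]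
    exact (growthDist_eq isOrderCone_nonnegCone abs_maslov_mul_sub_le maslov_one
      (fun _ => maslov_nonneg_of_mem) (fun _ => mem_nonnegCone_of_le_maslov hn) f.mem g.mem
      (homogenization_maslov_pos hn f.mem) (homogenization_maslov_pos hn g.mem)).symm
  have hlift : Isometry (SeparationQuotient.lift
      (fun f : DominantSpace (isOrderCone_nonnegCone (n := n)) =>
        Real.log (homogenization maslov f.val)) fun f g h => (h.map hiso.continuous).eq) := by
    refine Isometry.of_dist_eq fun f g => ?_
    obtain ⟨f, rfl⟩ := SeparationQuotient.surjective_mk f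
    obtain ⟨g, rfl⟩ := SeparationQuotient.surjective_mk g
    rw [SeparationQuotient.lift_mk, SeparationQuotient.lift_mk, SeparationQuotient.dist_mk]
    exact hiso.dist_eq f g
  exact ⟨Equiv.ofBijective _ ⟨hlift.injective, fun y =>
    ⟨SeparationQuotient.mk ⟨_, scalarRotation_mem_dominants hn (Real.exp_pos y)⟩, by
      rw [SeparationQuotient.lift_mk]
      simp only [homogenization_scalarRotation_turns hn, Real.log_exp]⟩⟩, hlift⟩

end Domination

end

theorem theorem1p2 (n : ℕ) (hn : 1 ≤ n) :
    (∀ x : SpCover n, ∃! m : ℝ, IsMaslovValue x m) ∧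
    IsQuasimorphism (maslov : SpCover n → ℝ) ∧
    (∀ x : SpCover n, Tendsto (fun k : ℕ => maslov (x ^ k) / k) atTop
      (𝓝 (homogenization maslov x))) ∧
    ∃ hC : IsOrderCone (nonnegCone n), ∃ e : GrowthSpace hC ≃ᵢ ℝ,
      ∀ (X : SpCover n) (hX : X ∈ dominants (nonnegCone n)),
        0 < homogenization maslov X ∧
        e (GrowthSpace.mk hC X hX) = Real.log (homogenization maslov X) :=
  ⟨existsUnique_isMaslovValue, isQuasimorphism_maslov,
    tendsto_homogenization abs_maslov_mul_sub_le, isOrderCone_nonnegCone, logMaslov hn,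
    fun _ hX => ⟨homogenization_maslov_pos hn hX, rfl⟩⟩
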